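/- **Setting.** Let $I$ be a (possibly infinite) index set with at least two elements, $\langle\cdot,\cdot\rangle$, $\|\cdot\|$ the inner product and norm of the real space $\ell_2(I)$, and let $A,C$ be bounded symmetric operators on $\ell_2(I)$, $C$ positive definite ($\langle Cx,x\rangle>0$ for $x\ne0$), with $\gamma\|x\|^2\le\langle Ax,x\rangle\le\Gamma\|x\|^2$ for all $x$, where $\gamma,\Gamma>0$. Put $\lambda(x)=\langle Ax,x\rangle/\langle Cx,x\rangle$. Assume that $\lambda_{\min}=\min_{x\ne 0}\lambda(x)>0$ is an eigenvalue, $Au=\lambda_{\min}Cu$ with $\|u\|=1$, and that for some $\Lambda>\lambda_{\min}$ one has $\lambda(x)\ge\Lambda$ for all $x\neq0$ with $\langle Au,x\rangle=0$. Let $x^\perp=x-\langle x,u\rangle u$ and $V_0=\{x:\langle x,u\rangle=0\}$. *Approximation spaces.* $\sigma_N(x)$ is the distance of $x$ to the vectors with at most $N$ nonzero entries, $|x|_{\mathcal A^s}=\sup_{N\in\mathbb N} N^s\sigma_N(x)$, $\|x\|_{\mathcal A^s}=\|x\|+|x|_{\mathcal A^s}$, and $x\in\mathcal A^s$ means $|x|_{\mathcal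 A^s}<\infty$. *Constants.* $\theta=(1-\lambda_{\min}/\Lambda)\gamma$, $\alpha=2/(\theta+\Gamma)$, $\beta=(\Gamma-\theta)/(\Gamma+\theta)$, $\xi=(1+\beta)/2$; $0<a<\gamma/(2\Gamma)$; $K=\lambda_{\min}(1-2\Gamma a/\gamma)^{-1}$, $c_C=\gamma/K$, $C_{C}=\Gamma/\lambda_{\min}$, $\tilde c=2\alpha\Gamma C_C/\gamma$, $d=\min\{\sqrt a,(1-\beta)/(2\tilde cK)\}$. $M_\perp$ is the compression of $A-\lambda_{\min}C$ to $V_0$, $M=2\|M_\perp^{-1}\|$, $\bar\delta=\frac12\{(1+\gamma/(\Gamma K\|C\|\,\|M_\perp^{-1}\|))^{1/2}-1\}$. Fix $0<\varepsilon_0\le\min\{d,\bar\delta\}$, $0<c_1\le\min\{2/(5\varepsilon_0),(\sqrt3+5/2)^{-1}2^{-3/2}\}$, and $0<\bar s<s^*$. *Sparsity and compressibility.* $A$ and $C$ are $s^*$-sparse: for $B\in\{A,C\}$ there is a scheme $APPLY(B,x,\delta)$ which, for finitely supported $x$ and $\delta>0$, produces a finitely supported $w$ with $\|Bx-w\|\le\delta$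 such that, for every compact interval of exponents $s$ in $(0,s^*)$, with a constant $\kappa$ that is uniform on this interval, $\|w\|_{\mathcal A^s}\le\kappa\|x\|_{\mathcal A^s}$, $\#\mathrm{supp}\,w\le\kappa\|x\|_{\mathcal A^s}^{1/s}\delta^{-1/s}$ and the number of operations is at most $\kappa(\|x\|_{\mathcal A^s}^{1/s}\delta^{-1/s}+\#\mathrm{supp}\,x+1)$. Moreover $A$ and $C$ are $s^*$-compressible: for $B\in\{A,C\}$ there are $B_k$ $(k\ge 0)$ with at most $2^k$ nonzero entries in each row and column and $\|B-B_k\|\le c_B2^{-ks^*}\alpha_k$, where $\alpha_{-1},\alpha_0,\alpha_1,\dots>0$ (which may depend on $B$) sum to $1$ and decay algebraically, in the sense that $\alpha_k\ge c(k+2)^{-q}$ for some $c>0$, $q\in\mathbb R$. *Routines.* $APPROX(x,\eta)$ replaces as many entries of the finitely supported $x$ as possible by $0$, subject to an error of at most $\eta$. The simple $SCAL(B,x,\eta)$ is $\langle z,w\rangle$ with $z=APPROX(x,\eta/(2\|B\|))$, $w=APPLY(B,x,\eta/2)$. The improved $SCAL(B,v,\delta)$ is as follows. For $\zeta>0$ let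 $v_\zeta=APPROX(v,\zeta)$, $J(\zeta)=\max\{0,\lceil\log_2(\|v\|/\zeta)/\bar s\rceil\}$, $v_{-1}(\zeta)=v-v_\zeta$, $v_j(\zeta)=v_{2^{j\bar s}\zeta}-v_{2^{(j+1)\bar s}\zeta}$, and $w_\zeta=\sum_{j=0}^{J(\zeta/C')}B_jv_j(\zeta/C')$, where $C'=\|B\|+(1+2^{\bar s})c_B$. With $\epsilon_{-1}=\alpha_{-1}\sqrt\delta$, $\epsilon_j=\alpha_j(1+2^{\bar s})^{-1}2^{-\bar sj}\sqrt\delta$ put $$SCAL(B,v,\delta)=\sum_{j=-1}^{J(\sqrt\delta)}\langle v_j(\sqrt\delta),w_{\epsilon_j}\rangle ,$$ where $w_{\epsilon_j}$ is computed only on $\mathrm{supp}\,v_j(\sqrt\delta)$. $RAYL(x,\eta)$ is the quotient of $SCAL(A,x,\tau c_C/2)$ and $SCAL(C,x,c_C^2\tau/(6\Gamma))$, where $\tau=\min\{\eta,\gamma/c_C,3\Gamma/c_C\}$. $RES(x,\eta)=\alpha\big(APPLY(A,x,\eta/(2\alpha))-\bar\lambda\,APPLY(C,x,\eta/(4\bar\lambda\alpha))\big)$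 with $\bar\lambda=RAYL(x,\eta/(4C_C\alpha))$ (simple $SCAL$), an approximation to $\alpha(A-\lambda(x)C)x$. *Algorithm MINIEIG$(A,C,\varepsilon)$.* Start with $\bar\varepsilon=\varepsilon_0$ and a finitely supported $\bar u=x_0$ with $\|x_0\|=1$, $\|x_0^\perp\|\le\varepsilon_0$. (ii) Put $v=\bar u$, $\eta=(1-\xi)\bar\varepsilon$, $j=0$ and repeat: $r=RES(v,\eta)$, replace $v$ by $(v-r)/\|v-r\|$, increase $j$ by $1$, stop if $j\ge\log(c_1\beta)/\log\xi$ or $\eta+\|r\|\le\alpha c_1\bar\varepsilon/M$, otherwise halve $\eta$. (iii) Let $w=APPROX(v,3c_1\bar\varepsilon/\sqrt2)$, $\bar u=w/\|w\|$. If $\bar\varepsilon/2\le\varepsilon$, stop with output $u(\varepsilon)=\bar u$, $\lambda(\varepsilon)=RAYL(\bar u,\varepsilon)$ (simple $SCAL$); otherwise halve $\bar\varepsilon$ and go to (ii). *Cost.* Vector operations are charged proportionally to the support sizes involved, one call of $APPROX$ proportionally to the support size of its input, a call of $APPLY$ its number of operations, and one entry of $B_jv_j$ proportionally to $1+\min\{2^j,\#\mathrm{supp}\,v_j\}$.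 **Statement.** Let $\lambda^*(\varepsilon)=RAYL(u(\varepsilon),\varepsilon^2)$, with the improved version of $SCAL$. Then, for every $\varepsilon>0$, $$|\lambda_{\min}-\lambda^*(\varepsilon)|\le(1+2\Gamma K/\gamma)\,\varepsilon^2 .$$ If $u\in\mathcal A^s$ for some $0<s\le\bar s$, then, for $0<\varepsilon\le1$, the total number of operations for $\lambda^*(\varepsilon)$ (MINIEIG and the final evaluation of $RAYL$) satisfies $$\#ops(\lambda^*(\varepsilon))\le \mathrm{Const}\cdot\|u\|_{\mathcal A^s}^{\frac{2s+\bar s}{s(s+\bar s)}}\,\varepsilon^{-\frac1s\cdot\frac{\bar s+2s}{s+\bar s}}\qquad\text{and hence}\qquad \#ops(\lambda^*(\varepsilon))\le \mathrm{Const}\cdot\|u\|_{\mathcal A^s}^{\frac{2s+\bar s}{s(s+\bar s)}}\,\varepsilon^{-\frac3{2s}} .$$ Here $\mathrm{Const}$ does not depend on $\varepsilon$, $s$ and $u$: it depends only on $\gamma,\Gamma,\lambda_{\min},\Lambda,a,\varepsilon_0,c_1,s^*,\bar s$, on a bound for $\#\mathrm{supp}\,x_0$, and on the constants and sequences in the sparsity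 and compressibility of $A$ and $C$, and is otherwise uniform over $I$, $A$, $C$, $u$, the routines and $x_0$. -/

import Mathlib

open Finset

universe w

noncomputable section

/-! ### Sequences, best `N`-term approximation and approximation spaces -/

/-- The space of real square summable sequences over the index set `I`. -/
abbrev L2 (I : Type w) := lp (fun _ : I => ℝ) 2

/-- A finitely supported vector, regarded as an element of `ℓ₂(I)`. -/
def toL2 {I : Type w} (x : I →₀ ℝ) : L2 I :=
  ⟨fun i => x i, (memℓp_zero x.hasFiniteSupport).of_exponent_ge zero_le⟩

/-- Number of nonzero entries. -/
def nnz {I : Type w} (x : I →₀ ℝ) : ℕ := x.support.card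

/-- `σ_N(x)`, the error of best `N`-term approximation. -/
def bestErr {I : Type w} (N : ℕ) (x : L2 I) : ℝ :=
  ⨅ z : {z : I →₀ ℝ // nnz z ≤ N}, ‖x - toL2 z.1‖

/-- `x ∈ 𝒜^s`, i.e. `sup_N N^s σ_N(x) < ∞`. -/
def MemA {I : Type w} (s : ℝ) (x : L2 I) : Prop :=
  BddAbove (Set.range fun N : ℕ => (N : ℝ) ^ s * bestErr N x)

/-- `|x|_{𝒜^s} = sup_N N^s σ_N(x)`; used only for `x` with `MemA s x`, which includes all finitely
supported `x`. -/
def semiA {I : Type w} (s : ℝ) (x : L2 I) : ℝ := ⨆ N : ℕ, (N : ℝ) ^ s * bestErr N x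

/-- `‖x‖_{𝒜^s} = ‖x‖ + |x|_{𝒜^s}`. -/
def normA {I : Type w} (s : ℝ) (x : L2 I) : ℝ := ‖x‖ + semiA s x

/-- Normalization of a finitely supported vector. -/
def unitVec {I : Type w} (x : I →₀ ℝ) : I →₀ ℝ := ‖toL2 x‖⁻¹ • x

/-! ### Parameters -/

/-- The data in the bound `‖B - B_k‖ ≤ cst * 2^(-k s*) * α_k` of an `s*`-compressible matrix.
The positive weights `α_{-1}, α_0, α_1, …` sum to one and have algebraic decay, i.e. they do not
decay faster than some power. Indices are shifted by one: `wt 0 = α_{-1}` and `wt (k+1) = α_k`. -/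
structure CompressConst where
  cst : ℝ
  wt : ℕ → ℝ
  wt_pos : ∀ j, 0 < wt j
  wt_sum : HasSum wt 1
  wt_algebraic : ∃ c : ℝ, 0 < c ∧ ∃ q : ℝ, ∀ j : ℕ, c * ((j : ℝ) + 1) ^ (-q) ≤ wt j

/-- All numerical parameters of the problem class and of the algorithm. -/
structure Params where
  /-- ellipticity constants of `A` -/
  gam : ℝ
  Gam : ℝ
  /-- the smallest eigenvalue and the lower bound for the rest of the spectrum -/
  lam : ℝ
  Lam : ℝ
  /-- the number `a`, the initial accuracy `ε₀` and the constant `c₁` of the algorithm -/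
  a : ℝ
  eps0 : ℝ
  c1 : ℝ
  /-- a bound for the support size of the initial guess -/
  n0 : ℕ
  /-- the sparsity and compressibility order `s*` and the order `s̄ < s*` of the scalar products -/
  sstar : ℝ
  sbar : ℝ
  /-- the constants in the compressibility of `A`, `C` -/
  compA : CompressConst
  compC : CompressConst
  /-- the constants in the sparsity of `A`, `C`: `kA s₀ s₁` is for exponents in `[s₀, s₁]` -/
  kA : ℝ → ℝ → ℝ
  kC : ℝ → ℝ → ℝ

namespace Params

variable (P : Params)

def theta : ℝ := (1 - P.lam / P.Lam) * P.gam

/-- `α = 2 / ((1 - λ/Λ) γ + Γ)` -/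
def alpha : ℝ := 2 / (P.theta + P.Gam)

def beta : ℝ := (P.Gam - P.theta) / (P.Gam + P.theta)

def xi : ℝ := (P.beta + 1) / 2

def K : ℝ := P.lam * (1 - 2 * P.Gam * P.a / P.gam)⁻¹

/-- `C_C = Γ/λ`, a bound for the norm of `C` -/
def CC : ℝ := P.Gam / P.lam

/-- `c_C = γ/K`, the local coercivity constant of `C` -/
def cC : ℝ := P.gam / P.K

def ctilde : ℝ := 2 * P.alpha * P.Gam * P.CC / P.gam

def d : ℝ := min (√P.a) ((1 - P.beta) / (2 * P.ctilde * P.K))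

/-- The admissible ranges of the parameters. -/
structure Valid : Prop where
  gam_pos : 0 < P.gam
  Gam_pos : 0 < P.Gam
  lam_pos : 0 < P.lam
  lam_lt : P.lam < P.Lam
  a_pos : 0 < P.a
  a_lt : P.a < P.gam / (2 * P.Gam)
  eps0_pos : 0 < P.eps0
  eps0_le : P.eps0 ≤ P.d
  c1_pos : 0 < P.c1
  c1_le : P.c1 ≤ min (2 / (5 * P.eps0)) ((√3 + 5 / 2)⁻¹ * (2 : ℝ) ^ (-(3 / 2) : ℝ))
  sbar_pos : 0 < P.sbar
  sbar_lt : P.sbar < P.sstar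

end Params

/-! ### The routines `APPROX` and `APPLY`, compressed matrices -/

/-- `APPROX(x, η)` replaces as many entries of `x` as possible by zero, subject to the error
bound `η`. -/
structure IsApprox {I : Type w} (approx : (I →₀ ℝ) → ℝ → (I →₀ ℝ)) : Prop where
  restrict : ∀ x η, 0 < η → ∀ i, approx x η i = x i ∨ approx x η i = 0
  error : ∀ x η, 0 < η → ‖toL2 x - toL2 (approx x η)‖ ≤ η
  minimal : ∀ x η, 0 < η → ∀ z : I →₀ ℝ, ‖toL2 x - toL2 z‖ ≤ η → nnz (approx x η) ≤ nnz z

/-- A scheme `APPLY(B, x, δ)`, with the number of operations that it uses (computation of entries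
of `B` included). -/
structure ApplyScheme {I : Type w} (B : L2 I →L[ℝ] L2 I) where
  run : (I →₀ ℝ) → ℝ → (I →₀ ℝ)
  ops : (I →₀ ℝ) → ℝ → ℕ
  accurate : ∀ x δ, 0 < δ → ‖B (toL2 x) - toL2 (run x δ)‖ ≤ δ

/-- `s*`-sparsity: output support and norm are controlled in `𝒜^s` for all `s < s*`, and the work
is linear in the bound for the output size and the input size. -/
def ApplyScheme.IsSparse {I : Type w} {B : L2 I →L[ℝ] L2 I} (S : ApplyScheme B)
    (sstar : ℝ) (κ : ℝ → ℝ → ℝ) : Prop :=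
  ∀ s₀ s₁ : ℝ, 0 < s₀ → s₁ < sstar → ∀ s ∈ Set.Icc s₀ s₁, ∀ (x : I →₀ ℝ) (δ : ℝ), 0 < δ →
    normA s (toL2 (S.run x δ)) ≤ κ s₀ s₁ * normA s (toL2 x) ∧
    (nnz (S.run x δ) : ℝ) ≤ κ s₀ s₁ * (normA s (toL2 x) / δ) ^ (1 / s) ∧
    (S.ops x δ : ℝ) ≤ κ s₀ s₁ * ((normA s (toL2 x) / δ) ^ (1 / s) + nnz x + 1)

/-- The entry of the (bi-infinite) matrix `T` in row `i`, column `k`. -/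
def entry {I : Type w} (T : L2 I →L[ℝ] L2 I) (i k : I) : ℝ := (T (toL2 (Finsupp.single k 1))) i

/-- `s*`-compressibility of `B`, with compressed versions `Bc k`. -/
def IsCompression {I : Type w} (B : L2 I →L[ℝ] L2 I) (Bc : ℕ → L2 I →L[ℝ] L2 I)
    (sstar : ℝ) (Q : CompressConst) : Prop :=
  ∀ k : ℕ,
    (∀ i, {l | entry (Bc k) i l ≠ 0}.encard ≤ 2 ^ k) ∧
    (∀ l, {i | entry (Bc k) i l ≠ 0}.encard ≤ 2 ^ k) ∧
    ‖B - Bc k‖ ≤ Q.cst * (2 : ℝ) ^ (-((k : ℝ) * sstar)) * Q.wt (k + 1)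

/-! ### The two versions of `SCAL`

Values are paired with operation counts. One call of `APPROX` on `x` is charged `nnz x`
operations. -/

section Scal

variable {I : Type w} (approx : (I →₀ ℝ) → ℝ → (I →₀ ℝ))

/-- The simple version: `z = APPROX(x, η/(2‖B‖))`, `w = APPLY(B, x, η/2)`, `⟨z, w⟩`. -/
def scal {B : L2 I →L[ℝ] L2 I} (S : ApplyScheme B) (x : I →₀ ℝ) (η : ℝ) : ℝ :=
  ∑ i ∈ (approx x (η / (2 * ‖B‖))).support, approx x (η / (2 * ‖B‖)) i * S.run x (η / 2) i

def scalOps {B : L2 I →L[ℝ] L2 I} (S : ApplyScheme B) (x : I →₀ ℝ) (η : ℝ) : ℕ :=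
  nnz x + S.ops x (η / 2) + nnz (S.run x (η / 2)) + 2 * nnz (approx x (η / (2 * ‖B‖)))

variable (sb : ℝ)

/-- `J(ζ) = ⌈log₂(‖v‖/ζ)/s̄⌉`, and `0` if this is negative. -/
def levels (v : I →₀ ℝ) (ζ : ℝ) : ℕ := ⌈Real.logb 2 (‖toL2 v‖ / ζ) / sb⌉₊

/-- The pieces of the decomposition of `v`, with indices shifted by one: `piece 0` is
`v_{-1}(ζ) = v - v_ζ` and `piece (j+1)` is `v_j(ζ)`, the difference of the thresholded versions
of `v` for the tolerances `2^{j s̄} ζ` and `2^{(j+1) s̄} ζ`. -/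
def piece (v : I →₀ ℝ) (ζ : ℝ) : ℕ → (I →₀ ℝ)
  | 0 => v - approx v ζ
  | j + 1 => approx v ((2 : ℝ) ^ ((j : ℝ) * sb) * ζ)
      - approx v ((2 : ℝ) ^ (((j : ℝ) + 1) * sb) * ζ)

/-- `J(ζ) + 2` calls of `APPROX` and as many subtractions. -/
def pieceOps (v : I →₀ ℝ) (ζ : ℝ) : ℕ := (levels sb v ζ + 2) * (2 * nnz v)

/-- Entry `i` of `∑_{j=0}^{J(ζ)} B_j v_j(ζ)`. -/
def applyEntry (Bc : ℕ → L2 I →L[ℝ] L2 I) (v : I →₀ ℝ) (ζ : ℝ) (i : I) : ℝ :=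
  ∑ j ∈ range (levels sb v ζ + 1), (Bc j (toL2 (piece approx sb v ζ (j + 1)))) i

/-- The entry of `B_j v_j(ζ)` in a given row is computed by running through the row of `B_j`, which
has at most `2^j` nonzero entries, or through the support of `v_j(ζ)`, whichever is shorter. -/
def applyEntryOps (v : I →₀ ℝ) (ζ : ℝ) : ℕ :=
  ∑ j ∈ range (levels sb v ζ + 1), (2 * min (2 ^ j) (nnz (piece approx sb v ζ (j + 1))) + 1)

/-- A constant `C'` for which `∑_j B_j v_j(ζ)` approximates `B v` up to `C' ζ`. -/
def applyConst (B : L2 I →L[ℝ] L2 I) (Q : CompressConst) : ℝ := ‖B‖ + (1 + (2 : ℝ) ^ sb) * Q.cst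

/-- The tolerances `ε_{-1}, ε_0, ε_1, …`, with indices shifted by one. -/
def scalTol (Q : CompressConst) (δ : ℝ) : ℕ → ℝ
  | 0 => Q.wt 0 * √δ
  | j + 1 => Q.wt (j + 1) * (1 + (2 : ℝ) ^ sb)⁻¹ * (2 : ℝ) ^ (-(sb * (j : ℝ))) * √δ

/-- The improved version: `∑_{j=-1}^{J(√δ)} ⟨v_j(√δ), w_{ε_j}⟩`, where `w_ζ` approximates `B v` up
to `ζ` and is computed only on the support of `v_j(√δ)`. -/
def scalImp (B : L2 I →L[ℝ] L2 I) (Bc : ℕ → L2 I →L[ℝ] L2 I) (Q : CompressConst)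
    (v : I →₀ ℝ) (δ : ℝ) : ℝ :=
  ∑ l ∈ range (levels sb v (√δ) + 2), ∑ i ∈ (piece approx sb v (√δ) l).support,
    piece approx sb v (√δ) l i *
      applyEntry approx sb Bc v (scalTol sb Q δ l / applyConst sb B Q) i

def scalImpOps (B : L2 I →L[ℝ] L2 I) (Q : CompressConst) (v : I →₀ ℝ) (δ : ℝ) : ℕ :=
  pieceOps sb v (√δ) + ∑ l ∈ range (levels sb v (√δ) + 2),
    (pieceOps sb v (scalTol sb Q δ l / applyConst sb B Q)
      + nnz (piece approx sb v (√δ) l)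
        * (applyEntryOps approx sb v (scalTol sb Q δ l / applyConst sb B Q) + 2))

end Scal

/-! ### `RAYL` on top of a version of `SCAL` -/

/-- The tolerance for which `RAYL` is run: it is capped by `min{γ/c_C, 3Γ/c_C}`. -/
def raylTol (P : Params) (η : ℝ) : ℝ := min η (min (P.gam / P.cC) (3 * P.Gam / P.cC))

/-- `RAYL(x, η)`, where `scA`, `scC` are the scalar product routines for `A`, `C`. -/
def rayl {I : Type w} (P : Params) (scA scC : (I →₀ ℝ) → ℝ → ℝ) (x : I →₀ ℝ) (η : ℝ) : ℝ :=
  scA x (raylTol P η * P.cC / 2) / scC x (P.cC ^ 2 * raylTol P η / (6 * P.Gam))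

def raylOps {I : Type w} (P : Params) (opA opC : (I →₀ ℝ) → ℝ → ℕ) (x : I →₀ ℝ) (η : ℝ) : ℕ :=
  opA x (raylTol P η * P.cC / 2) + opC x (P.cC ^ 2 * raylTol P η / (6 * P.Gam)) + 1

/-! ### The problem and the algorithm -/

/-- The matrices, the eigenvector, the routines and the initial guess. What they have to satisfy is
stated in `Data.Admissible`. -/
structure Data (I : Type w) where
  A : L2 I →L[ℝ] L2 I
  C : L2 I →L[ℝ] L2 I
  u : L2 I
  approx : (I →₀ ℝ) → ℝ → (I →₀ ℝ)
  applyA : ApplyScheme A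
  applyC : ApplyScheme C
  /-- compressed versions of `A`, `C` -/
  Ac : ℕ → L2 I →L[ℝ] L2 I
  Cc : ℕ → L2 I →L[ℝ] L2 I
  /-- initial guess -/
  x0 : I →₀ ℝ

namespace Data

variable {I : Type w} (P : Params) (D : Data I)

/-- The Rayleigh quotient. -/
def rayleigh (x : L2 I) : ℝ := inner ℝ (D.A x) x / inner ℝ (D.C x) x

/-- `x^⊥`, the component of `x` orthogonal to `u`. -/
def perp (x : L2 I) : L2 I := x - (inner ℝ x D.u / inner ℝ D.u D.u) • D.u

/-- `V₀`, the orthogonal complement of `u`. -/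
abbrev V0 : Submodule ℝ (L2 I) := (ℝ ∙ D.u)ᗮ

/-- `M_⊥ = (I - P)(A - λ C)` on `V₀`. -/
def Mperp : D.V0 →L[ℝ] D.V0 :=
  D.V0.orthogonalProjectionOnto ∘L (D.A - P.lam • D.C) ∘L D.V0.subtypeL

/-- `‖M_⊥⁻¹‖` -/
def MperpInvNorm : ℝ := ‖(D.Mperp P).inverse‖

/-- The threshold `δ̄`. -/
def deltaBar : ℝ :=
  1 / 2 * (√(1 + P.gam / (P.Gam * P.K * ‖D.C‖ * D.MperpInvNorm P)) - 1)

/-- `M = 2 ‖M_⊥⁻¹‖` -/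
def Mconst : ℝ := 2 * D.MperpInvNorm P

/-- The assumptions on the problem, the routines and the initial guess. -/
structure Admissible : Prop where
  A_symm : ∀ x y, inner ℝ (D.A x) y = inner ℝ x (D.A y)
  C_symm : ∀ x y, inner ℝ (D.C x) y = inner ℝ x (D.C y)
  A_lower : ∀ x, P.gam * ‖x‖ ^ 2 ≤ inner ℝ (D.A x) x
  A_upper : ∀ x, inner ℝ (D.A x) x ≤ P.Gam * ‖x‖ ^ 2
  C_pos : ∀ x, x ≠ 0 → 0 < inner ℝ (D.C x) x
  u_norm : ‖D.u‖ = 1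
  u_eig : D.A D.u = P.lam • D.C D.u
  lam_min : IsLeast {t | ∃ x, x ≠ 0 ∧ t = D.rayleigh x} P.lam
  gap : ∀ x, x ≠ 0 → inner ℝ (D.A D.u) x = 0 → P.Lam ≤ D.rayleigh x
  approx_spec : IsApprox D.approx
  A_sparse : D.applyA.IsSparse P.sstar P.kA
  C_sparse : D.applyC.IsSparse P.sstar P.kC
  A_comp : IsCompression D.A D.Ac P.sstar P.compA
  C_comp : IsCompression D.C D.Cc P.sstar P.compC
  eps0_le : P.eps0 ≤ D.deltaBar P
  x0_norm : ‖toL2 D.x0‖ = 1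
  x0_near : ‖D.perp (toL2 D.x0)‖ ≤ P.eps0
  x0_nnz : nnz D.x0 ≤ P.n0

/-- `RAYL` based on the simple `SCAL`. -/
def raylSimple (x : I →₀ ℝ) (η : ℝ) : ℝ :=
  rayl P (scal D.approx D.applyA) (scal D.approx D.applyC) x η

def raylSimpleOps (x : I →₀ ℝ) (η : ℝ) : ℕ :=
  raylOps P (scalOps D.approx D.applyA) (scalOps D.approx D.applyC) x η

/-- `RES(x, η)`, an approximation of `α (A - λ(x) C) x`. -/
def res (x : I →₀ ℝ) (η : ℝ) : I →₀ ℝ :=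
  P.alpha • (D.applyA.run x (η / (2 * P.alpha))
    - D.raylSimple P x (η / (4 * P.CC * P.alpha)) •
      D.applyC.run x (η / (4 * D.raylSimple P x (η / (4 * P.CC * P.alpha)) * P.alpha)))

def resOps (x : I →₀ ℝ) (η : ℝ) : ℕ :=
  D.raylSimpleOps P x (η / (4 * P.CC * P.alpha))
    + D.applyA.ops x (η / (2 * P.alpha))
    + D.applyC.ops x (η / (4 * D.raylSimple P x (η / (4 * P.CC * P.alpha)) * P.alpha))
    + 3 * (nnz (D.applyA.run x (η / (2 * P.alpha)))
      + nnz (D.applyC.run x (η / (4 * D.raylSimple P x (η / (4 * P.CC * P.alpha)) * P.alpha))))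

/-- The tolerance in step `j` of an iteration block with accuracy `ε̄ = eb`. -/
def stepTol (eb : ℝ) (j : ℕ) : ℝ := (1 - P.xi) * eb / 2 ^ j

/-- The normalized iterates of an iteration block started at `v` with accuracy `ε̄ = eb`. -/
def iter (v : I →₀ ℝ) (eb : ℝ) : ℕ → (I →₀ ℝ)
  | 0 => v
  | j + 1 => unitVec (iter v eb j - D.res P (iter v eb j) (stepTol P eb j))

/-- The number of steps of an iteration block (do … until). The residual routine approximates the
residual multiplied by `α`, hence the factor `α` in the residual test. -/
def blockLen (v : I →₀ ℝ) (eb : ℝ) : ℕ :=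
  sInf {n | ∃ j : ℕ, n = j + 1 ∧
    (Real.log (P.c1 * P.beta) / Real.log P.xi ≤ (n : ℝ) ∨
      stepTol P eb j + ‖toL2 (D.res P (D.iter P v eb j) (stepTol P eb j))‖
        ≤ P.alpha * P.c1 * eb / D.Mconst P)}

/-- One cycle: an iteration block followed by coarsening and normalization. -/
def cycle (v : I →₀ ℝ) (eb : ℝ) : I →₀ ℝ :=
  unitVec (D.approx (D.iter P v eb (D.blockLen P v eb)) (3 * P.c1 * eb / √2))

/-- Vector updates, norms and normalization after a residual computation are charged
`6 (nnz v + nnz r)`, coarsening and normalization `4 nnz v` operations. -/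
def cycleOps (v : I →₀ ℝ) (eb : ℝ) : ℕ :=
  ∑ j ∈ range (D.blockLen P v eb),
    (D.resOps P (D.iter P v eb j) (stepTol P eb j)
      + 6 * (nnz (D.iter P v eb j) + nnz (D.res P (D.iter P v eb j) (stepTol P eb j))))
  + 4 * nnz (D.iter P v eb (D.blockLen P v eb))

/-- The accuracy `ε̄ = 2^{-k} ε₀` in cycle `k`. -/
def cycleTol (k : ℕ) : ℝ := P.eps0 / 2 ^ k

/-- The input of cycle `k`. -/
def ubar : ℕ → (I →₀ ℝ)
  | 0 => D.x0
  | k + 1 => D.cycle P (ubar k) (cycleTol P k)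

/-- The index of the last cycle: the first `k` for which `ε̄/2 ≤ ε`. -/
def lastCycle (ε : ℝ) : ℕ := sInf {k | cycleTol P k / 2 ≤ ε}

/-- The output `u(ε)` of the eigensolver. -/
def uEps (ε : ℝ) : I →₀ ℝ := D.ubar P (lastCycle P ε + 1)

/-- The output `λ(ε)` of the eigensolver. -/
def lamEps (ε : ℝ) : ℝ := D.raylSimple P (D.uEps P ε) ε

/-- The number of operations of the eigensolver. -/
def eigOps (ε : ℝ) : ℕ :=
  ∑ k ∈ range (lastCycle P ε + 1), D.cycleOps P (D.ubar P k) (cycleTol P k)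
    + D.raylSimpleOps P (D.uEps P ε) ε

/-- `λ*(ε) = RAYL(u(ε), ε²)`, based on the improved version of `SCAL`. -/
def lamStar (ε : ℝ) : ℝ :=
  rayl P (scalImp D.approx P.sbar D.A D.Ac P.compA) (scalImp D.approx P.sbar D.C D.Cc P.compC)
    (D.uEps P ε) (ε ^ 2)

/-- The number of operations that lead to `λ*(ε)`: those of the eigensolver and those of the final
evaluation of the Rayleigh quotient. -/
def lamStarOps (ε : ℝ) : ℕ :=
  D.eigOps P ε
    + raylOps P (scalImpOps D.approx P.sbar D.A P.compA) (scalImpOps D.approx P.sbar D.C P.compC)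
      (D.uEps P ε) (ε ^ 2)

end Data

end

/-!
Accuracy and cost of the adaptive eigensolver with a final improved Rayleigh quotient.

*Convergence.* On the orthogonal complement of `u` the operator `A - λ C` is coercive with
constant `θ` (`theta_mul_le`), so the exact iteration contracts `x^⊥` by `β`, and by `ξ` when the
quadratic error of the Rayleigh quotient is included (`exact_step`). The exact residual is
orthogonal to `x`, so the update has norm at least one, and an error `η` in the residual then adds
at most `η` to the sine of the angle with `u` (`norm_perp_unit_le`). Hence a block of steps ends
with `‖v^⊥‖ ≤ (7/6) c₁ ε̄` whichever criterion stops it (`norm_perp_iter_blockLen_le`), and every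
cycle halves the error (`cycle_spec`). Since the improved scalar product has accuracy `δ`
(`abs_scalImp_sub_le`) and the Rayleigh quotient is quadratically accurate, the error bound
follows.

*Cost of the eigensolver.* The number of steps of a cycle is bounded, so it increases support and
`𝒜^s` norm by constant factors only, and the thresholding tolerance exceeds the distance of `v` to
`±u` by `c₁ ε̄ / 3`, so the output of a cycle is quasi-optimal for `u`
(`exists_cycle_le_of_memA`). With `U = ‖u‖_{𝒜^s}`, a cycle costs `O((U/ε)^(1/s))`, and the
logarithmic number of cycles is absorbed by the surplus factor `(U/ε)^(1/(s+s̄))`.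

*Cost of the improved scalar product.* One entry of the approximation to `B v` costs `∑_j min{2^j,
#supp v_j} ≲ (U/ζ)^(1/(s+s̄))`, since the increasing and the decreasing terms meet where they are
of this size (`sum_min_two_pow_le`, `applyEntryOps_le`). On the support of `v_l(√δ)`, which has
size `2^(-l s̄/s) (U/ε)^(1/s)`, the tolerance is proportional to `2^(-l s̄) ε`, and the product is
summable in `l` because `s ≤ s̄` (`two_rpow_mul_two_rpow_le`, `exists_scalImpOps_le`).

*Uniformity in `s`.* All these constants are uniform for `s` in `[s₀, s̄]` only, `s₀ > 0`. For
smaller `s` the eigenvector turns out to be more regular than assumed: the error is halved in each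
cycle while the supports grow at most geometrically, so that `u` is bounded in `𝒜^{s₀}` for some
`s₀` that depends on the parameters alone (`exists_memA`). As `ε ≤ 1`, the estimate for `s₀`
implies the one for `s < s₀`.
-/

/-! ### Finitely supported vectors and best `N`-term approximation -/

section ApproximationSpaces

variable {I : Type w}

@[simp] lemma toL2_apply (x : I →₀ ℝ) (i : I) : toL2 x i = x i := rfl

lemma toL2_add (x y : I →₀ ℝ) : toL2 (x + y) = toL2 x + toL2 y := by
  ext i; simp

lemma toL2_sub (x y : I →₀ ℝ) : toL2 (x - y) = toL2 x - toL2 y := by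
  ext i; simp

lemma toL2_smul (c : ℝ) (x : I →₀ ℝ) : toL2 (c • x) = c • toL2 x := by
  ext i; simp

@[simp] lemma toL2_zero : toL2 (0 : I →₀ ℝ) = 0 := by
  ext i; simp

lemma toL2_sum {ι : Type*} (t : Finset ι) (f : ι → I →₀ ℝ) :
    toL2 (∑ j ∈ t, f j) = ∑ j ∈ t, toL2 (f j) := by
  classical
  induction t using Finset.induction_on with
  | empty => simp
  | insert a t ha ih => rw [Finset.sum_insert ha, Finset.sum_insert ha, toL2_add, ih]

lemma inner_toL2 (x : I →₀ ℝ) (f : L2 I) :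
    inner ℝ (toL2 x) f = ∑ i ∈ x.support, x i * f i := by
  rw [lp.inner_eq_tsum, tsum_eq_sum (s := x.support)]
  · refine Finset.sum_congr rfl fun i _ => ?_
    simp [mul_comm]
  · intro i hi
    simp [Finsupp.notMem_support_iff.1 hi]

lemma norm_toL2_le_of_restrict {x y : I →₀ ℝ} (h : ∀ i, y i = x i ∨ y i = 0) :
    ‖toL2 y‖ ≤ ‖toL2 x‖ := by
  have h1 : inner ℝ (toL2 y) (toL2 x) = inner ℝ (toL2 y) (toL2 y) := by
    rw [inner_toL2, inner_toL2]
    refine Finset.sum_congr rfl fun i hi => ?_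
    rcases h i with h | h
    · simp [h]
    · simp [h]
  have h2 := real_inner_le_norm (toL2 y) (toL2 x)
  rw [h1, real_inner_self_eq_norm_mul_norm] at h2
  rcases (norm_nonneg (toL2 y)).eq_or_lt with h3 | h3
  · rw [← h3]; exact norm_nonneg _
  · exact le_of_mul_le_mul_left h2 h3

lemma nnz_add_le (x y : I →₀ ℝ) : nnz (x + y) ≤ nnz x + nnz y := by
  classical
  exact (Finset.card_le_card Finsupp.support_add).trans (Finset.card_union_le _ _)

lemma nnz_sub_le (x y : I →₀ ℝ) : nnz (x - y) ≤ nnz x + nnz y := by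
  classical
  exact (Finset.card_le_card Finsupp.support_sub).trans (Finset.card_union_le _ _)

lemma nnz_smul_le (c : ℝ) (x : I →₀ ℝ) : nnz (c • x) ≤ nnz x :=
  Finset.card_le_card Finsupp.support_smul

@[simp] lemma nnz_zero : nnz (0 : I →₀ ℝ) = 0 := by simp [nnz]

lemma nnz_le_of_restrict {x y : I →₀ ℝ} (h : ∀ i, y i = x i ∨ y i = 0) : nnz y ≤ nnz x := by
  refine Finset.card_le_card fun i hi => ?_
  rw [Finsupp.mem_support_iff] at hi ⊢
  rcases h i with h | h
  · rwa [← h]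
  · exact absurd h hi

lemma bddBelow_bestErr (N : ℕ) (x : L2 I) :
    BddBelow (Set.range fun z : {z : I →₀ ℝ // nnz z ≤ N} => ‖x - toL2 z.1‖) :=
  ⟨0, by rintro _ ⟨z, rfl⟩; exact norm_nonneg _⟩

instance nonempty_nnz_le (N : ℕ) : Nonempty {z : I →₀ ℝ // nnz z ≤ N} := ⟨⟨0, by simp⟩⟩

lemma bestErr_nonneg (N : ℕ) (x : L2 I) : 0 ≤ bestErr N x :=
  Real.iInf_nonneg fun _ => norm_nonneg _

lemma bestErr_le {N : ℕ} (x : L2 I) (z : I →₀ ℝ) (hz : nnz z ≤ N) :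
    bestErr N x ≤ ‖x - toL2 z‖ :=
  ciInf_le (bddBelow_bestErr N x) ⟨z, hz⟩

lemma exists_of_bestErr_lt {N : ℕ} {x : L2 I} {g : ℝ} (h : bestErr N x < g) :
    ∃ z : I →₀ ℝ, nnz z ≤ N ∧ ‖x - toL2 z‖ < g := by
  obtain ⟨z, hz⟩ := exists_lt_of_ciInf_lt h
  exact ⟨z.1, z.2, hz⟩

lemma bestErr_le_norm (N : ℕ) (x : L2 I) : bestErr N x ≤ ‖x‖ := by
  simpa using bestErr_le x 0 (by simp : nnz (0 : I →₀ ℝ) ≤ N)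

lemma bestErr_anti {N M : ℕ} (h : N ≤ M) (x : L2 I) : bestErr M x ≤ bestErr N x :=
  le_ciInf fun z => bestErr_le x z.1 (z.2.trans h)

lemma bestErr_add_le (N M : ℕ) (x y : L2 I) :
    bestErr (N + M) (x + y) ≤ bestErr N x + bestErr M y := by
  refine le_of_forall_pos_le_add fun e he => ?_
  obtain ⟨z, hz, hz'⟩ := exists_of_bestErr_lt (show bestErr N x < bestErr N x + e / 2 by linarith)
  obtain ⟨t, ht, ht'⟩ := exists_of_bestErr_lt (show bestErr M y < bestErr M y + e / 2 by linarith)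
  have h1 := bestErr_le (x + y) (z + t) ((nnz_add_le z t).trans (add_le_add hz ht))
  have h2 : x + y - toL2 (z + t) = (x - toL2 z) + (y - toL2 t) := by rw [toL2_add]; abel
  rw [h2] at h1
  linarith [norm_add_le (x - toL2 z) (y - toL2 t)]

lemma bestErr_le_add_norm_sub (N : ℕ) (x y : L2 I) : bestErr N x ≤ bestErr N y + ‖x - y‖ := by
  have h := bestErr_add_le N 0 y (x - y)
  rw [add_sub_cancel, add_zero] at h
  exact h.trans (by gcongr; exact bestErr_le_norm _ _)

lemma bestErr_smul_le (N : ℕ) (c : ℝ) (x : L2 I) : bestErr N (c • x) ≤ |c| * bestErr N x := by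
  rw [bestErr, bestErr, Real.mul_iInf_of_nonneg (abs_nonneg c)]
  refine le_ciInf fun z => ?_
  refine (bestErr_le (c • x) (c • z.1) ((nnz_smul_le c z.1).trans z.2)).trans ?_
  rw [toL2_smul, ← smul_sub, norm_smul, Real.norm_eq_abs]

lemma bestErr_toL2_eq_zero {N : ℕ} (x : I →₀ ℝ) (h : nnz x ≤ N) : bestErr N (toL2 x) = 0 :=
  le_antisymm (by simpa using bestErr_le (toL2 x) x h) (bestErr_nonneg _ _)

lemma bestErr_le_of_restrict {x y : I →₀ ℝ} (h : ∀ i, y i = x i ∨ y i = 0) (N : ℕ) :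
    bestErr N (toL2 y) ≤ bestErr N (toL2 x) := by
  classical
  refine le_ciInf fun z => ?_
  have hr : ∀ i, z.1.filter (· ∈ y.support) i = z.1 i ∨ z.1.filter (· ∈ y.support) i = 0 := by
    intro i
    by_cases hi : i ∈ y.support
    · exact Or.inl (Finsupp.filter_apply_pos _ _ hi)
    · exact Or.inr (Finsupp.filter_apply_neg _ _ hi)
  refine (bestErr_le (toL2 y) _ ((nnz_le_of_restrict hr).trans z.2)).trans ?_
  rw [← toL2_sub, ← toL2_sub]
  refine norm_toL2_le_of_restrict fun i => ?_
  by_cases hi : i ∈ y.support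
  · left
    rw [Finsupp.sub_apply, Finsupp.sub_apply, Finsupp.filter_apply_pos _ _ hi]
    rcases h i with h | h
    · rw [h]
    · exact absurd h (Finsupp.mem_support_iff.1 hi)
  · right
    rw [Finsupp.sub_apply, Finsupp.filter_apply_neg _ _ hi, Finsupp.notMem_support_iff.1 hi,
      sub_zero]

/-! ### Approximation spaces -/

lemma rpow_mul_bestErr_le {s : ℝ} {x : L2 I} (h : MemA s x) (N : ℕ) :
    (N : ℝ) ^ s * bestErr N x ≤ semiA s x :=
  le_ciSup h N

lemma semiA_nonneg {s : ℝ} (x : L2 I) : 0 ≤ semiA s x :=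
  Real.iSup_nonneg fun N => mul_nonneg (by positivity) (bestErr_nonneg _ _)

lemma norm_le_normA {s : ℝ} (x : L2 I) : ‖x‖ ≤ normA s x := by
  unfold normA; linarith [semiA_nonneg (s := s) x]

lemma normA_nonneg {s : ℝ} (x : L2 I) : 0 ≤ normA s x := (norm_nonneg x).trans (norm_le_normA x)

lemma semiA_le_normA {s : ℝ} (x : L2 I) : semiA s x ≤ normA s x := by
  unfold normA; linarith [norm_nonneg x]

lemma memA_of_le {s b : ℝ} {x : L2 I} (h : ∀ N : ℕ, (N : ℝ) ^ s * bestErr N x ≤ b) : MemA s x :=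
  ⟨b, by rintro _ ⟨N, rfl⟩; exact h N⟩

lemma rpow_mul_bestErr_toL2_le {s : ℝ} (hs : 0 < s) (x : I →₀ ℝ) (N : ℕ) :
    (N : ℝ) ^ s * bestErr N (toL2 x) ≤ (nnz x : ℝ) ^ s * ‖toL2 x‖ := by
  rcases le_total (nnz x) N with h | h
  · rw [bestErr_toL2_eq_zero x h, mul_zero]; positivity
  · exact mul_le_mul (Real.rpow_le_rpow (by positivity) (by exact_mod_cast h) hs.le)
      (bestErr_le_norm _ _) (bestErr_nonneg _ _) (by positivity)

lemma memA_toL2 {s : ℝ} (hs : 0 < s) (x : I →₀ ℝ) : MemA s (toL2 x) :=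
  memA_of_le (rpow_mul_bestErr_toL2_le hs x)

lemma normA_toL2_le {s : ℝ} (hs : 0 < s) (x : I →₀ ℝ) :
    normA s (toL2 x) ≤ (1 + (nnz x : ℝ) ^ s) * ‖toL2 x‖ := by
  unfold normA semiA
  have := ciSup_le (rpow_mul_bestErr_toL2_le hs x)
  linarith

/-- A finitely supported vector near `y ∈ 𝒜^s` is bounded in `𝒜^s` by `y`, up to an inverse
estimate for the difference. -/
lemma normA_toL2_le_of_near {s : ℝ} (hs : 0 < s) (x : I →₀ ℝ) {y : L2 I} (hy : MemA s y) :
    normA s (toL2 x) ≤ ‖toL2 x‖ + semiA s y + (nnz x : ℝ) ^ s * ‖toL2 x - y‖ := by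
  unfold normA
  rw [add_assoc]
  gcongr
  refine ciSup_le fun N => ?_
  rcases le_total (nnz x) N with h | h
  · rw [bestErr_toL2_eq_zero x h, mul_zero]
    have := semiA_nonneg (s := s) y
    positivity
  · calc (N : ℝ) ^ s * bestErr N (toL2 x) ≤ (N : ℝ) ^ s * (bestErr N y + ‖toL2 x - y‖) := by
          gcongr; exact bestErr_le_add_norm_sub _ _ _
      _ = (N : ℝ) ^ s * bestErr N y + (N : ℝ) ^ s * ‖toL2 x - y‖ := by ring
      _ ≤ _ := by
          gcongr
          exact rpow_mul_bestErr_le hy N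

lemma normA_smul_le {s : ℝ} (c : ℝ) {x : L2 I} (hx : MemA s x) :
    normA s (c • x) ≤ |c| * normA s x := by
  unfold normA
  rw [mul_add, norm_smul, Real.norm_eq_abs]
  gcongr
  refine ciSup_le fun N => ?_
  calc (N : ℝ) ^ s * bestErr N (c • x) ≤ (N : ℝ) ^ s * (|c| * bestErr N x) := by
        gcongr; exact bestErr_smul_le _ _ _
    _ = |c| * ((N : ℝ) ^ s * bestErr N x) := by ring
    _ ≤ _ := by gcongr; exact rpow_mul_bestErr_le hx N

lemma memA_smul {s : ℝ} (c : ℝ) {x : L2 I} (hx : MemA s x) : MemA s (c • x) :=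
  memA_of_le (b := |c| * semiA s x) fun N => by
    calc (N : ℝ) ^ s * bestErr N (c • x) ≤ (N : ℝ) ^ s * (|c| * bestErr N x) := by
          gcongr; exact bestErr_smul_le _ _ _
      _ = |c| * ((N : ℝ) ^ s * bestErr N x) := by ring
      _ ≤ _ := by gcongr; exact rpow_mul_bestErr_le hx N

lemma normA_le_of_restrict {s : ℝ} (hs : 0 < s) {x y : I →₀ ℝ} (h : ∀ i, y i = x i ∨ y i = 0) :
    normA s (toL2 y) ≤ normA s (toL2 x) := by
  unfold normA
  gcongr
  · exact norm_toL2_le_of_restrict h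
  · refine ciSup_le fun N => ?_
    refine le_trans ?_ (rpow_mul_bestErr_le (memA_toL2 hs x) N)
    gcongr
    exact bestErr_le_of_restrict h N

/-- The quasi-triangle inequality in `𝒜^s`. -/
lemma normA_add_le {s : ℝ} (hs : 0 < s) {x y : L2 I} (hx : MemA s x) (hy : MemA s y) :
    normA s (x + y) ≤ 2 * 3 ^ s * (normA s x + normA s y) := by
  have h3 : (1 : ℝ) ≤ 3 ^ s := Real.one_le_rpow (by norm_num) hs.le
  have hxn := normA_nonneg (s := s) x
  have hyn := normA_nonneg (s := s) y
  have key : semiA s (x + y) ≤ 3 ^ s * (normA s x + normA s y) := by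
    refine ciSup_le fun N => ?_
    rcases Nat.lt_or_ge N 2 with hN | hN
    · have h0 : (N : ℝ) ^ s ≤ 1 :=
        Real.rpow_le_one (by positivity) (by exact_mod_cast Nat.lt_succ_iff.1 hN) hs.le
      calc (N : ℝ) ^ s * bestErr N (x + y) ≤ 1 * (normA s x + normA s y) := by
            refine mul_le_mul h0 ?_ (bestErr_nonneg _ _) (by norm_num)
            exact (bestErr_le_norm _ _).trans ((norm_add_le _ _).trans
              (add_le_add (norm_le_normA _) (norm_le_normA _)))
        _ ≤ _ := by gcongr
    · have h1 : bestErr N (x + y) ≤ bestErr (N / 2) x + bestErr (N / 2) y :=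
        (bestErr_anti (by omega) _).trans (bestErr_add_le _ _ x y)
      have h2 : (N : ℝ) ^ s ≤ 3 ^ s * ((N / 2 : ℕ) : ℝ) ^ s := by
        rw [← Real.mul_rpow (by norm_num) (by positivity)]
        refine Real.rpow_le_rpow (by positivity) ?_ hs.le
        have : N ≤ 3 * (N / 2) := by omega
        exact_mod_cast this
      calc (N : ℝ) ^ s * bestErr N (x + y)
          ≤ 3 ^ s * ((N / 2 : ℕ) : ℝ) ^ s * (bestErr (N / 2) x + bestErr (N / 2) y) :=
            mul_le_mul h2 h1 (bestErr_nonneg _ _) (by positivity)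
        _ = 3 ^ s * (((N / 2 : ℕ) : ℝ) ^ s * bestErr (N / 2) x
              + ((N / 2 : ℕ) : ℝ) ^ s * bestErr (N / 2) y) := by ring
        _ ≤ _ := by
            gcongr
            · exact (rpow_mul_bestErr_le hx _).trans (semiA_le_normA _)
            · exact (rpow_mul_bestErr_le hy _).trans (semiA_le_normA _)
  have : ‖x + y‖ ≤ 3 ^ s * (normA s x + normA s y) := by
    calc ‖x + y‖ ≤ 1 * (normA s x + normA s y) := by
          rw [one_mul]
          exact (norm_add_le _ _).trans (add_le_add (norm_le_normA _) (norm_le_normA _))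
      _ ≤ _ := by gcongr
  unfold normA at *
  linarith

lemma normA_sub_le {s : ℝ} (hs : 0 < s) {x y : L2 I} (hx : MemA s x) (hy : MemA s y) :
    normA s (x - y) ≤ 2 * 3 ^ s * (normA s x + normA s y) := by
  have h1 := normA_add_le hs hx (memA_smul (-1) hy)
  have h2 := normA_smul_le (-1) hy
  simp only [neg_smul, one_smul, abs_neg, abs_one, one_mul] at h1 h2
  rw [sub_eq_add_neg]
  refine h1.trans ?_
  gcongr

/-! ### Thresholding -/

variable {approx : (I →₀ ℝ) → ℝ → (I →₀ ℝ)}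

/-- Coarsening: thresholding `v` with a tolerance that exceeds its distance to `y ∈ 𝒜^s` by `g`
leaves no more entries than a best approximation of `y` with error `g` has. -/
lemma IsApprox.nnz_le_of_near (ha : IsApprox approx) {s : ℝ} (hs : 0 < s) {y : L2 I}
    (hy : MemA s y) (v : I →₀ ℝ) {η g : ℝ} (hg : 0 < g) (h : ‖toL2 v - y‖ + g ≤ η) :
    (nnz (approx v η) : ℝ) ≤ (normA s y / g) ^ (1 / s) + 1 := by
  have hη : 0 < η := by linarith [norm_nonneg (toL2 v - y)]
  have hy0 := normA_nonneg (s := s) y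
  set t : ℝ := (normA s y / g) ^ (1 / s) with ht
  have ht0 : 0 ≤ t := by positivity
  have hlt : t < (⌊t⌋₊ + 1 : ℕ) := by exact_mod_cast Nat.lt_floor_add_one t
  set N : ℕ := ⌊t⌋₊ + 1 with hN
  have hN0 : (0 : ℝ) < N := by positivity
  have h1 : normA s y / g < (N : ℝ) ^ s := by
    have := Real.rpow_lt_rpow ht0 hlt hs
    rwa [ht, ← Real.rpow_mul (by positivity), one_div_mul_cancel hs.ne', Real.rpow_one] at this
  have h2 : bestErr N y < g := by
    have h3 := (rpow_mul_bestErr_le hy N).trans (semiA_le_normA y)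
    rw [div_lt_iff₀ hg] at h1
    exact lt_of_mul_lt_mul_left (h3.trans_lt h1) (by positivity)
  obtain ⟨z, hz, hz'⟩ := exists_of_bestErr_lt h2
  have h4 : ‖toL2 v - toL2 z‖ ≤ η := by
    calc ‖toL2 v - toL2 z‖ = ‖(toL2 v - y) + (y - toL2 z)‖ := by congr 1; abel
      _ ≤ ‖toL2 v - y‖ + ‖y - toL2 z‖ := norm_add_le _ _
      _ ≤ η := by linarith
  have h5 : (nnz (approx v η) : ℝ) ≤ N := by
    exact_mod_cast (ha.minimal v η hη z h4).trans hz
  refine h5.trans ?_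
  rw [hN]
  push_cast
  gcongr
  exact Nat.floor_le ht0

lemma IsApprox.eq_zero (ha : IsApprox approx) {v : I →₀ ℝ} {η : ℝ} (hη : 0 < η)
    (h : ‖toL2 v‖ ≤ η) : approx v η = 0 := by
  have := ha.minimal v η hη 0 (by simpa using h)
  simpa [nnz] using this

lemma IsApprox.nnz_le (ha : IsApprox approx) {s : ℝ} (hs : 0 < s) (v : I →₀ ℝ) {η : ℝ}
    (hη : 0 < η) : (nnz (approx v η) : ℝ) ≤ 2 * (normA s (toL2 v) / η) ^ (1 / s) := by
  have hv0 := normA_nonneg (s := s) (toL2 v)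
  rcases le_or_gt ‖toL2 v‖ η with h | h
  · rw [ha.eq_zero hη h]
    simp only [nnz_zero, Nat.cast_zero]
    positivity
  · have h1 := ha.nnz_le_of_near hs (memA_toL2 hs v) v (η := η) hη (by simp)
    have h2 : 1 ≤ (normA s (toL2 v) / η) ^ (1 / s) := by
      refine Real.one_le_rpow ?_ (by positivity)
      rw [one_le_div hη]
      exact h.le.trans (norm_le_normA _)
    linarith

lemma IsApprox.norm_le (ha : IsApprox approx) (v : I →₀ ℝ) {η : ℝ} (hη : 0 < η) :
    ‖toL2 (approx v η)‖ ≤ ‖toL2 v‖ :=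
  norm_toL2_le_of_restrict (ha.restrict v η hη)

lemma IsApprox.nnz_le_self (ha : IsApprox approx) (v : I →₀ ℝ) {η : ℝ} (hη : 0 < η) :
    nnz (approx v η) ≤ nnz v :=
  nnz_le_of_restrict (ha.restrict v η hη)

lemma IsApprox.nnz_anti (ha : IsApprox approx) (v : I →₀ ℝ) {η ζ : ℝ} (hη : 0 < η) (h : η ≤ ζ) :
    nnz (approx v ζ) ≤ nnz (approx v η) :=
  ha.minimal v ζ (hη.trans_le h) _ ((ha.error v η hη).trans h)

/-! ### Normalization -/

lemma norm_unitVec {x : I →₀ ℝ} (h : toL2 x ≠ 0) : ‖toL2 (unitVec x)‖ = 1 := by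
  rw [unitVec, toL2_smul, norm_smul, norm_inv, norm_norm, inv_mul_cancel₀ (norm_ne_zero_iff.2 h)]

lemma nnz_unitVec_le (x : I →₀ ℝ) : nnz (unitVec x) ≤ nnz x := nnz_smul_le _ _

lemma normA_unitVec_le {s : ℝ} (hs : 0 < s) {x : I →₀ ℝ} (h : 1 / 2 ≤ ‖toL2 x‖) :
    normA s (toL2 (unitVec x)) ≤ 2 * normA s (toL2 x) := by
  rw [unitVec, toL2_smul]
  refine (normA_smul_le _ (memA_toL2 hs x)).trans ?_
  have := normA_nonneg (s := s) (toL2 x)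
  gcongr
  rw [abs_inv, abs_norm]
  exact inv_le_of_inv_le₀ (by norm_num) (by linarith)

end ApproximationSpaces

/-! ### Parameters -/

lemma Params.one_sub_xi (P : Params) : 1 - P.xi = (1 - P.beta) / 2 := by
  unfold Params.xi; ring

namespace Params.Valid

variable {P : Params} (hP : P.Valid)
include hP

lemma theta_pos : 0 < P.theta := by
  have h1 := hP.lam_pos
  have h2 := hP.lam_lt
  refine mul_pos ?_ hP.gam_pos
  rw [sub_pos, div_lt_one (h1.trans h2)]
  exact h2

lemma theta_lt : P.theta < P.gam := by
  have h1 := hP.lam_pos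
  have h2 := hP.lam_lt
  have h3 : 0 < P.lam / P.Lam := div_pos h1 (h1.trans h2)
  unfold Params.theta
  nlinarith [hP.gam_pos]

lemma alpha_pos : 0 < P.alpha := div_pos two_pos (add_pos hP.theta_pos hP.Gam_pos)

lemma one_sub_beta : 1 - P.beta = P.alpha * P.theta := by
  have := hP.theta_pos
  have := hP.Gam_pos
  unfold Params.beta Params.alpha
  field_simp
  ring

lemma one_add_beta : 1 + P.beta = P.alpha * P.Gam := by
  have := hP.theta_pos
  have := hP.Gam_pos
  unfold Params.beta Params.alpha
  field_simp
  ring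

lemma beta_lt_one : P.beta < 1 := by
  have := hP.one_sub_beta
  have := mul_pos hP.alpha_pos hP.theta_pos
  linarith

lemma beta_pos (h : P.gam ≤ P.Gam) : 0 < P.beta :=
  div_pos (by linarith [hP.theta_lt]) (add_pos hP.Gam_pos hP.theta_pos)

lemma xi_lt_one : P.xi < 1 := by
  unfold Params.xi; linarith [hP.beta_lt_one]

lemma two_mul_lt : 2 * P.Gam * P.a < P.gam := by
  have h := hP.a_lt
  rw [lt_div_iff₀ (mul_pos two_pos hP.Gam_pos)] at h
  linarith

lemma K_eq : P.K = P.lam * P.gam / (P.gam - 2 * P.Gam * P.a) := by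
  have h := hP.two_mul_lt
  have h1 := hP.gam_pos
  have h2 : P.gam - 2 * P.Gam * P.a ≠ 0 := by linarith
  have h3 : 1 - 2 * P.Gam * P.a / P.gam = (P.gam - 2 * P.Gam * P.a) / P.gam := by
    field_simp
  unfold Params.K
  rw [h3, inv_div, mul_div_assoc]

lemma K_pos : 0 < P.K := by
  rw [hP.K_eq]
  have := hP.two_mul_lt
  exact div_pos (mul_pos hP.lam_pos hP.gam_pos) (by linarith)

lemma cC_pos : 0 < P.cC := div_pos hP.gam_pos hP.K_pos

lemma lam_mul_cC : P.lam * P.cC = P.gam - 2 * P.Gam * P.a := by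
  have h := hP.two_mul_lt
  have h1 := hP.gam_pos
  have h3 := hP.lam_pos
  have h2 : P.gam - 2 * P.Gam * P.a ≠ 0 := by linarith
  unfold Params.cC
  rw [hP.K_eq]
  field_simp

lemma CC_pos : 0 < P.CC := div_pos hP.Gam_pos hP.lam_pos

lemma ctilde_pos : 0 < P.ctilde :=
  div_pos (mul_pos (mul_pos (mul_pos two_pos hP.alpha_pos) hP.Gam_pos) hP.CC_pos) hP.gam_pos

lemma eps0_sq_le : P.eps0 ^ 2 ≤ P.a := by
  have h : P.eps0 ≤ √P.a := hP.eps0_le.trans (min_le_left _ _)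
  calc P.eps0 ^ 2 ≤ √P.a ^ 2 := by
        have := hP.eps0_pos
        gcongr
    _ = P.a := Real.sq_sqrt hP.a_pos.le

lemma ctilde_mul_eps0_le : P.ctilde * P.K * P.eps0 ≤ (1 - P.beta) / 2 := by
  have h : P.eps0 ≤ (1 - P.beta) / (2 * P.ctilde * P.K) := hP.eps0_le.trans (min_le_right _ _)
  have h1 := hP.ctilde_pos
  have h2 := hP.K_pos
  rw [le_div_iff₀ (by positivity)] at h
  linarith

lemma eps0_lt_one (h : P.gam ≤ P.Gam) : P.eps0 < 1 := by
  have h1 := hP.eps0_sq_le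
  have h2 := hP.two_mul_lt
  have h3 := hP.Gam_pos
  have : P.a < 1 := by nlinarith [hP.a_pos]
  nlinarith

lemma c1_le_tenth : P.c1 ≤ 1 / 10 := by
  have h : P.c1 ≤ (√3 + 5 / 2)⁻¹ * (2 : ℝ) ^ (-(3 / 2) : ℝ) := hP.c1_le.trans (min_le_right _ _)
  refine h.trans ?_
  have h2 : (2 : ℝ) ^ (-(3 / 2) : ℝ) ≤ 2 / 5 := by
    have : (2 : ℝ) ^ (-(3 / 2) : ℝ) = (√2)⁻¹ * 2⁻¹ := by
      rw [show (-(3 / 2) : ℝ) = -(1 / 2) + (-1) by norm_num, Real.rpow_add two_pos,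
        Real.rpow_neg two_pos.le, ← Real.sqrt_eq_rpow, Real.rpow_neg_one]
    rw [this]
    have h3 : 5 / 4 ≤ √2 := Real.le_sqrt_of_sq_le (by norm_num)
    have h4 : (√2)⁻¹ ≤ 4 / 5 := by
      rw [inv_le_comm₀ (by linarith) (by norm_num)]
      linarith
    linarith
  have h5 : (√3 + 5 / 2)⁻¹ ≤ 1 / 4 := by
    have h3 : 3 / 2 ≤ √3 := Real.le_sqrt_of_sq_le (by norm_num)
    rw [inv_le_comm₀ (by linarith) (by norm_num)]
    linarith
  calc _ ≤ (1 / 4 : ℝ) * (2 / 5) := mul_le_mul h5 h2 (by positivity) (by norm_num)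
    _ = 1 / 10 := by norm_num

end Params.Valid

/-! ### Symmetric operators -/

section Symmetric

variable {H : Type*} [NormedAddCommGroup H] [InnerProductSpace ℝ H]

/-- The norm of a symmetric operator is bounded by its numerical radius. -/
lemma norm_apply_le_of_abs_inner_le {T : H →ₗ[ℝ] H} (hT : ∀ x y, inner ℝ (T x) y = inner ℝ x (T y))
    {c : ℝ} (h : ∀ x, |inner ℝ (T x) x| ≤ c * ‖x‖ ^ 2) (x : H) : ‖T x‖ ≤ c * ‖x‖ := by
  have key : ∀ x y, 2 * inner ℝ (T x) y ≤ c * (‖x‖ ^ 2 + ‖y‖ ^ 2) := by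
    intro x y
    have h1 := (abs_le.1 (h (x + y))).2
    have h2 := (abs_le.1 (h (x - y))).1
    have h3 := parallelogram_law_with_norm ℝ x y
    have h4 : inner ℝ (T (x + y)) (x + y) - inner ℝ (T (x - y)) (x - y)
        = 4 * inner ℝ (T x) y := by
      have h5 : inner ℝ (T y) x = inner ℝ (T x) y := by
        rw [hT y x, real_inner_comm]
      simp only [map_add, map_sub, inner_add_left, inner_add_right, inner_sub_left,
        inner_sub_right, h5]
      ring
    have h6 : c * ‖x + y‖ ^ 2 + c * ‖x - y‖ ^ 2 = c * (2 * (‖x‖ ^ 2 + ‖y‖ ^ 2)) := by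
      rw [← mul_add, h3]
    linarith
  rcases eq_or_ne (T x) 0 with h0 | h0
  · rw [h0, norm_zero]
    rcases eq_or_ne x 0 with hx | hx
    · simp [hx]
    · have h1 := (abs_nonneg _).trans (h x)
      have h2 : 0 < ‖x‖ := norm_pos_iff.2 hx
      exact mul_nonneg (nonneg_of_mul_nonneg_left h1 (by positivity)) h2.le
  · have h1 : 0 < ‖T x‖ := norm_pos_iff.2 h0
    have h2 : 0 < ‖x‖ := norm_pos_iff.2 fun hx => h0 (by simp [hx])
    have h3 := key x ((‖x‖ / ‖T x‖) • T x)
    rw [inner_smul_right, real_inner_self_eq_norm_sq, norm_smul, Real.norm_eq_abs,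
      abs_of_pos (by positivity)] at h3
    have h4 : ‖x‖ / ‖T x‖ * ‖T x‖ ^ 2 = ‖x‖ * ‖T x‖ := by field_simp
    have h5 : ‖x‖ / ‖T x‖ * ‖T x‖ = ‖x‖ := by field_simp
    rw [h4, h5] at h3
    have h6 : ‖x‖ * ‖T x‖ ≤ ‖x‖ * (c * ‖x‖) := by nlinarith
    exact le_of_mul_le_mul_left h6 h2

end Symmetric

/-! ### The component orthogonal to the eigenvector -/

namespace Data

variable {I : Type w} (D : Data I)

/-- `x ↦ x^⊥` as a linear map. -/
noncomputable def perpL : L2 I →ₗ[ℝ] L2 I where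
  toFun := D.perp
  map_add' x y := by
    simp only [perp, inner_add_left, add_div, add_smul]
    abel
  map_smul' c x := by
    simp only [perp, inner_smul_left, RingHom.id_apply, smul_sub, smul_smul, mul_div_assoc,
      conj_trivial]

lemma perp_sub (x y : L2 I) : D.perp (x - y) = D.perp x - D.perp y := D.perpL.map_sub x y

lemma perp_smul (c : ℝ) (x : L2 I) : D.perp (c • x) = c • D.perp x := D.perpL.map_smul c x

variable {D} {P : Params}

namespace Admissible

variable (h : D.Admissible P)
include h

lemma inner_u_u : inner ℝ D.u D.u = 1 := by
  rw [real_inner_self_eq_norm_sq, h.u_norm, one_pow]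

lemma u_ne_zero : D.u ≠ 0 := by
  intro h0
  have := h.u_norm
  simp [h0] at this

lemma perp_eq (x : L2 I) : D.perp x = x - inner ℝ x D.u • D.u := by
  rw [perp, h.inner_u_u, div_one]

lemma inner_perp_u (x : L2 I) : inner ℝ (D.perp x) D.u = 0 := by
  rw [h.perp_eq, inner_sub_left, inner_smul_left, h.inner_u_u]
  simp

lemma perp_of_inner_eq_zero {x : L2 I} (hx : inner ℝ x D.u = 0) : D.perp x = x := by
  rw [h.perp_eq, hx, zero_smul, sub_zero]

lemma perp_perp (x : L2 I) : D.perp (D.perp x) = D.perp x :=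
  h.perp_of_inner_eq_zero (h.inner_perp_u x)

lemma inner_perp_left (x y : L2 I) : inner ℝ (D.perp x) y = inner ℝ x (D.perp y) := by
  rw [h.perp_eq, h.perp_eq, inner_sub_left, inner_sub_right, inner_smul_left, inner_smul_right,
    real_inner_comm y D.u]
  simp only [conj_trivial]
  rw [real_inner_comm D.u y]
  ring

lemma norm_perp_sq (x : L2 I) : ‖D.perp x‖ ^ 2 = ‖x‖ ^ 2 - inner ℝ x D.u ^ 2 := by
  rw [← real_inner_self_eq_norm_sq, h.inner_perp_left, h.perp_perp, h.perp_eq, inner_sub_right,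
    inner_smul_right, real_inner_self_eq_norm_sq]
  ring

lemma norm_perp_le (x : L2 I) : ‖D.perp x‖ ≤ ‖x‖ := by
  have := h.norm_perp_sq x
  refine le_of_sq_le_sq ?_ (norm_nonneg x)
  nlinarith [sq_nonneg (inner ℝ x D.u)]

/-- Angles add up: perturbing `y`, `‖y‖ ≥ 1`, to `z` increases the sine of the angle with the
eigenvector by at most `‖y - z‖`. No quadratic term arises from the normalization of `z`. -/
lemma norm_perp_unit_le {y z : L2 I} (hy : 1 ≤ ‖y‖) (hz : z ≠ 0) :
    ‖D.perp (‖z‖⁻¹ • z)‖ ≤ ‖D.perp y‖ + ‖y - z‖ := by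
  have hy0 : 0 < ‖y‖ := by linarith
  have hz0 : 0 < ‖z‖ := norm_pos_iff.2 hz
  obtain ⟨a, ha⟩ : ∃ a : L2 I, a = ‖z‖⁻¹ • z := ⟨_, rfl⟩
  obtain ⟨b, hb⟩ : ∃ b : L2 I, b = ‖y‖⁻¹ • y := ⟨_, rfl⟩
  rw [← ha]
  have ha1 : ‖a‖ = 1 := by
    rw [ha, norm_smul, norm_inv, norm_norm, inv_mul_cancel₀ hz0.ne']
  have hb1 : ‖b‖ = 1 := by
    rw [hb, norm_smul, norm_inv, norm_norm, inv_mul_cancel₀ hy0.ne']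
  set t : ℝ := inner ℝ a b with ht
  have ht1 : |t| ≤ 1 := by
    have := abs_real_inner_le_norm a b
    rwa [ha1, hb1, one_mul] at this
  have h1 : ‖a - t • b‖ ^ 2 = 1 - t ^ 2 := by
    rw [norm_sub_sq_real, inner_smul_right, norm_smul, ha1, hb1, ← ht, Real.norm_eq_abs]
    rw [mul_one, sq_abs]
    ring
  have hyb : y = ‖y‖ • b := by rw [hb, smul_smul, mul_inv_cancel₀ hy0.ne', one_smul]
  have hza : z = ‖z‖ • a := by rw [ha, smul_smul, mul_inv_cancel₀ hz0.ne', one_smul]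
  have h2 : 1 - t ^ 2 ≤ ‖y - z‖ ^ 2 := by
    have h3 : ‖y - z‖ ^ 2 = ‖y‖ ^ 2 - 2 * (‖y‖ * ‖z‖ * t) + ‖z‖ ^ 2 := by
      rw [norm_sub_sq_real]
      congr 2
      nth_rewrite 1 [hyb, hza]
      rw [inner_smul_left, inner_smul_right, real_inner_comm, ← ht]
      simp only [conj_trivial]
      ring
    have h4 : 0 ≤ 1 - t ^ 2 := by rw [← h1]; positivity
    have h5 : 1 - t ^ 2 ≤ ‖y‖ ^ 2 * (1 - t ^ 2) :=
      le_mul_of_one_le_left h4 (one_le_pow₀ hy)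
    nlinarith [sq_nonneg (‖z‖ - ‖y‖ * t)]
  have h3 : ‖a - t • b‖ ≤ ‖y - z‖ := by
    refine le_of_sq_le_sq ?_ (norm_nonneg _)
    rw [h1]; exact h2
  have h4 : ‖D.perp b‖ ≤ ‖D.perp y‖ := by
    rw [hb, D.perp_smul, norm_smul, norm_inv, norm_norm]
    have : ‖y‖⁻¹ ≤ 1 := inv_le_one_of_one_le₀ hy
    nlinarith [norm_nonneg (D.perp y)]
  calc ‖D.perp a‖ = ‖t • D.perp b + D.perp (a - t • b)‖ := by
        rw [D.perp_sub, D.perp_smul]; congr 1; abel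
    _ ≤ |t| * ‖D.perp b‖ + ‖D.perp (a - t • b)‖ := by
        refine (norm_add_le _ _).trans ?_
        rw [norm_smul, Real.norm_eq_abs]
    _ ≤ 1 * ‖D.perp y‖ + ‖y - z‖ := by
        gcongr
        exact (h.norm_perp_le _).trans h3
    _ = _ := by rw [one_mul]

/-- Up to the sign of the eigenvector, the distance of a unit vector to it is controlled by the
orthogonal component. -/
lemma exists_sign {v : L2 I} (hv : ‖v‖ = 1) :
    ∃ σ : ℝ, |σ| = 1 ∧ ‖v - σ • D.u‖ ≤ √2 * ‖D.perp v‖ := by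
  have h1 := h.norm_perp_sq v
  set t := inner ℝ v D.u with ht
  rw [hv] at h1
  obtain ⟨σ, hσ, hσt⟩ : ∃ σ : ℝ, |σ| = 1 ∧ σ * t = |t| := by
    rcases le_total 0 t with h0 | h0
    · exact ⟨1, by simp, by rw [one_mul, abs_of_nonneg h0]⟩
    · exact ⟨-1, by simp, by rw [abs_of_nonpos h0]; ring⟩
  refine ⟨σ, hσ, le_of_sq_le_sq ?_ (by positivity)⟩
  have ht1 : |t| ≤ 1 := by
    have := abs_real_inner_le_norm v D.u
    rwa [hv, h.u_norm, one_mul] at this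
  have ht0 := abs_nonneg t
  rw [norm_sub_sq_real, inner_smul_right, norm_smul, hv, h.u_norm, Real.norm_eq_abs, hσ, ← ht, hσt,
    mul_pow, mul_pow, Real.sq_sqrt (show (0 : ℝ) ≤ 2 by norm_num), h1, ← sq_abs t]
  nlinarith

/-! ### Ellipticity -/

lemma gam_le_Gam : P.gam ≤ P.Gam := by
  have h1 := (h.A_lower D.u).trans (h.A_upper D.u)
  rw [h.u_norm] at h1
  linarith

lemma C_nonneg (x : L2 I) : 0 ≤ inner ℝ (D.C x) x := by
  rcases eq_or_ne x 0 with rfl | hx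
  · simp
  · exact (h.C_pos x hx).le

lemma lam_le_rayleigh {x : L2 I} (hx : x ≠ 0) : P.lam ≤ D.rayleigh x :=
  h.lam_min.2 ⟨x, hx, rfl⟩

lemma lam_mul_C_le (x : L2 I) : P.lam * inner ℝ (D.C x) x ≤ inner ℝ (D.A x) x := by
  rcases eq_or_ne x 0 with rfl | hx
  · simp
  · exact (le_div_iff₀ (h.C_pos x hx)).1 (h.lam_le_rayleigh hx)

lemma norm_A_le (hP : P.Valid) (x : L2 I) : ‖D.A x‖ ≤ P.Gam * ‖x‖ := by
  refine norm_apply_le_of_abs_inner_le (T := D.A.toLinearMap) h.A_symm (fun x => ?_) x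
  have h1 := h.A_lower x
  have h2 := h.A_upper x
  have h3 : 0 ≤ P.gam * ‖x‖ ^ 2 := mul_nonneg hP.gam_pos.le (by positivity)
  have h4 : |inner ℝ (D.A x) x| ≤ P.Gam * ‖x‖ ^ 2 := by
    rw [abs_of_nonneg (h3.trans h1)]; exact h2
  exact h4

lemma norm_C_le (hP : P.Valid) (x : L2 I) : ‖D.C x‖ ≤ P.CC * ‖x‖ := by
  refine norm_apply_le_of_abs_inner_le (T := D.C.toLinearMap) h.C_symm (fun x => ?_) x
  have h1 := h.lam_mul_C_le x
  have h2 := h.A_upper x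
  have h4 : |inner ℝ (D.C x) x| ≤ P.CC * ‖x‖ ^ 2 := by
    rw [abs_of_nonneg (h.C_nonneg x), Params.CC, div_mul_eq_mul_div, le_div_iff₀ hP.lam_pos]
    linarith
  exact h4

lemma opNorm_A_le (hP : P.Valid) : ‖D.A‖ ≤ P.Gam :=
  D.A.opNorm_le_bound hP.Gam_pos.le (h.norm_A_le hP)

lemma opNorm_C_le (hP : P.Valid) : ‖D.C‖ ≤ P.CC :=
  D.C.opNorm_le_bound hP.CC_pos.le (h.norm_C_le hP)

lemma opNorm_A_pos (hP : P.Valid) : 0 < ‖D.A‖ := by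
  refine norm_pos_iff.2 fun h0 => ?_
  have := h.A_lower D.u
  rw [h0, h.u_norm] at this
  simp at this
  linarith [hP.gam_pos]

lemma opNorm_C_pos : 0 < ‖D.C‖ := by
  refine norm_pos_iff.2 fun h0 => ?_
  have := h.C_pos D.u h.u_ne_zero
  rw [h0] at this
  simp at this

/-! ### The shifted operator `A - λ C` -/

omit h in
/-- The operator `A - λ C`, which vanishes at the eigenvector. -/
noncomputable def _root_.Data.shift (P : Params) (D : Data I) : L2 I →L[ℝ] L2 I := D.A - P.lam • D.C

omit h in
lemma _root_.Data.shift_apply (x : L2 I) : D.shift P x = D.A x - P.lam • D.C x := rfl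

lemma shift_u : D.shift P D.u = 0 := by
  rw [D.shift_apply, h.u_eig, sub_self]

lemma shift_symm (x y : L2 I) : inner ℝ (D.shift P x) y = inner ℝ x (D.shift P y) := by
  rw [D.shift_apply, D.shift_apply, inner_sub_left, inner_sub_right, inner_smul_left,
    inner_smul_right, h.A_symm, h.C_symm]
  simp

lemma shift_perp (x : L2 I) : D.shift P (D.perp x) = D.shift P x := by
  rw [h.perp_eq, map_sub, map_smul, h.shift_u, smul_zero, sub_zero]

lemma inner_shift_perp (x : L2 I) :
    inner ℝ (D.shift P (D.perp x)) (D.perp x) = inner ℝ (D.shift P x) x := by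
  rw [h.shift_perp, h.shift_symm, h.shift_perp, h.shift_symm]

lemma perp_shift (x : L2 I) : D.perp (D.shift P x) = D.shift P x := by
  refine h.perp_of_inner_eq_zero ?_
  rw [h.shift_symm, h.shift_u, inner_zero_right]

lemma inner_shift_le (hP : P.Valid) (x : L2 I) : inner ℝ (D.shift P x) x ≤ P.Gam * ‖x‖ ^ 2 := by
  rw [D.shift_apply, inner_sub_left, inner_smul_left]
  have h1 := mul_nonneg hP.lam_pos.le (h.C_nonneg x)
  have h2 := h.A_upper x
  simp only [conj_trivial]
  linarith

/-- `A - λ C` is coercive on the orthogonal complement of `u`. The spectral gap gives this for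
vectors that are `A`-orthogonal to `u`, and projecting these along `u` does not change the
quadratic form. -/
lemma theta_mul_le (hP : P.Valid) {x : L2 I} (hx : inner ℝ x D.u = 0) :
    P.theta * ‖x‖ ^ 2 ≤ inner ℝ (D.shift P x) x := by
  have hAu : 0 < inner ℝ (D.A D.u) D.u := by
    have := h.A_lower D.u
    rw [h.u_norm] at this
    linarith [hP.gam_pos]
  set t : ℝ := inner ℝ (D.A D.u) x / inner ℝ (D.A D.u) D.u with ht
  set y : L2 I := x - t • D.u with hy
  have hAy : inner ℝ (D.A D.u) y = 0 := by
    rw [hy, inner_sub_right, inner_smul_right, ht, div_mul_cancel₀ _ hAu.ne', sub_self]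
  have hxy : D.perp y = x := by
    rw [hy, D.perp_sub, D.perp_smul, h.perp_of_inner_eq_zero hx, h.perp_eq D.u, h.inner_u_u,
      one_smul, sub_self, smul_zero, sub_zero]
  have h1 : inner ℝ (D.shift P x) x = inner ℝ (D.shift P y) y := by
    rw [← hxy, h.inner_shift_perp]
  have h2 : ‖x‖ ≤ ‖y‖ := by
    rw [← hxy]; exact h.norm_perp_le y
  have hLam : 0 < P.Lam := hP.lam_pos.trans hP.lam_lt
  have h3 : P.Lam * inner ℝ (D.C y) y ≤ inner ℝ (D.A y) y := by
    rcases eq_or_ne y 0 with h0 | h0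
    · simp [h0]
    · exact (le_div_iff₀ (h.C_pos y h0)).1 (h.gap y h0 hAy)
  have h4 : P.lam * inner ℝ (D.C y) y ≤ P.lam / P.Lam * inner ℝ (D.A y) y := by
    rw [div_mul_eq_mul_div, le_div_iff₀ hLam]
    nlinarith [hP.lam_pos]
  have h5 := h.A_lower y
  have h6 : 0 < 1 - P.lam / P.Lam := by
    rw [sub_pos, div_lt_one hLam]; exact hP.lam_lt
  rw [h1, D.shift_apply, inner_sub_left, inner_smul_left]
  simp only [conj_trivial]
  calc P.theta * ‖x‖ ^ 2 ≤ P.theta * ‖y‖ ^ 2 := by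
        have := hP.theta_pos
        gcongr
    _ = (1 - P.lam / P.Lam) * (P.gam * ‖y‖ ^ 2) := by unfold Params.theta; ring
    _ ≤ (1 - P.lam / P.Lam) * inner ℝ (D.A y) y := by gcongr
    _ ≤ _ := by linarith

/-- The Richardson iteration with the shifted operator contracts the orthogonal component. -/
lemma norm_perp_sub_shift_le (hP : P.Valid) (x : L2 I) :
    ‖D.perp x - P.alpha • D.shift P x‖ ≤ P.beta * ‖D.perp x‖ := by
  let S : L2 I →ₗ[ℝ] L2 I := D.perpL - P.alpha • (D.shift P).toLinearMap
  have hS : ∀ x, S x = D.perp x - P.alpha • D.shift P x := fun x => rfl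
  have hform : ∀ x, inner ℝ (S x) x
      = ‖D.perp x‖ ^ 2 - P.alpha * inner ℝ (D.shift P (D.perp x)) (D.perp x) := by
    intro x
    rw [hS, inner_sub_left, inner_smul_left, h.inner_shift_perp, ← real_inner_self_eq_norm_sq,
      ← h.inner_perp_left, h.perp_perp]
    simp
  have key := norm_apply_le_of_abs_inner_le (T := S) (c := P.beta)
    (fun x y => by
      rw [hS, hS, inner_sub_left, inner_sub_right, inner_smul_left, inner_smul_right, h.shift_symm,
        h.inner_perp_left]
      simp)
    (fun x => by
      have h1 := h.theta_mul_le hP (h.inner_perp_u x)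
      have h2 := h.inner_shift_le hP (D.perp x)
      have h3 := hP.one_sub_beta
      have h4 := hP.one_add_beta
      have h5 := mul_le_mul_of_nonneg_left h1 hP.alpha_pos.le
      have h6 := mul_le_mul_of_nonneg_left h2 hP.alpha_pos.le
      rw [← mul_assoc, ← h3] at h5
      rw [← mul_assoc, ← h4] at h6
      have h7 : ‖D.perp x‖ ^ 2 ≤ ‖x‖ ^ 2 := by
        have := h.norm_perp_le x
        gcongr
      have h8 := mul_le_mul_of_nonneg_left h7 (hP.beta_pos h.gam_le_Gam).le
      rw [hform, abs_le]
      constructor <;> linarith)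
  have h1 := key (D.perp x)
  rwa [hS, h.perp_perp, h.shift_perp] at h1

/-! ### Local properties of the Rayleigh quotient -/

lemma inner_shift_self {x : L2 I} (hx : x ≠ 0) :
    inner ℝ (D.shift P x) x = (D.rayleigh x - P.lam) * inner ℝ (D.C x) x := by
  rw [D.shift_apply, inner_sub_left, inner_smul_left, rayleigh, sub_mul,
    div_mul_cancel₀ _ (h.C_pos x hx).ne']
  simp

/-- Near the eigenvector, the form of `C` is bounded below by `c_C`. -/
lemma cC_le (hP : P.Valid) {x : L2 I} (hx : ‖x‖ = 1) (he : ‖D.perp x‖ ^ 2 ≤ P.a) :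
    P.cC ≤ inner ℝ (D.C x) x := by
  have h1 := h.inner_shift_le hP (D.perp x)
  rw [h.inner_shift_perp, D.shift_apply, inner_sub_left, inner_smul_left] at h1
  simp only [conj_trivial] at h1
  have h2 := h.A_lower x
  rw [hx] at h2
  have h3 := hP.lam_mul_cC
  have h4 := mul_le_mul_of_nonneg_left he hP.Gam_pos.le
  have h5 := mul_pos hP.Gam_pos hP.a_pos
  refine le_of_mul_le_mul_left ?_ hP.lam_pos
  linarith

omit h in
lemma ne_zero_of_norm_eq_one {x : L2 I} (hx : ‖x‖ = 1) : x ≠ 0 := by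
  rintro rfl; simp at hx

/-- The error of the Rayleigh quotient is quadratic in the error of the vector. -/
lemma rayleigh_sub_le (hP : P.Valid) {x : L2 I} (hx : ‖x‖ = 1) (he : ‖D.perp x‖ ^ 2 ≤ P.a) :
    D.rayleigh x - P.lam ≤ P.Gam * P.K / P.gam * ‖D.perp x‖ ^ 2 := by
  have hx0 := ne_zero_of_norm_eq_one hx
  have h1 := h.inner_shift_le hP (D.perp x)
  rw [h.inner_shift_perp, h.inner_shift_self hx0] at h1
  have h2 := h.cC_le hP hx he
  have h3 := h.lam_le_rayleigh hx0
  have h4 : (D.rayleigh x - P.lam) * P.cC ≤ P.Gam * ‖D.perp x‖ ^ 2 :=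
    (mul_le_mul_of_nonneg_left h2 (by linarith)).trans h1
  rw [← le_div_iff₀ hP.cC_pos] at h4
  refine h4.trans (le_of_eq ?_)
  have := hP.gam_pos
  have := hP.K_pos
  unfold Params.cC
  field_simp

/-! ### The inverse of the shifted operator on the orthogonal complement -/

omit h in
lemma mem_V0 {x : L2 I} : x ∈ D.V0 ↔ inner ℝ x D.u = 0 := by
  rw [V0, Submodule.mem_orthogonal_singleton_iff_inner_left]

lemma coe_Mperp (x : D.V0) : ((D.Mperp P x : D.V0) : L2 I) = D.shift P (x : L2 I) := by
  have hm : D.shift P (x : L2 I) ∈ D.V0 := by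
    rw [mem_V0, h.shift_symm, h.shift_u, inner_zero_right]
  exact congrArg Subtype.val
    (Submodule.orthogonalProjectionOnto_mem_subspace_eq_self (⟨_, hm⟩ : D.V0))

/-- By the theorem of Lax and Milgram, coercivity makes the compressed operator invertible. -/
lemma isInvertible_Mperp (hP : P.Valid) : (D.Mperp P).IsInvertible := by
  have hco : IsCoercive ((innerSL ℝ).comp (D.Mperp P)) := by
    refine ⟨P.theta, hP.theta_pos, fun x => ?_⟩
    have h1 := h.theta_mul_le hP (mem_V0.1 x.2)
    rw [ContinuousLinearMap.comp_apply, innerSL_apply_apply, Submodule.coe_inner, h.coe_Mperp]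
    rw [Submodule.coe_norm]
    linarith
  refine ⟨hco.continuousLinearEquivOfBilin, ?_⟩
  refine ContinuousLinearMap.ext fun x => ext_inner_right ℝ fun y => ?_
  exact hco.continuousLinearEquivOfBilin_apply x y

/-- `‖x^⊥‖ ≤ ‖M_⊥⁻¹‖ ‖(A - λ C) x‖` -/
lemma norm_perp_le_shift (hP : P.Valid) (x : L2 I) :
    ‖D.perp x‖ ≤ D.MperpInvNorm P * ‖D.shift P x‖ := by
  have hm : D.perp x ∈ D.V0 := mem_V0.2 (h.inner_perp_u x)
  have h1 : (D.Mperp P).inverse (D.Mperp P ⟨_, hm⟩) = ⟨_, hm⟩ := by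
    rw [← ContinuousLinearMap.comp_apply, (h.isInvertible_Mperp hP).inverse_comp_self]
    rfl
  have h2 := (D.Mperp P).inverse.le_opNorm (D.Mperp P ⟨_, hm⟩)
  rw [h1, Submodule.coe_norm, Submodule.coe_norm, h.coe_Mperp] at h2
  rwa [h.shift_perp] at h2

lemma norm_shift_le (hP : P.Valid) (x : L2 I) : ‖D.shift P x‖ ≤ P.Gam * ‖x‖ := by
  refine norm_apply_le_of_abs_inner_le (T := (D.shift P).toLinearMap) h.shift_symm
    (fun x => ?_) x
  have h1 := h.inner_shift_le hP x
  have h2 : 0 ≤ inner ℝ (D.shift P x) x := by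
    rw [D.shift_apply, inner_sub_left, inner_smul_left]
    have := h.lam_mul_C_le x
    simp only [conj_trivial]
    linarith
  have h4 : |inner ℝ (D.shift P x) x| ≤ P.Gam * ‖x‖ ^ 2 := by
    rwa [abs_of_nonneg h2]
  exact h4

lemma one_le_Gam_mul [Nontrivial I] (hP : P.Valid) : 1 ≤ P.Gam * D.MperpInvNorm P := by
  classical
  obtain ⟨v, hv⟩ : ∃ v : L2 I, D.perp v ≠ 0 := by
    by_contra! h0
    obtain ⟨i, j, hij⟩ := exists_pair_ne I
    have key : ∀ k : I, D.u k ≠ 0 := by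
      intro k hk
      have h1 := h0 (toL2 (Finsupp.single k 1))
      rw [h.perp_eq, sub_eq_zero] at h1
      have h2 := congrArg (fun f : L2 I => f k) h1
      simp [hk] at h2
    have h1 := h0 (toL2 (Finsupp.single i 1))
    rw [h.perp_eq, sub_eq_zero] at h1
    have h2 := congrArg (fun f : L2 I => f j) h1
    have h3 := congrArg (fun f : L2 I => f i) h1
    simp only [toL2_apply, lp.coeFn_smul, Pi.smul_apply, smul_eq_mul, Finsupp.single_apply,
      if_neg hij, if_true] at h2 h3
    rcases mul_eq_zero.1 h2.symm with h4 | h4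
    · rw [h4] at h3; simp at h3
    · exact key j h4
  have h1 := h.norm_perp_le_shift hP (D.perp v)
  rw [h.perp_perp] at h1
  have h2 := h.norm_shift_le hP (D.perp v)
  have h3 : 0 < ‖D.perp v‖ := norm_pos_iff.2 hv
  have h4 : 0 ≤ D.MperpInvNorm P := by exact norm_nonneg (D.Mperp P).inverse
  have h5 : 1 * ‖D.perp v‖ ≤ P.Gam * D.MperpInvNorm P * ‖D.perp v‖ := by
    rw [one_mul]
    refine h1.trans ((mul_le_mul_of_nonneg_left h2 h4).trans (le_of_eq ?_))
    ring
  exact le_of_mul_le_mul_right h5 h3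

lemma MperpInvNorm_pos [Nontrivial I] (hP : P.Valid) : 0 < D.MperpInvNorm P := by
  have := h.one_le_Gam_mul hP
  exact pos_of_mul_pos_right (by linarith) hP.Gam_pos.le

/-- The exact residual `(A - λ(x) C) x`. -/
noncomputable def _root_.Data.residual (D : Data I) (x : L2 I) : L2 I :=
  D.A x - D.rayleigh x • D.C x

omit h in
lemma _root_.Data.residual_eq (x : L2 I) :
    D.residual x = D.shift P x - (D.rayleigh x - P.lam) • D.C x := by
  rw [Data.residual, D.shift_apply, sub_smul]
  abel

lemma inner_residual_self {x : L2 I} (hx : x ≠ 0) : inner ℝ (D.residual x) x = 0 := by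
  rw [D.residual_eq (P := P), inner_sub_left, inner_smul_left, h.inner_shift_self hx]
  simp

/-- Below the threshold `δ̄` the residual is a reliable error indicator. -/
lemma norm_perp_le_residual [Nontrivial I] (hP : P.Valid) {x : L2 I} (hx : ‖x‖ = 1)
    (he : ‖D.perp x‖ ^ 2 ≤ P.a) (hd : ‖D.perp x‖ ≤ D.deltaBar P) :
    ‖D.perp x‖ ≤ 4 / 3 * (D.MperpInvNorm P * ‖D.residual x‖) := by
  have hm := h.MperpInvNorm_pos hP
  have hC := h.opNorm_C_pos
  have hG := hP.Gam_pos
  have hg := hP.gam_pos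
  have hK := hP.K_pos
  set m := D.MperpInvNorm P with hm_def
  have h1 := h.norm_perp_le_shift hP x
  have h2 : ‖D.shift P x‖ ≤ ‖D.residual x‖
      + P.Gam * P.K / P.gam * ‖D.perp x‖ ^ 2 * ‖D.C‖ := by
    have h3 : D.shift P x = D.residual x + (D.rayleigh x - P.lam) • D.C x := by
      rw [D.residual_eq (P := P)]; abel
    have h4 := h.lam_le_rayleigh (ne_zero_of_norm_eq_one hx)
    rw [h3]
    refine (norm_add_le _ _).trans ?_
    rw [norm_smul, Real.norm_eq_abs, abs_of_nonneg (by linarith)]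
    gcongr
    · exact h.rayleigh_sub_le hP hx he
    · simpa [hx] using D.C.le_opNorm x
  -- `δ̄` is the positive root of `q (δ² + δ) = 1/4`.
  set q : ℝ := P.Gam * P.K * ‖D.C‖ * m / P.gam with hq
  have hq0 : 0 < q := by positivity
  have h5 : q * D.deltaBar P ≤ 1 / 4 := by
    have h6 : P.gam / (P.Gam * P.K * ‖D.C‖ * m) = q⁻¹ := by rw [hq, inv_div]
    have h7 : D.deltaBar P = 1 / 2 * (√(1 + q⁻¹) - 1) := by
      rw [Data.deltaBar, ← hm_def, h6]
    have h8 : √(1 + q⁻¹) ≤ 1 + q⁻¹ / 2 := by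
      refine Real.sqrt_le_iff.2 ⟨by positivity, ?_⟩
      nlinarith [sq_nonneg q⁻¹]
    have h9 : D.deltaBar P ≤ q⁻¹ / 4 := by rw [h7]; linarith
    calc q * D.deltaBar P ≤ q * (q⁻¹ / 4) := by gcongr
      _ = 1 / 4 := by field_simp
  have h6 : m * (P.Gam * P.K / P.gam * ‖D.perp x‖ ^ 2 * ‖D.C‖)
      = q * ‖D.perp x‖ * ‖D.perp x‖ := by
    rw [hq]; ring
  have h7 : q * ‖D.perp x‖ * ‖D.perp x‖ ≤ 1 / 4 * ‖D.perp x‖ := by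
    gcongr
    exact (mul_le_mul_of_nonneg_left hd hq0.le).trans h5
  have h8 := mul_le_mul_of_nonneg_left h2 hm.le
  rw [mul_add, h6] at h8
  linarith

end Admissible

end Data

/-! ### Accuracy of the routines -/

lemma abs_scal_sub_le {I : Type w} {approx : (I →₀ ℝ) → ℝ → (I →₀ ℝ)} (ha : IsApprox approx)
    {B : L2 I →L[ℝ] L2 I} (hB : 0 < ‖B‖) (S : ApplyScheme B) {x : I →₀ ℝ} (hx : ‖toL2 x‖ = 1)
    {η : ℝ} (hη : 0 < η) :
    |scal approx S x η - inner ℝ (B (toL2 x)) (toL2 x)| ≤ η := by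
  set z := approx x (η / (2 * ‖B‖)) with hz
  set y := S.run x (η / 2) with hy
  have h1 : scal approx S x η = inner ℝ (toL2 z) (toL2 y) := by
    rw [inner_toL2]; rfl
  have h2 : scal approx S x η - inner ℝ (B (toL2 x)) (toL2 x)
      = - inner ℝ (toL2 x - toL2 z) (B (toL2 x)) - inner ℝ (toL2 z) (B (toL2 x) - toL2 y) := by
    rw [h1, inner_sub_left, inner_sub_right, real_inner_comm (toL2 x) (B (toL2 x))]
    ring
  have h3 : |inner ℝ (toL2 x - toL2 z) (B (toL2 x))| ≤ η / 2 := by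
    refine (abs_real_inner_le_norm _ _).trans ?_
    calc ‖toL2 x - toL2 z‖ * ‖B (toL2 x)‖ ≤ η / (2 * ‖B‖) * (‖B‖ * ‖toL2 x‖) := by
          gcongr
          · exact ha.error x _ (by positivity)
          · exact B.le_opNorm _
      _ = η / 2 := by rw [hx]; field_simp
  have h4 : |inner ℝ (toL2 z) (B (toL2 x) - toL2 y)| ≤ η / 2 := by
    refine (abs_real_inner_le_norm _ _).trans ?_
    calc ‖toL2 z‖ * ‖B (toL2 x) - toL2 y‖ ≤ 1 * (η / 2) := by
          gcongr
          · rw [← hx]; exact ha.norm_le x (by positivity)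
          · exact S.accurate x _ (by positivity)
      _ = η / 2 := one_mul _
  rw [h2]
  rw [abs_le] at h3 h4 ⊢
  constructor <;> linarith [h3.1, h3.2, h4.1, h4.2]

lemma raylTol_pos {P : Params} (hP : P.Valid) {η : ℝ} (hη : 0 < η) : 0 < raylTol P η := by
  have h1 := hP.cC_pos
  have h2 := hP.gam_pos
  have h3 := hP.Gam_pos
  exact lt_min hη (lt_min (by positivity) (by positivity))

lemma raylTol_le (P : Params) (η : ℝ) : raylTol P η ≤ η := min_le_left _ _

namespace Data.Admissible

variable {I : Type w} {D : Data I} {P : Params} (h : D.Admissible P)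
include h

/-- Accuracy of `RAYL` for unit vectors near the eigenvector, for any routines that compute the
scalar products with the prescribed accuracy. -/
lemma rayl_spec (hP : P.Valid) {scA scC : (I →₀ ℝ) → ℝ → ℝ} {x : I →₀ ℝ} (hx : ‖toL2 x‖ = 1)
    (he : ‖D.perp (toL2 x)‖ ^ 2 ≤ P.a)
    (hA : ∀ η, 0 < η → |scA x η - inner ℝ (D.A (toL2 x)) (toL2 x)| ≤ η)
    (hC : ∀ η, 0 < η → |scC x η - inner ℝ (D.C (toL2 x)) (toL2 x)| ≤ η) {η : ℝ} (hη : 0 < η) :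
    |rayl P scA scC x η - D.rayleigh (toL2 x)| ≤ raylTol P η ∧ 0 < rayl P scA scC x η ∧
      rayl P scA scC x η ≤ 3 * P.Gam / P.cC := by
  have hc := hP.cC_pos
  have hG := hP.Gam_pos
  have hg := hP.gam_pos
  have hgG := h.gam_le_Gam
  set τ := raylTol P η with hτ
  have hτ0 : 0 < τ := raylTol_pos hP hη
  have hτ1 : τ * P.cC ≤ P.gam := by
    rw [← le_div_iff₀ hc]
    exact (min_le_right _ _).trans (min_le_left _ _)
  have hτ2 : τ * P.cC ≤ 3 * P.Gam := by
    rw [← le_div_iff₀ hc]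
    exact (min_le_right _ _).trans (min_le_right _ _)
  have hA1 := hA (τ * P.cC / 2) (by positivity)
  have hC1 := hC (P.cC ^ 2 * τ / (6 * P.Gam)) (by positivity)
  have hr : rayl P scA scC x η
    = scA x (τ * P.cC / 2) / scC x (P.cC ^ 2 * τ / (6 * P.Gam)) := rfl
  have hl : D.rayleigh (toL2 x)
    = inner ℝ (D.A (toL2 x)) (toL2 x) / inner ℝ (D.C (toL2 x)) (toL2 x) := rfl
  have hA2 := h.A_lower (toL2 x)
  have hA3 := h.A_upper (toL2 x)
  have hC2 := h.cC_le hP hx he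
  rw [hx] at hA2 hA3
  rw [hr, hl]
  generalize scA x (τ * P.cC / 2) = n' at *
  generalize scC x (P.cC ^ 2 * τ / (6 * P.Gam)) = d' at *
  generalize (inner ℝ (D.A (toL2 x)) (toL2 x) : ℝ) = n at *
  generalize (inner ℝ (D.C (toL2 x)) (toL2 x) : ℝ) = d at *
  have htol : P.cC ^ 2 * τ / (6 * P.Gam) ≤ P.cC / 2 := by
    rw [div_le_iff₀ (by positivity)]
    nlinarith
  have hd' : P.cC / 2 ≤ d' := by
    have := (abs_le.1 hC1).1
    linarith
  have hn' : n' ≤ 3 / 2 * P.Gam := by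
    have := (abs_le.1 hA1).2
    linarith
  have hn0 : 0 < n' := by
    have := (abs_le.1 hA1).1
    linarith
  have hd0 : 0 < d' := by linarith
  have hdd : 0 < d := by linarith
  refine ⟨?_, by positivity, ?_⟩
  · have h1 : n' / d' - n / d = (n' - n) / d + n' * (d - d') / (d' * d) := by
      field_simp
      ring
    have h2 : |(n' - n) / d| ≤ τ / 2 := by
      rw [abs_div, abs_of_pos hdd, div_le_iff₀ hdd]
      refine hA1.trans ?_
      rw [mul_div_right_comm]
      gcongr
    have h3 : |n' * (d - d') / (d' * d)| ≤ τ / 2 := by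
      rw [abs_div, abs_of_pos (mul_pos hd0 hdd), div_le_iff₀ (by positivity), abs_mul,
        abs_of_pos hn0, abs_sub_comm]
      calc n' * |d' - d| ≤ 3 / 2 * P.Gam * (P.cC ^ 2 * τ / (6 * P.Gam)) := by gcongr
        _ = τ / 2 * (P.cC / 2 * P.cC) := by field_simp; ring
        _ ≤ τ / 2 * (d' * d) := by gcongr
    rw [h1]
    exact (abs_add_le _ _).trans (by linarith)
  · rw [div_le_iff₀ hd0]
    calc n' ≤ 3 / 2 * P.Gam := hn'
      _ = 3 * P.Gam / P.cC * (P.cC / 2) := by field_simp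
      _ ≤ _ := by gcongr

lemma raylSimple_spec (hP : P.Valid) {x : I →₀ ℝ} (hx : ‖toL2 x‖ = 1)
    (he : ‖D.perp (toL2 x)‖ ^ 2 ≤ P.a) {η : ℝ} (hη : 0 < η) :
    |D.raylSimple P x η - D.rayleigh (toL2 x)| ≤ raylTol P η ∧ 0 < D.raylSimple P x η ∧
      D.raylSimple P x η ≤ 3 * P.Gam / P.cC :=
  h.rayl_spec hP hx he
    (fun _ hη => abs_scal_sub_le h.approx_spec (h.opNorm_A_pos hP) D.applyA hx hη)
    (fun _ hη => abs_scal_sub_le h.approx_spec h.opNorm_C_pos D.applyC hx hη) hη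

/-- Accuracy of `RES`. -/
lemma norm_res_sub_le (hP : P.Valid) {x : I →₀ ℝ} (hx : ‖toL2 x‖ = 1)
    (he : ‖D.perp (toL2 x)‖ ^ 2 ≤ P.a) {η : ℝ} (hη : 0 < η) :
    ‖P.alpha • D.residual (toL2 x) - toL2 (D.res P x η)‖ ≤ η := by
  have hα := hP.alpha_pos
  have hCC := hP.CC_pos
  obtain ⟨h1, h2, -⟩ := h.raylSimple_spec hP hx he
    (η := η / (4 * P.CC * P.alpha)) (by positivity)
  have h1' := h1.trans (raylTol_le P _)
  unfold Data.res
  set l := D.raylSimple P x (η / (4 * P.CC * P.alpha)) with hl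
  have hA := D.applyA.accurate x (η / (2 * P.alpha)) (by positivity)
  have hC := D.applyC.accurate x (η / (4 * l * P.alpha)) (by positivity)
  set wA := D.applyA.run x (η / (2 * P.alpha))
  set wC := D.applyC.run x (η / (4 * l * P.alpha))
  have h3 : P.alpha • D.residual (toL2 x) - toL2 (P.alpha • (wA - l • wC))
      = P.alpha • ((D.A (toL2 x) - toL2 wA) - l • (D.C (toL2 x) - toL2 wC)
        + (l - D.rayleigh (toL2 x)) • D.C (toL2 x)) := by
    rw [Data.residual, toL2_smul, toL2_sub, toL2_smul, ← smul_sub]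
    congr 1
    rw [smul_sub, sub_smul]
    abel
  have h4 := h.norm_C_le hP (toL2 x)
  rw [hx, mul_one] at h4
  rw [h3, norm_smul, Real.norm_eq_abs, abs_of_pos hα]
  calc P.alpha * ‖(D.A (toL2 x) - toL2 wA) - l • (D.C (toL2 x) - toL2 wC)
        + (l - D.rayleigh (toL2 x)) • D.C (toL2 x)‖
      ≤ P.alpha * (η / (2 * P.alpha) + l * (η / (4 * l * P.alpha))
        + η / (4 * P.CC * P.alpha) * P.CC) := by
        gcongr
        refine (norm_add_le _ _).trans (add_le_add ((norm_sub_le _ _).trans (add_le_add hA ?_)) ?_)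
        · rw [norm_smul, Real.norm_eq_abs, abs_of_pos h2]
          gcongr
        · rw [norm_smul, Real.norm_eq_abs]
          gcongr
    _ = η := by field_simp; ring

/-! ### Convergence of the iteration -/

/-- One step of the iteration, before normalization, with exact residual. -/
lemma exact_step (hP : P.Valid) {x : L2 I} (hx : ‖x‖ = 1) (he : ‖D.perp x‖ ≤ P.eps0) :
    1 ≤ ‖x - P.alpha • D.residual x‖ ∧
      ‖D.perp (x - P.alpha • D.residual x)‖ ≤ P.xi * ‖D.perp x‖ := by
  have hα := hP.alpha_pos
  have hx0 := ne_zero_of_norm_eq_one hx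
  have he2 : ‖D.perp x‖ ^ 2 ≤ P.a := le_trans (by gcongr) hP.eps0_sq_le
  constructor
  · have h1 : ‖x - P.alpha • D.residual x‖ ^ 2 = 1 + ‖P.alpha • D.residual x‖ ^ 2 := by
      rw [norm_sub_sq_real, inner_smul_right, real_inner_comm, h.inner_residual_self hx0, hx]
      ring
    have h2 : (1 : ℝ) ^ 2 ≤ ‖x - P.alpha • D.residual x‖ ^ 2 := by
      rw [h1]
      nlinarith [sq_nonneg ‖P.alpha • D.residual x‖]
    exact le_of_sq_le_sq h2 (norm_nonneg _)
  · have h1 : D.perp (x - P.alpha • D.residual x) = (D.perp x - P.alpha • D.shift P x)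
        + P.alpha • (D.rayleigh x - P.lam) • D.perp (D.C x) := by
      rw [D.perp_sub, D.perp_smul, D.residual_eq (P := P), D.perp_sub, h.perp_shift, D.perp_smul,
        smul_sub]
      abel
    have h2 := h.norm_perp_sub_shift_le hP x
    have h3 := h.rayleigh_sub_le hP hx he2
    have h4 := h.lam_le_rayleigh hx0
    have h5 : ‖D.perp (D.C x)‖ ≤ P.CC := by
      refine (h.norm_perp_le _).trans ?_
      simpa [hx] using h.norm_C_le hP x
    have hG := hP.Gam_pos
    have hg := hP.gam_pos
    have hK := hP.K_pos
    have hCC := hP.CC_pos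
    have hct := hP.ctilde_pos
    rw [h1]
    calc ‖(D.perp x - P.alpha • D.shift P x)
          + P.alpha • (D.rayleigh x - P.lam) • D.perp (D.C x)‖
        ≤ P.beta * ‖D.perp x‖
          + P.alpha * (P.Gam * P.K / P.gam * ‖D.perp x‖ ^ 2 * P.CC) := by
          refine (norm_add_le _ _).trans (add_le_add h2 ?_)
          rw [norm_smul, norm_smul, Real.norm_eq_abs, Real.norm_eq_abs, abs_of_pos hα,
            abs_of_nonneg (by linarith)]
          gcongr
      _ = P.beta * ‖D.perp x‖ + P.ctilde * P.K * ‖D.perp x‖ / 2 * ‖D.perp x‖ := by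
          unfold Params.ctilde
          field_simp
      _ ≤ P.beta * ‖D.perp x‖ + (1 - P.beta) / 2 * ‖D.perp x‖ := by
          gcongr
          have h6 : P.ctilde * P.K * ‖D.perp x‖ ≤ P.ctilde * P.K * P.eps0 := by gcongr
          have h7 := hP.ctilde_mul_eps0_le
          have h8 := hP.beta_lt_one
          linarith
      _ = P.xi * ‖D.perp x‖ := by unfold Params.xi; ring

/-- One step of the iteration. -/
lemma step_spec (hP : P.Valid) {x : I →₀ ℝ} (hx : ‖toL2 x‖ = 1)
    (he : ‖D.perp (toL2 x)‖ ≤ P.eps0) {η : ℝ} (hη : 0 < η) (hη1 : η ≤ 1 / 2) :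
    1 / 2 ≤ ‖toL2 (x - D.res P x η)‖ ∧ ‖toL2 (unitVec (x - D.res P x η))‖ = 1 ∧
      ‖D.perp (toL2 (unitVec (x - D.res P x η)))‖ ≤ P.xi * ‖D.perp (toL2 x)‖ + η ∧
      ‖D.perp (toL2 (unitVec (x - D.res P x η)))‖
        ≤ ‖D.perp (toL2 x)‖ + ‖toL2 (D.res P x η)‖ := by
  have he2 : ‖D.perp (toL2 x)‖ ^ 2 ≤ P.a := le_trans (by gcongr) hP.eps0_sq_le
  obtain ⟨h1, h2⟩ := h.exact_step hP hx he
  have h3 := h.norm_res_sub_le hP hx he2 hη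
  have h4 : ‖(toL2 x - P.alpha • D.residual (toL2 x)) - toL2 (x - D.res P x η)‖ ≤ η := by
    rw [toL2_sub, norm_sub_rev]
    rwa [show toL2 x - toL2 (D.res P x η) - (toL2 x - P.alpha • D.residual (toL2 x))
      = P.alpha • D.residual (toL2 x) - toL2 (D.res P x η) by abel]
  have h5 : 1 / 2 ≤ ‖toL2 (x - D.res P x η)‖ := by
    have := norm_sub_norm_le (toL2 x - P.alpha • D.residual (toL2 x)) (toL2 (x - D.res P x η))
    linarith
  have h6 : toL2 (x - D.res P x η) ≠ 0 := norm_pos_iff.1 (by linarith)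
  refine ⟨h5, norm_unitVec h6, ?_, ?_⟩
  · rw [unitVec, toL2_smul]
    exact (h.norm_perp_unit_le h1 h6).trans (add_le_add h2 h4)
  · rw [unitVec, toL2_smul]
    refine (h.norm_perp_unit_le hx.ge h6).trans (le_of_eq ?_)
    rw [toL2_sub, sub_sub_cancel]

omit h in
lemma stepTol_pos (hP : P.Valid) {eb : ℝ} (heb : 0 < eb) (j : ℕ) : 0 < stepTol P eb j := by
  have := hP.xi_lt_one
  unfold stepTol
  have : 0 < 1 - P.xi := by linarith
  positivity

omit h in
lemma stepTol_le (hP : P.Valid) {eb : ℝ} (heb : 0 < eb) (j : ℕ) :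
    stepTol P eb j ≤ (1 - P.xi) * eb := by
  have h1 := hP.xi_lt_one
  have h2 : 0 < 1 - P.xi := by linarith
  exact div_le_self (by positivity) (one_le_pow₀ (by norm_num))

lemma stepTol_le_half (hP : P.Valid) {eb : ℝ} (heb : 0 < eb) (heb1 : eb ≤ P.eps0) (j : ℕ) :
    stepTol P eb j ≤ 1 / 2 := by
  have h0 := stepTol_le hP heb j
  have h1 := P.one_sub_xi
  have h2 := hP.beta_pos h.gam_le_Gam
  have h3 := hP.eps0_lt_one h.gam_le_Gam
  have h4 := hP.beta_lt_one
  nlinarith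

/-- The iterates of a block are unit vectors. The halving of the tolerances is at least as fast as
the contraction by `ξ = (1 + β)/2`, hence the errors accumulate to at most `ξ^j ε̄ / β`. -/
lemma iter_spec (hP : P.Valid) {v : I →₀ ℝ} {eb : ℝ} (heb : 0 < eb) (heb1 : eb ≤ P.eps0)
    (hv : ‖toL2 v‖ = 1) (he : ‖D.perp (toL2 v)‖ ≤ eb) (j : ℕ) :
    ‖toL2 (D.iter P v eb j)‖ = 1 ∧ ‖D.perp (toL2 (D.iter P v eb j))‖ ≤ eb ∧
      P.beta * ‖D.perp (toL2 (D.iter P v eb j))‖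
        ≤ (P.xi ^ j - (1 - P.beta) * (1 / 2) ^ j) * eb := by
  have hβ := hP.beta_pos h.gam_le_Gam
  have hξ1 := hP.xi_lt_one
  have hξ : P.xi = (P.beta + 1) / 2 := rfl
  induction j with
  | zero =>
    refine ⟨hv, he, ?_⟩
    simp only [pow_zero, mul_one, sub_sub_cancel, Data.iter]
    gcongr
  | succ j ih =>
    obtain ⟨i1, i2, i3⟩ := ih
    obtain ⟨-, s2, s3, -⟩ := h.step_spec hP i1 (i2.trans heb1) (stepTol_pos hP heb j)
      (h.stepTol_le_half hP heb heb1 j)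
    refine ⟨s2, ?_, ?_⟩
    · refine s3.trans ?_
      have h1 := stepTol_le hP heb j
      have h2 : P.xi * ‖D.perp (toL2 (D.iter P v eb j))‖ ≤ P.xi * eb := by
        gcongr
        rw [hξ]; linarith
      linarith
    · have h1 : stepTol P eb j = (1 - P.beta) / 2 * eb * (1 / 2) ^ j := by
        rw [stepTol, P.one_sub_xi, one_div_pow]
        ring
      have s3' := s3.trans_eq (congrArg (P.xi * ‖D.perp (toL2 (D.iter P v eb j))‖ + ·) h1)
      calc P.beta * ‖D.perp (toL2 (D.iter P v eb (j + 1)))‖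
          ≤ P.beta * (P.xi * ‖D.perp (toL2 (D.iter P v eb j))‖
            + (1 - P.beta) / 2 * eb * (1 / 2) ^ j) := by
            gcongr
            exact s3'
        _ = P.xi * (P.beta * ‖D.perp (toL2 (D.iter P v eb j))‖)
            + P.beta * ((1 - P.beta) / 2 * eb * (1 / 2) ^ j) := by ring
        _ ≤ P.xi * ((P.xi ^ j - (1 - P.beta) * (1 / 2) ^ j) * eb)
            + P.beta * ((1 - P.beta) / 2 * eb * (1 / 2) ^ j) := by
            gcongr
            rw [hξ]; linarith
        _ = (P.xi ^ (j + 1) - (1 - P.beta) * (1 / 2) ^ (j + 1)) * eb := by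
            rw [pow_succ P.xi, pow_succ (1 / 2 : ℝ)]
            nth_rewrite 4 [hξ]
            rw [hξ]
            ring

omit h in
/-- A bound for the number of steps of an iteration block. -/
noncomputable def _root_.Params.maxSteps (P : Params) : ℕ :=
  ⌈Real.log (P.c1 * P.beta) / Real.log P.xi⌉₊ + 1

omit h in
lemma _root_.Data.blockLen_mem (D : Data I) (v : I →₀ ℝ) (eb : ℝ) :
    (∃ j : ℕ, D.blockLen P v eb = j + 1 ∧
      (Real.log (P.c1 * P.beta) / Real.log P.xi ≤ (D.blockLen P v eb : ℝ) ∨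
        stepTol P eb j + ‖toL2 (D.res P (D.iter P v eb j) (stepTol P eb j))‖
          ≤ P.alpha * P.c1 * eb / D.Mconst P)) ∧ D.blockLen P v eb ≤ P.maxSteps := by
  have hmem : P.maxSteps ∈ {n : ℕ | ∃ j : ℕ, n = j + 1 ∧
    (Real.log (P.c1 * P.beta) / Real.log P.xi ≤ (n : ℝ) ∨
      stepTol P eb j + ‖toL2 (D.res P (D.iter P v eb j) (stepTol P eb j))‖
        ≤ P.alpha * P.c1 * eb / D.Mconst P)} := by
    refine ⟨_, rfl, Or.inl ?_⟩
    refine (Nat.le_ceil _).trans ?_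
    unfold Params.maxSteps
    push_cast
    linarith
  exact ⟨Nat.sInf_mem ⟨_, hmem⟩, Nat.sInf_le hmem⟩

/-- The accuracy at the end of an iteration block, for both stopping criteria. -/
lemma norm_perp_iter_blockLen_le [Nontrivial I] (hP : P.Valid) {v : I →₀ ℝ} {eb : ℝ}
    (heb : 0 < eb) (heb1 : eb ≤ P.eps0) (hv : ‖toL2 v‖ = 1) (he : ‖D.perp (toL2 v)‖ ≤ eb) :
    ‖D.perp (toL2 (D.iter P v eb (D.blockLen P v eb)))‖ ≤ 7 / 6 * P.c1 * eb := by
  have hβ := hP.beta_pos h.gam_le_Gam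
  have hβ1 := hP.beta_lt_one
  have hξ1 := hP.xi_lt_one
  have hξ : P.xi = (P.beta + 1) / 2 := rfl
  have hξ0 : 0 < P.xi := by rw [hξ]; linarith
  have hc1 := hP.c1_pos
  obtain ⟨⟨j, hj, hcrit⟩, -⟩ := D.blockLen_mem (P := P) v eb
  rcases hcrit with hcrit | hcrit
  · have h1 := (h.iter_spec hP heb heb1 hv he (D.blockLen P v eb)).2.2
    have h2 : P.xi ^ D.blockLen P v eb ≤ P.c1 * P.beta := by
      rw [div_le_iff_of_neg (Real.log_neg hξ0 hξ1), ← Real.log_pow] at hcrit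
      exact (Real.log_le_log_iff (by positivity) (by positivity)).1 hcrit
    have h3 : P.beta * ‖D.perp (toL2 (D.iter P v eb (D.blockLen P v eb)))‖
        ≤ P.beta * (P.c1 * eb) := by
      refine h1.trans ?_
      have h4 : 0 ≤ (1 - P.beta) * (1 / 2 : ℝ) ^ D.blockLen P v eb :=
        mul_nonneg (by linarith) (by positivity)
      calc _ ≤ P.c1 * P.beta * eb := by gcongr; linarith
        _ = _ := by ring
    have h4 := le_of_mul_le_mul_left h3 hβ
    have h5 : 0 < P.c1 * eb := by positivity
    linarith
  · obtain ⟨i1, i2, -⟩ := h.iter_spec hP heb heb1 hv he j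
    have hη := stepTol_pos hP heb j
    obtain ⟨-, -, s3, s4⟩ := h.step_spec hP i1 (i2.trans heb1) hη
      (h.stepTol_le_half hP heb heb1 j)
    rw [hj]
    change ‖D.perp (toL2 (unitVec (D.iter P v eb j
      - D.res P (D.iter P v eb j) (stepTol P eb j))))‖ ≤ _
    have he2 : ‖D.perp (toL2 (D.iter P v eb j))‖ ^ 2 ≤ P.a :=
      le_trans (by gcongr; exact i2.trans heb1) hP.eps0_sq_le
    have r1 := h.norm_perp_le_residual hP i1 he2 ((i2.trans heb1).trans h.eps0_le)
    have r2 := h.norm_res_sub_le hP i1 he2 hη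
    set x := D.iter P v eb j with hx
    set η := stepTol P eb j with hη_def
    have hα := hP.alpha_pos
    have hm := h.MperpInvNorm_pos hP
    have r3 : P.alpha * ‖D.residual (toL2 x)‖ ≤ η + ‖toL2 (D.res P x η)‖ := by
      have := norm_le_norm_sub_add (P.alpha • D.residual (toL2 x)) (toL2 (D.res P x η))
      rw [norm_smul, Real.norm_eq_abs, abs_of_pos hα] at this
      linarith
    rw [Data.Mconst, le_div_iff₀ (by positivity)] at hcrit
    have r4 : ‖D.perp (toL2 x)‖ ≤ 2 / 3 * (P.c1 * eb) := by
      refine le_of_mul_le_mul_left ?_ hα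
      calc P.alpha * ‖D.perp (toL2 x)‖
          ≤ P.alpha * (4 / 3 * (D.MperpInvNorm P * ‖D.residual (toL2 x)‖)) := by gcongr
        _ = 4 / 3 * D.MperpInvNorm P * (P.alpha * ‖D.residual (toL2 x)‖) := by ring
        _ ≤ 4 / 3 * D.MperpInvNorm P * (η + ‖toL2 (D.res P x η)‖) := by gcongr
        _ = 2 / 3 * ((η + ‖toL2 (D.res P x η)‖) * (2 * D.MperpInvNorm P)) := by ring
        _ ≤ 2 / 3 * (P.alpha * P.c1 * eb) := by gcongr
        _ = _ := by ring
    have r5 : η + ‖toL2 (D.res P x η)‖ ≤ P.c1 * eb := by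
      have h1 := h.one_le_Gam_mul hP
      have h2 := hP.one_add_beta
      have h3 : P.alpha * P.c1 * eb ≤ P.c1 * eb * (2 * D.MperpInvNorm P) := by
        have h4 : P.alpha ≤ 2 * D.MperpInvNorm P := by
          have h5 : P.alpha * P.Gam ≤ 2 * D.MperpInvNorm P * P.Gam := by linarith
          exact le_of_mul_le_mul_right h5 hP.Gam_pos
        calc P.alpha * P.c1 * eb = P.c1 * eb * P.alpha := by ring
          _ ≤ _ := by gcongr
      exact le_of_mul_le_mul_right (hcrit.trans h3) (by positivity)
    have r6 : P.xi * ‖D.perp (toL2 x)‖ ≤ ‖D.perp (toL2 x)‖ :=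
      mul_le_of_le_one_left (norm_nonneg _) hξ1.le
    linarith

omit h in
lemma three_c1_div_sqrt (t : ℝ) : 3 * t / √2 = 3 / 2 * √2 * t := by
  have h0 : √2 ≠ 0 := by positivity
  have h1 : √2 * √2 = 2 := Real.mul_self_sqrt (by norm_num)
  field_simp
  linear_combination (-t) * h1

/-- A cycle halves the error bound. The thresholding tolerance exceeds the distance to
`span {u}` by a fixed fraction of `ε̄`. -/
lemma cycle_spec [Nontrivial I] (hP : P.Valid) {v : I →₀ ℝ} {eb : ℝ}
    (heb : 0 < eb) (heb1 : eb ≤ P.eps0) (hv : ‖toL2 v‖ = 1) (he : ‖D.perp (toL2 v)‖ ≤ eb) :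
    1 / 2 ≤ ‖toL2 (D.approx (D.iter P v eb (D.blockLen P v eb)) (3 * P.c1 * eb / √2))‖ ∧
    ‖toL2 (D.cycle P v eb)‖ = 1 ∧ ‖D.perp (toL2 (D.cycle P v eb))‖ ≤ eb / 2 ∧
    ∃ σ : ℝ, |σ| = 1 ∧ ‖toL2 (D.iter P v eb (D.blockLen P v eb)) - σ • D.u‖ + P.c1 * eb / 3
      ≤ 3 * P.c1 * eb / √2 := by
  have h1 := (h.iter_spec hP heb heb1 hv he (D.blockLen P v eb)).1
  have h2 := h.norm_perp_iter_blockLen_le hP heb heb1 hv he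
  have hc1 := hP.c1_pos
  have hc2 := hP.c1_le_tenth
  have hce : 0 < P.c1 * eb := by positivity
  have htol : 3 * P.c1 * eb / √2 = 3 / 2 * √2 * (P.c1 * eb) := by
    rw [← three_c1_div_sqrt]; ring
  have hs1 : √2 ≤ 3 / 2 := Real.sqrt_le_iff.2 ⟨by norm_num, by norm_num⟩
  have hs2 : 1 ≤ √2 := Real.le_sqrt_of_sq_le (by norm_num)
  have heb2 : eb < 1 := heb1.trans_lt (hP.eps0_lt_one h.gam_le_Gam)
  have hce1 : P.c1 * eb ≤ eb / 10 := by nlinarith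
  have htol0 : 0 < 3 * P.c1 * eb / √2 := by positivity
  have h3 := h.approx_spec.error (D.iter P v eb (D.blockLen P v eb)) _ htol0
  rw [htol] at h3 ⊢
  have hle : 3 / 2 * √2 * (P.c1 * eb) ≤ 9 / 4 * (P.c1 * eb) := by gcongr; linarith
  unfold Data.cycle
  rw [htol]
  set y := D.iter P v eb (D.blockLen P v eb) with hy
  set z := D.approx y (3 / 2 * √2 * (P.c1 * eb)) with hz
  have h4 : 1 / 2 ≤ ‖toL2 z‖ := by
    have := norm_sub_norm_le (toL2 y) (toL2 z)
    linarith
  have h5 : toL2 z ≠ 0 := norm_pos_iff.1 (by linarith)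
  refine ⟨h4, norm_unitVec h5, ?_, ?_⟩
  · rw [unitVec, toL2_smul]
    refine (h.norm_perp_unit_le h1.ge h5).trans ?_
    linarith
  · obtain ⟨σ, hσ, hd⟩ := h.exists_sign h1
    refine ⟨σ, hσ, ?_⟩
    have h6 : √2 * ‖D.perp (toL2 y)‖ ≤ √2 * (7 / 6 * P.c1 * eb) := by gcongr
    have h7 : 1 * (P.c1 * eb) ≤ √2 * (P.c1 * eb) := by gcongr
    linarith

omit h in
lemma cycleTol_pos (hP : P.Valid) (k : ℕ) : 0 < cycleTol P k :=
  div_pos hP.eps0_pos (by positivity)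

omit h in
lemma cycleTol_le (hP : P.Valid) (k : ℕ) : cycleTol P k ≤ P.eps0 :=
  div_le_self hP.eps0_pos.le (one_le_pow₀ (by norm_num))

omit h in
lemma cycleTol_succ (k : ℕ) : cycleTol P (k + 1) = cycleTol P k / 2 := by
  unfold cycleTol
  rw [pow_succ, div_div]

/-- Convergence of the eigensolver. -/
lemma ubar_spec [Nontrivial I] (hP : P.Valid) (k : ℕ) :
    ‖toL2 (D.ubar P k)‖ = 1 ∧ ‖D.perp (toL2 (D.ubar P k))‖ ≤ cycleTol P k := by
  induction k with
  | zero => exact ⟨h.x0_norm, by simpa [cycleTol, Data.ubar] using h.x0_near⟩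
  | succ k ih =>
    obtain ⟨-, h2, h3, -⟩ := h.cycle_spec hP (cycleTol_pos hP k) (cycleTol_le hP k) ih.1 ih.2
    exact ⟨h2, by rw [cycleTol_succ]; exact h3⟩

omit h in
lemma lastCycle_mem (hP : P.Valid) {ε : ℝ} (hε : 0 < ε) : cycleTol P (lastCycle P ε) / 2 ≤ ε := by
  have hne : {k | cycleTol P k / 2 ≤ ε}.Nonempty := by
    obtain ⟨n, hn⟩ := exists_pow_lt_of_lt_one (div_pos hε hP.eps0_pos)
      (show (1 / 2 : ℝ) < 1 by norm_num)
    refine ⟨n, ?_⟩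
    rw [lt_div_iff₀ hP.eps0_pos, one_div_pow] at hn
    have h1 := cycleTol_pos hP n
    have h2 : cycleTol P n = 1 / 2 ^ n * P.eps0 := by unfold cycleTol; ring
    have : cycleTol P n / 2 ≤ ε := by linarith
    exact this
  exact Nat.sInf_mem hne

omit h in
lemma le_cycleTol (hP : P.Valid) (hgG : P.gam ≤ P.Gam) {ε : ℝ} (hε1 : ε ≤ 1) {k : ℕ}
    (hk : k ≤ lastCycle P ε) (hε : 0 < ε) : P.eps0 * ε ≤ cycleTol P k := by
  have he := hP.eps0_pos
  rcases Nat.eq_zero_or_pos k with rfl | hk0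
  · rw [cycleTol, pow_zero, div_one]
    nlinarith
  · have h1 : k - 1 ∉ {k | cycleTol P k / 2 ≤ ε} := by
      refine Nat.notMem_of_lt_sInf (lt_of_lt_of_le ?_ hk)
      omega
    have h2 : ¬ cycleTol P (k - 1) / 2 ≤ ε := h1
    rw [← cycleTol_succ, Nat.sub_add_cancel hk0] at h2
    have h3 := hP.eps0_lt_one hgG
    nlinarith

lemma uEps_spec [Nontrivial I] (hP : P.Valid) {ε : ℝ} (hε : 0 < ε) :
    ‖toL2 (D.uEps P ε)‖ = 1 ∧ ‖D.perp (toL2 (D.uEps P ε))‖ ≤ ε ∧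
      ‖D.perp (toL2 (D.uEps P ε))‖ ^ 2 ≤ P.a := by
  obtain ⟨h1, h2⟩ := h.ubar_spec hP (lastCycle P ε + 1)
  refine ⟨h1, ?_, ?_⟩
  · refine h2.trans ?_
    rw [cycleTol_succ]
    exact lastCycle_mem hP hε
  · refine le_trans ?_ hP.eps0_sq_le
    have := h2.trans (cycleTol_le hP _)
    unfold Data.uEps
    gcongr

end Data.Admissible

/-! ### Accuracy of the improved scalar product -/

lemma CompressConst.sum_wt_le (Q : CompressConst) (n : ℕ) : ∑ j ∈ range n, Q.wt j ≤ 1 :=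
  sum_le_hasSum _ (fun i _ => (Q.wt_pos i).le) Q.wt_sum

section ImprovedScal

variable {I : Type w} {approx : (I →₀ ℝ) → ℝ → (I →₀ ℝ)} {sb : ℝ}

lemma norm_le_two_rpow_levels_mul (hsb : 0 < sb) (v : I →₀ ℝ) {ζ : ℝ} (hζ : 0 < ζ) :
    ‖toL2 v‖ ≤ (2 : ℝ) ^ (((levels sb v ζ : ℕ) : ℝ) * sb) * ζ := by
  rcases (norm_nonneg (toL2 v)).eq_or_lt with h0 | h0
  · rw [← h0]; positivity
  · have h1 : Real.logb 2 (‖toL2 v‖ / ζ) ≤ (levels sb v ζ : ℕ) * sb := by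
      rw [← div_le_iff₀ hsb]
      exact Nat.le_ceil _
    rw [Real.logb_le_iff_le_rpow one_lt_two (by positivity), div_le_iff₀ hζ] at h1
    exact h1

lemma sum_piece_aux (v : I →₀ ℝ) (ζ : ℝ) (n : ℕ) :
    ∑ l ∈ range (n + 1), piece approx sb v ζ l
      = v - approx v ((2 : ℝ) ^ ((n : ℝ) * sb) * ζ) := by
  induction n with
  | zero => simp [piece]
  | succ n ih =>
    rw [Finset.sum_range_succ, ih, piece]
    push_cast
    abel

/-- The pieces add up to `v`. -/
lemma sum_piece (ha : IsApprox approx) (hsb : 0 < sb) (v : I →₀ ℝ) {ζ : ℝ} (hζ : 0 < ζ) :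
    ∑ l ∈ range (levels sb v ζ + 2), piece approx sb v ζ l = v := by
  rw [sum_piece_aux, ha.eq_zero (by positivity), sub_zero]
  refine (norm_le_two_rpow_levels_mul hsb v hζ).trans ?_
  gcongr
  · norm_num
  · linarith

lemma norm_piece_zero_le (ha : IsApprox approx) (v : I →₀ ℝ) {ζ : ℝ} (hζ : 0 < ζ) :
    ‖toL2 (piece approx sb v ζ 0)‖ ≤ ζ := by
  rw [piece, toL2_sub]
  exact ha.error v ζ hζ

lemma norm_piece_succ_le (ha : IsApprox approx) (v : I →₀ ℝ) {ζ : ℝ} (hζ : 0 < ζ) (j : ℕ) :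
    ‖toL2 (piece approx sb v ζ (j + 1))‖
      ≤ (1 + (2 : ℝ) ^ sb) * ((2 : ℝ) ^ ((j : ℝ) * sb) * ζ) := by
  have h1 := ha.error v ((2 : ℝ) ^ ((j : ℝ) * sb) * ζ) (by positivity)
  have h2 := ha.error v ((2 : ℝ) ^ (((j : ℝ) + 1) * sb) * ζ) (by positivity)
  have h3 : (2 : ℝ) ^ (((j : ℝ) + 1) * sb) = 2 ^ sb * 2 ^ ((j : ℝ) * sb) := by
    rw [← Real.rpow_add two_pos]; ring_nf
  rw [h3] at h2
  rw [piece, h3, toL2_sub]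
  generalize toL2 (approx v ((2 : ℝ) ^ ((j : ℝ) * sb) * ζ)) = a at *
  generalize toL2 (approx v (2 ^ sb * (2 : ℝ) ^ ((j : ℝ) * sb) * ζ)) = b at *
  calc ‖a - b‖ = ‖(toL2 v - b) - (toL2 v - a)‖ := by congr 1; abel
    _ ≤ ‖toL2 v - b‖ + ‖toL2 v - a‖ := norm_sub_le _ _
    _ ≤ _ := by linarith

lemma IsCompression.cst_nonneg {B : L2 I →L[ℝ] L2 I} {Bc : ℕ → L2 I →L[ℝ] L2 I} {sstar : ℝ}
    {Q : CompressConst} (hB : IsCompression B Bc sstar Q) : 0 ≤ Q.cst := by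
  have h1 := (norm_nonneg _).trans (hB 0).2.2
  have h2 : 0 < (2 : ℝ) ^ (-(((0 : ℕ) : ℝ) * sstar)) := by positivity
  exact nonneg_of_mul_nonneg_left (nonneg_of_mul_nonneg_left h1 (Q.wt_pos _)) h2

/-- The vector `∑_j B_j v_j(ζ)`. -/
noncomputable def applyVec (approx : (I →₀ ℝ) → ℝ → (I →₀ ℝ)) (sb : ℝ)
    (Bc : ℕ → L2 I →L[ℝ] L2 I) (v : I →₀ ℝ) (ζ : ℝ) : L2 I :=
  ∑ j ∈ range (levels sb v ζ + 1), Bc j (toL2 (piece approx sb v ζ (j + 1)))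

lemma applyVec_apply (Bc : ℕ → L2 I →L[ℝ] L2 I) (v : I →₀ ℝ) (ζ : ℝ) (i : I) :
    applyVec approx sb Bc v ζ i = applyEntry approx sb Bc v ζ i := by
  rw [applyVec, applyEntry, lp.coeFn_sum, Finset.sum_apply]

lemma norm_sub_applyVec_le (ha : IsApprox approx) {B : L2 I →L[ℝ] L2 I}
    {Bc : ℕ → L2 I →L[ℝ] L2 I} {sstar : ℝ} {Q : CompressConst}
    (hB : IsCompression B Bc sstar Q) (hsb : 0 < sb) (hss : sb ≤ sstar) (v : I →₀ ℝ) {ζ : ℝ}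
    (hζ : 0 < ζ) : ‖B (toL2 v) - applyVec approx sb Bc v ζ‖ ≤ applyConst sb B Q * ζ := by
  have hc := hB.cst_nonneg
  have h1 : B (toL2 v) - applyVec approx sb Bc v ζ = B (toL2 (piece approx sb v ζ 0))
      + ∑ j ∈ range (levels sb v ζ + 1), (B - Bc j) (toL2 (piece approx sb v ζ (j + 1))) := by
    conv_lhs => rw [← sum_piece (sb := sb) ha hsb v hζ]
    rw [toL2_sum, map_sum, Finset.sum_range_succ', sum_piece ha hsb v hζ, applyVec]
    simp only [sub_apply, Finset.sum_sub_distrib]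
    abel
  have h2 : ∀ j, ‖(B - Bc j) (toL2 (piece approx sb v ζ (j + 1)))‖
      ≤ (1 + (2 : ℝ) ^ sb) * Q.cst * ζ * Q.wt (j + 1) := by
    intro j
    have h3 : (2 : ℝ) ^ (-((j : ℝ) * sstar)) * (2 : ℝ) ^ ((j : ℝ) * sb) ≤ 1 := by
      rw [← Real.rpow_add two_pos]
      refine Real.rpow_le_one_of_one_le_of_nonpos one_le_two ?_
      have : (j : ℝ) * sb ≤ j * sstar := by gcongr
      linarith
    have hw := Q.wt_pos (j + 1)
    calc ‖(B - Bc j) (toL2 (piece approx sb v ζ (j + 1)))‖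
        ≤ ‖B - Bc j‖ * ‖toL2 (piece approx sb v ζ (j + 1))‖ := ContinuousLinearMap.le_opNorm _ _
      _ ≤ (Q.cst * (2 : ℝ) ^ (-((j : ℝ) * sstar)) * Q.wt (j + 1))
            * ((1 + (2 : ℝ) ^ sb) * ((2 : ℝ) ^ ((j : ℝ) * sb) * ζ)) := by
          refine mul_le_mul (hB j).2.2 (norm_piece_succ_le ha v hζ j) (norm_nonneg _) ?_
          positivity
      _ = (1 + (2 : ℝ) ^ sb) * Q.cst * ζ * Q.wt (j + 1)
            * ((2 : ℝ) ^ (-((j : ℝ) * sstar)) * (2 : ℝ) ^ ((j : ℝ) * sb)) := by ring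
      _ ≤ (1 + (2 : ℝ) ^ sb) * Q.cst * ζ * Q.wt (j + 1) * 1 := by gcongr
      _ = _ := mul_one _
  have h4 : ∑ j ∈ range (levels sb v ζ + 1), Q.wt (j + 1) ≤ 1 := by
    have h5 := Q.sum_wt_le (levels sb v ζ + 1 + 1)
    rw [Finset.sum_range_succ'] at h5
    linarith [Q.wt_pos 0]
  rw [h1]
  calc ‖B (toL2 (piece approx sb v ζ 0))
        + ∑ j ∈ range (levels sb v ζ + 1), (B - Bc j) (toL2 (piece approx sb v ζ (j + 1)))‖
      ≤ ‖B‖ * ζ + ∑ j ∈ range (levels sb v ζ + 1),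
          (1 + (2 : ℝ) ^ sb) * Q.cst * ζ * Q.wt (j + 1) := by
        refine (norm_add_le _ _).trans (add_le_add ?_ ?_)
        · exact (B.le_opNorm _).trans (by gcongr; exact norm_piece_zero_le ha v hζ)
        · exact (norm_sum_le _ _).trans (Finset.sum_le_sum fun j _ => h2 j)
    _ = ‖B‖ * ζ + (1 + (2 : ℝ) ^ sb) * Q.cst * ζ
          * ∑ j ∈ range (levels sb v ζ + 1), Q.wt (j + 1) := by rw [Finset.mul_sum]
    _ ≤ ‖B‖ * ζ + (1 + (2 : ℝ) ^ sb) * Q.cst * ζ * 1 := by gcongr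
    _ = applyConst sb B Q * ζ := by unfold applyConst; ring

lemma scalTol_pos (Q : CompressConst) {δ : ℝ} (hδ : 0 < δ) (l : ℕ) : 0 < scalTol sb Q δ l := by
  have hw := Q.wt_pos
  cases l with
  | zero => exact mul_pos (hw 0) (by positivity)
  | succ j =>
    have := hw (j + 1)
    unfold scalTol
    positivity

lemma applyConst_pos {B : L2 I →L[ℝ] L2 I} {Q : CompressConst} (hB : 0 < ‖B‖) (hc : 0 ≤ Q.cst) :
    0 < applyConst sb B Q := by
  unfold applyConst
  positivity

/-- The improved scalar product has accuracy `δ`: the pieces `v_j(√δ)` of size `2^{j s̄} √δ` are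
paired with approximations of `B v` of accuracy proportional to `2^{-j s̄} √δ`. -/
lemma abs_scalImp_sub_le (ha : IsApprox approx) {B : L2 I →L[ℝ] L2 I} (hB0 : 0 < ‖B‖)
    {Bc : ℕ → L2 I →L[ℝ] L2 I} {sstar : ℝ} {Q : CompressConst}
    (hB : IsCompression B Bc sstar Q) (hsb : 0 < sb) (hss : sb ≤ sstar) (v : I →₀ ℝ) {δ : ℝ}
    (hδ : 0 < δ) :
    |scalImp approx sb B Bc Q v δ - inner ℝ (B (toL2 v)) (toL2 v)| ≤ δ := by
  have hC := applyConst_pos (sb := sb) hB0 hB.cst_nonneg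
  have hd : 0 < √δ := Real.sqrt_pos.2 hδ
  have hdd : √δ * √δ = δ := Real.mul_self_sqrt hδ.le
  set p := piece approx sb v (√δ) with hp
  set y : ℕ → L2 I := fun l =>
    applyVec approx sb Bc v (scalTol sb Q δ l / applyConst sb B Q) with hy
  have h1 : scalImp approx sb B Bc Q v δ
      = ∑ l ∈ range (levels sb v (√δ) + 2), inner ℝ (toL2 (p l)) (y l) := by
    unfold scalImp
    refine Finset.sum_congr rfl fun l _ => ?_
    rw [inner_toL2]
    refine Finset.sum_congr rfl fun i _ => ?_
    rw [hy, applyVec_apply]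
  have h2 : inner ℝ (B (toL2 v)) (toL2 v)
      = ∑ l ∈ range (levels sb v (√δ) + 2), inner ℝ (toL2 (p l)) (B (toL2 v)) := by
    rw [real_inner_comm, ← sum_inner, ← toL2_sum, sum_piece ha hsb v hd]
  have h3 : ∀ l, ‖B (toL2 v) - y l‖ ≤ scalTol sb Q δ l := by
    intro l
    have := norm_sub_applyVec_le ha hB hsb hss v
      (div_pos (scalTol_pos (sb := sb) Q hδ l) hC)
    rwa [mul_div_cancel₀ _ hC.ne'] at this
  have h4 : ∀ l, ‖toL2 (p l)‖ * scalTol sb Q δ l ≤ δ * Q.wt l := by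
    intro l
    have hw := Q.wt_pos l
    have htol := (scalTol_pos (sb := sb) Q hδ l).le
    cases l with
    | zero =>
      calc ‖toL2 (p 0)‖ * scalTol sb Q δ 0 ≤ √δ * scalTol sb Q δ 0 := by
            gcongr; exact norm_piece_zero_le ha v hd
        _ = √δ * √δ * Q.wt 0 := by unfold scalTol; ring
        _ = _ := by rw [hdd]
    | succ j =>
      have h5 : (2 : ℝ) ^ ((j : ℝ) * sb) * (2 : ℝ) ^ (-(sb * (j : ℝ))) = 1 := by
        rw [← Real.rpow_add two_pos, mul_comm sb, add_neg_cancel, Real.rpow_zero]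
      have h6 : (1 + (2 : ℝ) ^ sb) * (1 + (2 : ℝ) ^ sb)⁻¹ = 1 := mul_inv_cancel₀ (by positivity)
      calc ‖toL2 (p (j + 1))‖ * scalTol sb Q δ (j + 1)
          ≤ (1 + (2 : ℝ) ^ sb) * ((2 : ℝ) ^ ((j : ℝ) * sb) * √δ) * scalTol sb Q δ (j + 1) := by
            gcongr; exact norm_piece_succ_le ha v hd j
        _ = ((1 + (2 : ℝ) ^ sb) * (1 + (2 : ℝ) ^ sb)⁻¹)
            * ((2 : ℝ) ^ ((j : ℝ) * sb) * (2 : ℝ) ^ (-(sb * (j : ℝ)))) * (√δ * √δ)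
            * Q.wt (j + 1) := by unfold scalTol; ring
        _ = _ := by rw [h5, h6, hdd, one_mul, one_mul]
  rw [h1, h2, ← Finset.sum_sub_distrib]
  calc |∑ l ∈ range (levels sb v (√δ) + 2),
        (inner ℝ (toL2 (p l)) (y l) - inner ℝ (toL2 (p l)) (B (toL2 v)))|
      ≤ ∑ l ∈ range (levels sb v (√δ) + 2), δ * Q.wt l := by
        refine (Finset.abs_sum_le_sum_abs _ _).trans (Finset.sum_le_sum fun l _ => ?_)
        rw [← inner_sub_right]
        refine (abs_real_inner_le_norm _ _).trans ?_
        rw [norm_sub_rev]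
        exact (mul_le_mul_of_nonneg_left (h3 l) (norm_nonneg _)).trans (h4 l)
    _ ≤ δ := by
        rw [← Finset.mul_sum]
        exact mul_le_of_le_one_right hδ.le (Q.sum_wt_le _)

end ImprovedScal

/-- The error bound for the final Rayleigh quotient. -/
lemma Data.Admissible.abs_lam_sub_lamStar_le {I : Type w} [Nontrivial I] {D : Data I} {P : Params}
    (h : D.Admissible P) (hP : P.Valid) {ε : ℝ} (hε : 0 < ε) :
    |P.lam - D.lamStar P ε| ≤ (1 + 2 * P.Gam * P.K / P.gam) * ε ^ 2 := by
  obtain ⟨h1, h2, h3⟩ := h.uEps_spec hP hε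
  have h4 := (h.rayl_spec hP h1 h3
    (scA := scalImp D.approx P.sbar D.A D.Ac P.compA)
    (scC := scalImp D.approx P.sbar D.C D.Cc P.compC)
    (fun _ hη => abs_scalImp_sub_le h.approx_spec (h.opNorm_A_pos hP) h.A_comp hP.sbar_pos
      hP.sbar_lt.le _ hη)
    (fun _ hη => abs_scalImp_sub_le h.approx_spec h.opNorm_C_pos h.C_comp hP.sbar_pos
      hP.sbar_lt.le _ hη) (η := ε ^ 2) (by positivity)).1
  have h5 := h4.trans (raylTol_le P _)
  have h6 := h.rayleigh_sub_le hP h1 h3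
  have h7 := h.lam_le_rayleigh (ne_zero_of_norm_eq_one h1)
  have hG := hP.Gam_pos
  have hg := hP.gam_pos
  have hK := hP.K_pos
  have h8 : P.Gam * P.K / P.gam * ‖D.perp (toL2 (D.uEps P ε))‖ ^ 2
      ≤ P.Gam * P.K / P.gam * ε ^ 2 := by gcongr
  have h9 : 0 ≤ P.Gam * P.K / P.gam * ε ^ 2 := by positivity
  have h10 : (1 + 2 * P.Gam * P.K / P.gam) * ε ^ 2
      = ε ^ 2 + 2 * (P.Gam * P.K / P.gam * ε ^ 2) := by ring
  rw [h10]
  unfold Data.lamStar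
  rw [abs_le] at h5 ⊢
  constructor <;> linarith [h5.1, h5.2]

/-! ### Cost of the eigensolver -/

section Constants

variable {s₀ s X η η' c : ℝ}

/-- Constant factors stay bounded under the power `1/s`, uniformly for `s ≥ s₀`. -/
lemma mul_rpow_one_div_le (hs₀ : 0 < s₀) (hs : s₀ ≤ s) (hX : 0 ≤ X) (hc : 1 ≤ c) :
    (c * X) ^ (1 / s) ≤ c ^ (1 / s₀) * X ^ (1 / s) := by
  rw [Real.mul_rpow (by linarith) hX]
  gcongr

lemma div_rpow_one_div_le (hs₀ : 0 < s₀) (hs : s₀ ≤ s) (hX : 0 ≤ X) (hη : 0 < η) (hη' : 0 < η')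
    (hc : 1 ≤ c) (h : η ≤ c * η') : (X / η') ^ (1 / s) ≤ c ^ (1 / s₀) * (X / η) ^ (1 / s) := by
  refine le_trans ?_ (mul_rpow_one_div_le hs₀ hs (by positivity) hc)
  have hs' : 0 < s := by linarith
  refine Real.rpow_le_rpow (by positivity) ?_ (by positivity)
  rw [div_le_iff₀ hη']
  calc X = X / η * η := by field_simp
    _ ≤ X / η * (c * η') := by gcongr
    _ = c * (X / η) * η' := by ring

end Constants

/-- A common constant in the sparsity of `A` and `C` for exponents in `[s₀, s̄]`. -/
noncomputable def Params.kap (P : Params) (s₀ : ℝ) : ℝ :=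
  max 1 (max (P.kA s₀ P.sbar) (P.kC s₀ P.sbar))

lemma Params.one_le_kap (P : Params) (s₀ : ℝ) : 1 ≤ P.kap s₀ := le_max_left _ _

lemma ApplyScheme.IsSparse.bounds {I : Type w} {B : L2 I →L[ℝ] L2 I} {S : ApplyScheme B}
    {sstar : ℝ} {κ : ℝ → ℝ → ℝ} (hS : S.IsSparse sstar κ) {s₀ s₁ s k : ℝ} (hs₀ : 0 < s₀)
    (hs₁ : s₁ < sstar) (hs : s ∈ Set.Icc s₀ s₁) (hk : κ s₀ s₁ ≤ k) (x : I →₀ ℝ) {δ : ℝ}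
    (hδ : 0 < δ) :
    normA s (toL2 (S.run x δ)) ≤ k * normA s (toL2 x) ∧
    (nnz (S.run x δ) : ℝ) ≤ k * (normA s (toL2 x) / δ) ^ (1 / s) ∧
    (S.ops x δ : ℝ) ≤ k * ((normA s (toL2 x) / δ) ^ (1 / s) + nnz x + 1) := by
  obtain ⟨h1, h2, h3⟩ := hS s₀ s₁ hs₀ hs₁ s hs x δ hδ
  have hX := normA_nonneg (s := s) (toL2 x)
  exact ⟨h1.trans (by gcongr), h2.trans (by gcongr), h3.trans (by gcongr)⟩

namespace Data.Admissible

lemma applyA_bounds {I : Type w} {D : Data I} {P : Params} (h : D.Admissible P) (hP : P.Valid)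
    {s₀ s : ℝ} (hs₀ : 0 < s₀) (hs : s ∈ Set.Icc s₀ P.sbar) (x : I →₀ ℝ) {δ : ℝ} (hδ : 0 < δ) :
    normA s (toL2 (D.applyA.run x δ)) ≤ P.kap s₀ * normA s (toL2 x) ∧
    (nnz (D.applyA.run x δ) : ℝ) ≤ P.kap s₀ * (normA s (toL2 x) / δ) ^ (1 / s) ∧
    (D.applyA.ops x δ : ℝ) ≤ P.kap s₀ * ((normA s (toL2 x) / δ) ^ (1 / s) + nnz x + 1) :=
  h.A_sparse.bounds hs₀ hP.sbar_lt hs ((le_max_left _ _).trans (le_max_right _ _)) x hδ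

lemma applyC_bounds {I : Type w} {D : Data I} {P : Params} (h : D.Admissible P) (hP : P.Valid)
    {s₀ s : ℝ} (hs₀ : 0 < s₀) (hs : s ∈ Set.Icc s₀ P.sbar) (x : I →₀ ℝ) {δ : ℝ} (hδ : 0 < δ) :
    normA s (toL2 (D.applyC.run x δ)) ≤ P.kap s₀ * normA s (toL2 x) ∧
    (nnz (D.applyC.run x δ) : ℝ) ≤ P.kap s₀ * (normA s (toL2 x) / δ) ^ (1 / s) ∧
    (D.applyC.ops x δ : ℝ) ≤ P.kap s₀ * ((normA s (toL2 x) / δ) ^ (1 / s) + nnz x + 1) :=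
  h.C_sparse.bounds hs₀ hP.sbar_lt hs ((le_max_right _ _).trans (le_max_right _ _)) x hδ

end Data.Admissible

lemma scalOps_le {I : Type w} {approx : (I →₀ ℝ) → ℝ → (I →₀ ℝ)} (ha : IsApprox approx)
    {B : L2 I →L[ℝ] L2 I} (hB : 0 < ‖B‖) (S : ApplyScheme B) {s₀ s k : ℝ} (hs₀ : 0 < s₀)
    (hs : s₀ ≤ s) (hk : 1 ≤ k) (x : I →₀ ℝ)
    (hS : ∀ δ, 0 < δ → (nnz (S.run x δ) : ℝ) ≤ k * (normA s (toL2 x) / δ) ^ (1 / s) ∧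
      (S.ops x δ : ℝ) ≤ k * ((normA s (toL2 x) / δ) ^ (1 / s) + nnz x + 1))
    {η η' c : ℝ} (hη : 0 < η) (hη' : 0 < η') (hc : 1 ≤ c) (hηc : η ≤ c * η') :
    (scalOps approx S x η' : ℝ)
      ≤ (3 + 2 * k * (2 * c) ^ (1 / s₀)) * (nnz x + (normA s (toL2 x) / η) ^ (1 / s) + 1) := by
  obtain ⟨h1, h2⟩ := hS (η' / 2) (by positivity)
  have hX := normA_nonneg (s := s) (toL2 x)
  have h3 := div_rpow_one_div_le (η' := η' / 2) (c := 2 * c) hs₀ hs hX hη (by positivity)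
    (by linarith) (by linarith)
  have h4 : (nnz (approx x (η' / (2 * ‖B‖))) : ℝ) ≤ nnz x := by
    exact_mod_cast ha.nnz_le_self x (by positivity)
  have h5 : (1 : ℝ) ≤ (2 * c) ^ (1 / s₀) := Real.one_le_rpow (by linarith) (by positivity)
  have hT : 0 ≤ (normA s (toL2 x) / η) ^ (1 / s) := by positivity
  unfold scalOps
  push_cast
  generalize (normA s (toL2 x) / η) ^ (1 / s) = T at *
  generalize (normA s (toL2 x) / (η' / 2)) ^ (1 / s) = T' at *
  generalize (2 * c) ^ (1 / s₀) = b at *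
  have hn : (0 : ℝ) ≤ nnz x := by positivity
  have h6 : k * T' ≤ k * (b * T) := by gcongr
  have h7 : k * (nnz x + 1) ≤ 2 * k * b * ((nnz x : ℝ) + 1) := by
    have h9 : k ≤ 2 * k * b := by nlinarith
    gcongr
  have h8 : (S.ops x (η' / 2) : ℝ) ≤ k * T' + k * (nnz x + 1) := by linarith
  have h10 : (3 + 2 * k * b) * (nnz x + T + 1)
    = 3 * nnz x + 3 * T + 3 + 2 * (k * (b * T)) + 2 * k * b * ((nnz x : ℝ) + 1) := by ring
  rw [h10]
  linarith

lemma exists_raylTol_ge {P : Params} (hP : P.Valid) {H : ℝ} (hH : 0 < H) :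
    ∃ c : ℝ, 1 ≤ c ∧ ∀ η, 0 < η → η ≤ H → η ≤ c * raylTol P η := by
  have h1 := hP.cC_pos
  have h2 := hP.gam_pos
  have h3 := hP.Gam_pos
  set m := min (P.gam / P.cC) (3 * P.Gam / P.cC) with hm
  have hm0 : 0 < m := lt_min (by positivity) (by positivity)
  refine ⟨max 1 (H / m), le_max_left _ _, fun η hη hηH => ?_⟩
  rw [raylTol, ← hm]
  rcases min_cases η m with ⟨h4, -⟩ | ⟨h4, -⟩
  · rw [h4]
    exact le_mul_of_one_le_left hη.le (le_max_left _ _)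
  · rw [h4]
    calc η ≤ H := hηH
      _ = H / m * m := by field_simp
      _ ≤ _ := by gcongr; exact le_max_right _ _

/-- Cost of the Rayleigh quotient with the simple scalar product. -/
lemma exists_raylSimpleOps_le {P : Params} (hP : P.Valid) {s₀ : ℝ} (hs₀ : 0 < s₀) {H : ℝ}
    (hH : 0 < H) :
    ∃ K : ℝ, 1 ≤ K ∧ ∀ (I : Type w) (D : Data I), D.Admissible P → ∀ s ∈ Set.Icc s₀ P.sbar,
      ∀ (x : I →₀ ℝ) (η : ℝ), 0 < η → η ≤ H →
        (D.raylSimpleOps P x η : ℝ) ≤ K * (nnz x + (normA s (toL2 x) / η) ^ (1 / s) + 1) := by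
  obtain ⟨c, hc, hcη⟩ := exists_raylTol_ge hP hH
  have hcC := hP.cC_pos
  have hG := hP.Gam_pos
  have hk := P.one_le_kap s₀
  set k := P.kap s₀
  set cA : ℝ := max 1 (c * (2 / P.cC)) with hcA
  set cB : ℝ := max 1 (c * (6 * P.Gam / P.cC ^ 2)) with hcB
  have hA1 : 1 ≤ cA := le_max_left _ _
  have hB1 : 1 ≤ cB := le_max_left _ _
  refine ⟨(3 + 2 * k * (2 * cA) ^ (1 / s₀)) + (3 + 2 * k * (2 * cB) ^ (1 / s₀)) + 1, ?_, ?_⟩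
  · have : 0 ≤ 2 * k * (2 * cA) ^ (1 / s₀) := by positivity
    have : 0 ≤ 2 * k * (2 * cB) ^ (1 / s₀) := by positivity
    linarith
  · intro I D h s hs x η hη hηH
    have ht := raylTol_pos hP hη
    have h1 := hcη η hη hηH
    have h2 := scalOps_le h.approx_spec (h.opNorm_A_pos hP) D.applyA hs₀ hs.1 hk x
      (fun δ hδ => (h.applyA_bounds hP hs₀ hs x hδ).2) hη
      (η' := raylTol P η * P.cC / 2) (by positivity) hA1 (by
        calc η ≤ c * raylTol P η := h1
          _ = c * (2 / P.cC) * (raylTol P η * P.cC / 2) := by field_simp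
          _ ≤ _ := by gcongr; exact le_max_right _ _)
    have h3 := scalOps_le h.approx_spec h.opNorm_C_pos D.applyC hs₀ hs.1 hk x
      (fun δ hδ => (h.applyC_bounds hP hs₀ hs x hδ).2) hη
      (η' := P.cC ^ 2 * raylTol P η / (6 * P.Gam)) (by positivity) hB1 (by
        calc η ≤ c * raylTol P η := h1
          _ = c * (6 * P.Gam / P.cC ^ 2) * (P.cC ^ 2 * raylTol P η / (6 * P.Gam)) := by
              field_simp
          _ ≤ _ := by gcongr; exact le_max_right _ _)
    have hT : 0 ≤ (normA s (toL2 x) / η) ^ (1 / s) := by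
      have := normA_nonneg (s := s) (toL2 x)
      positivity
    have hn : (0 : ℝ) ≤ nnz x := by positivity
    unfold Data.raylSimpleOps raylOps
    push_cast
    generalize (normA s (toL2 x) / η) ^ (1 / s) = T at *
    rw [add_mul, add_mul]
    linarith

/-- Size and cost of the approximate residual. -/
lemma exists_res_le {P : Params} (hP : P.Valid) {s₀ : ℝ} (hs₀ : 0 < s₀) :
    ∃ K : ℝ, 1 ≤ K ∧ ∀ (I : Type w) (D : Data I), D.Admissible P → ∀ s ∈ Set.Icc s₀ P.sbar,
      ∀ (x : I →₀ ℝ), ‖toL2 x‖ = 1 → ‖D.perp (toL2 x)‖ ≤ P.eps0 → ∀ η : ℝ, 0 < η → η ≤ 1 / 2 →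
        normA s (toL2 (D.res P x η)) ≤ K * normA s (toL2 x) ∧
        (nnz (D.res P x η) : ℝ) ≤ K * (normA s (toL2 x) / η) ^ (1 / s) ∧
        (D.resOps P x η : ℝ) ≤ K * (nnz x + (normA s (toL2 x) / η) ^ (1 / s) + 1) := by
  have hα := hP.alpha_pos
  have hCC := hP.CC_pos
  have hcC := hP.cC_pos
  have hG := hP.Gam_pos
  obtain ⟨K₁, hK₁, hray⟩ := exists_raylSimpleOps_le.{w} hP hs₀ (H := 1 / 2 / (4 * P.CC * P.alpha))
    (by positivity)
  have hk := P.one_le_kap s₀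
  set k := P.kap s₀ with hk_def
  set L : ℝ := 3 * P.Gam / P.cC with hL
  have hL0 : 0 < L := by positivity
  set c : ℝ := 1 + 4 * P.CC * P.alpha + 2 * P.alpha + 4 * L * P.alpha with hc
  have hc1 : 1 ≤ c := by
    have : 0 ≤ 4 * P.CC * P.alpha + 2 * P.alpha + 4 * L * P.alpha := by positivity
    linarith
  set b : ℝ := c ^ (1 / s₀) with hb
  have hb1 : 1 ≤ b := Real.one_le_rpow hc1 (by positivity)
  set K₂ : ℝ := P.alpha * (2 * 3 ^ P.sbar * (k + L * k)) with hK₂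
  have hK₂0 : 0 ≤ K₂ := by positivity
  refine ⟨K₂ + K₁ * b + 8 * k * b, ?_, ?_⟩
  · have h1 : 0 ≤ K₁ * b := by positivity
    have h2 : 1 ≤ k * b := by nlinarith
    linarith
  intro I D h s hs x hx he η hη hη1
  have hs' : 0 < s := hs₀.trans_le hs.1
  have he2 : ‖D.perp (toL2 x)‖ ^ 2 ≤ P.a := le_trans (by gcongr) hP.eps0_sq_le
  have hη2 : 0 < η / (4 * P.CC * P.alpha) := by positivity
  obtain ⟨-, hl0, hl1⟩ := h.raylSimple_spec hP hx he2 hη2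
  have hro := hray I D h s hs x _ hη2 (by gcongr)
  unfold Data.res Data.resOps
  set l := D.raylSimple P x (η / (4 * P.CC * P.alpha)) with hl
  have hX := normA_nonneg (s := s) (toL2 x)
  obtain ⟨a1, a2, a3⟩ := h.applyA_bounds hP hs₀ hs x (δ := η / (2 * P.alpha)) (by positivity)
  obtain ⟨b1, b2, b3⟩ := h.applyC_bounds hP hs₀ hs x (δ := η / (4 * l * P.alpha)) (by positivity)
  have key : ∀ e : ℝ, 0 < e → e ≤ c → (normA s (toL2 x) / (η / e)) ^ (1 / s)
      ≤ b * (normA s (toL2 x) / η) ^ (1 / s) := by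
    intro e he hec
    refine div_rpow_one_div_le hs₀ hs.1 hX hη (by positivity) hc1 ?_
    calc η = e * (η / e) := by field_simp
      _ ≤ _ := by gcongr
  have t1 := key (4 * P.CC * P.alpha) (by positivity) (by
    have : 0 ≤ 2 * P.alpha + 4 * L * P.alpha := by positivity
    linarith)
  have t2 := key (2 * P.alpha) (by positivity) (by
    have : 0 ≤ 4 * P.CC * P.alpha + 4 * L * P.alpha := by positivity
    linarith)
  have t3 := key (4 * l * P.alpha) (by positivity) (by
    have : 0 ≤ 4 * P.CC * P.alpha + 2 * P.alpha := by positivity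
    have : 4 * l * P.alpha ≤ 4 * L * P.alpha := by gcongr
    linarith)
  have hT : 0 ≤ (normA s (toL2 x) / η) ^ (1 / s) := by positivity
  have hn : (0 : ℝ) ≤ nnz x := by positivity
  have hKT : 0 ≤ K₂ + K₁ * b := by positivity
  refine ⟨?_, ?_, ?_⟩
  · rw [toL2_smul, toL2_sub, toL2_smul]
    refine (normA_smul_le _ ?_).trans ?_
    · rw [← toL2_smul, ← toL2_sub]; exact memA_toL2 hs' _
    · have h1 := normA_sub_le hs' (memA_toL2 hs' (D.applyA.run x (η / (2 * P.alpha))))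
        (memA_smul l (memA_toL2 hs' (D.applyC.run x (η / (4 * l * P.alpha)))))
      have h2 := normA_smul_le l (memA_toL2 hs' (D.applyC.run x (η / (4 * l * P.alpha))))
      rw [abs_of_pos hl0] at h2
      have h3 : (3 : ℝ) ^ s ≤ 3 ^ P.sbar := Real.rpow_le_rpow_of_exponent_le (by norm_num) hs.2
      rw [abs_of_pos hα]
      calc _ ≤ P.alpha * (2 * 3 ^ s * (k * normA s (toL2 x) + l * (k * normA s (toL2 x)))) := by
            gcongr
            refine h1.trans ?_
            gcongr
            refine h2.trans ?_
            gcongr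
        _ ≤ P.alpha * (2 * 3 ^ P.sbar * (k * normA s (toL2 x) + L * (k * normA s (toL2 x)))) := by
            gcongr
        _ = K₂ * normA s (toL2 x) := by rw [hK₂]; ring
        _ ≤ _ := by
            gcongr
            have : 0 ≤ K₁ * b + 8 * k * b := by positivity
            linarith
  · have h1 : (nnz (P.alpha • (D.applyA.run x (η / (2 * P.alpha))
        - l • D.applyC.run x (η / (4 * l * P.alpha)))) : ℝ)
        ≤ nnz (D.applyA.run x (η / (2 * P.alpha)))
          + nnz (D.applyC.run x (η / (4 * l * P.alpha))) := by
      exact_mod_cast (nnz_smul_le _ _).trans ((nnz_sub_le _ _).trans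
        (add_le_add le_rfl (nnz_smul_le _ _)))
    have h2 : k * (normA s (toL2 x) / (η / (2 * P.alpha))) ^ (1 / s)
      ≤ k * (b * (normA s (toL2 x) / η) ^ (1 / s)) := by gcongr
    have h3 : k * (normA s (toL2 x) / (η / (4 * l * P.alpha))) ^ (1 / s)
      ≤ k * (b * (normA s (toL2 x) / η) ^ (1 / s)) := by gcongr
    have h4 : 0 ≤ (K₂ + K₁ * b) * (normA s (toL2 x) / η) ^ (1 / s) := by positivity
    have h5 : 0 ≤ k * (b * (normA s (toL2 x) / η) ^ (1 / s)) := by positivity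
    rw [add_mul]
    linarith
  · push_cast
    generalize (normA s (toL2 x) / η) ^ (1 / s) = T at *
    have h2 : k * (normA s (toL2 x) / (η / (2 * P.alpha))) ^ (1 / s) ≤ k * (b * T) := by gcongr
    have h3 : k * (normA s (toL2 x) / (η / (4 * l * P.alpha))) ^ (1 / s) ≤ k * (b * T) := by
      gcongr
    have h4 : K₁ * (nnz x + (normA s (toL2 x) / (η / (4 * P.CC * P.alpha))) ^ (1 / s) + 1)
        ≤ K₁ * b * (nnz x + T + 1) := by
      have h41 : (nnz x : ℝ) ≤ b * nnz x := le_mul_of_one_le_left hn hb1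
      rw [mul_assoc K₁]
      refine mul_le_mul_of_nonneg_left ?_ (by linarith)
      rw [mul_add, mul_add, mul_one]
      exact add_le_add (add_le_add h41 t1) hb1
    have h5 : k * ((nnz x : ℝ) + 1) ≤ k * b * (nnz x + 1) :=
      mul_le_mul_of_nonneg_right (le_mul_of_one_le_right (by linarith) hb1) (by positivity)
    have h6 : 0 ≤ K₂ * (nnz x + T + 1) := by positivity
    have h7 : 0 ≤ k * b * ((nnz x : ℝ) + 1) := by positivity
    rw [add_mul, add_mul]
    linarith

namespace Data.Admissible

/-- The `j`-th iterate of a block is controlled by the starting vector, with a constant that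
depends on `j`. -/
lemma exists_iter_le {P : Params} (hP : P.Valid) {s₀ : ℝ} (hs₀ : 0 < s₀) (j : ℕ) :
    ∃ K : ℝ, 1 ≤ K ∧ ∀ (I : Type w) (D : Data I), D.Admissible P → ∀ s ∈ Set.Icc s₀ P.sbar,
      ∀ (v : I →₀ ℝ) (eb : ℝ), 0 < eb → eb ≤ P.eps0 → ‖toL2 v‖ = 1 → ‖D.perp (toL2 v)‖ ≤ eb →
        normA s (toL2 (D.iter P v eb j)) ≤ K * normA s (toL2 v) ∧
        (nnz (D.iter P v eb j) : ℝ) ≤ K * (nnz v + (normA s (toL2 v) / eb) ^ (1 / s)) := by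
  induction j with
  | zero =>
    refine ⟨1, le_rfl, fun I D h s hs v eb heb _ _ _ => ⟨by simp [Data.iter], ?_⟩⟩
    have := normA_nonneg (s := s) (toL2 v)
    rw [one_mul, Data.iter]
    have : 0 ≤ (normA s (toL2 v) / eb) ^ (1 / s) := by positivity
    linarith
  | succ j ih =>
    obtain ⟨K, hK, ih⟩ := ih
    obtain ⟨R, hR, hres⟩ := exists_res_le.{w} hP hs₀
    have hξ : 0 < 1 - P.xi := by linarith [hP.xi_lt_one]
    have hξ1 : 1 ≤ 1 + 2 ^ j / (1 - P.xi) := by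
      have : 0 < 2 ^ j / (1 - P.xi) := by positivity
      linarith
    set c : ℝ := K * (1 + 2 ^ j / (1 - P.xi)) with hc
    have hc1 : 1 ≤ c := one_le_mul_of_one_le_of_one_le hK hξ1
    have hb0 : 0 ≤ c ^ (1 / s₀) := by positivity
    have h3 : (1 : ℝ) ≤ 3 ^ P.sbar := Real.one_le_rpow (by norm_num) hP.sbar_pos.le
    have hx1 : 0 ≤ 2 * (2 * 3 ^ P.sbar * (K + R * K)) := by positivity
    have hx2 : 0 ≤ R * c ^ (1 / s₀) := by positivity
    refine ⟨2 * (2 * 3 ^ P.sbar * (K + R * K)) + K + R * c ^ (1 / s₀), by linarith, ?_⟩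
    intro I D h s hs v eb heb heb1 hv he
    have hs' : 0 < s := hs₀.trans_le hs.1
    obtain ⟨i1, i2⟩ := ih I D h s hs v eb heb heb1 hv he
    obtain ⟨u1, u2, -⟩ := h.iter_spec hP heb heb1 hv he j
    have hη := stepTol_pos hP heb j
    have hη1 := h.stepTol_le_half hP heb heb1 j
    obtain ⟨r1, r2, -⟩ := hres I D h s hs _ u1 (u2.trans heb1) _ hη hη1
    have hst := (h.step_spec hP u1 (u2.trans heb1) hη hη1).1
    rw [Data.iter]
    set x := D.iter P v eb j
    set η := stepTol P eb j with hη_def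
    have hX := normA_nonneg (s := s) (toL2 v)
    have hX' := normA_nonneg (s := s) (toL2 x)
    have hT : 0 ≤ (normA s (toL2 v) / eb) ^ (1 / s) := by positivity
    have hn : (0 : ℝ) ≤ nnz v := by positivity
    constructor
    · refine (normA_unitVec_le hs' hst).trans ?_
      rw [toL2_sub]
      have h4 := normA_sub_le hs' (memA_toL2 hs' x) (memA_toL2 hs' (D.res P x η))
      have h5 : (3 : ℝ) ^ s ≤ 3 ^ P.sbar := Real.rpow_le_rpow_of_exponent_le (by norm_num) hs.2
      calc 2 * normA s (toL2 x - toL2 (D.res P x η))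
          ≤ 2 * (2 * 3 ^ s * (K * normA s (toL2 v) + R * (K * normA s (toL2 v)))) := by
            gcongr
            refine h4.trans ?_
            gcongr
            refine r1.trans ?_
            gcongr
        _ ≤ 2 * (2 * 3 ^ P.sbar * (K * normA s (toL2 v) + R * (K * normA s (toL2 v)))) := by
            gcongr
        _ = 2 * (2 * 3 ^ P.sbar * (K + R * K)) * normA s (toL2 v) := by ring
        _ ≤ _ := by gcongr; linarith
    · have h4 : (nnz (unitVec (x - D.res P x η)) : ℝ) ≤ nnz x + nnz (D.res P x η) := by
        exact_mod_cast (nnz_unitVec_le _).trans (nnz_sub_le _ _)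
      have h5 : (normA s (toL2 x) / η) ^ (1 / s)
          ≤ c ^ (1 / s₀) * (normA s (toL2 v) / eb) ^ (1 / s) := by
        refine le_trans ?_ (mul_rpow_one_div_le hs₀ hs.1 (by positivity) hc1)
        refine Real.rpow_le_rpow (by positivity) ?_ (by positivity)
        calc normA s (toL2 x) / η ≤ K * normA s (toL2 v) / η := by gcongr
          _ = K * (2 ^ j / (1 - P.xi)) * (normA s (toL2 v) / eb) := by
              rw [hη_def, stepTol]
              field_simp
          _ ≤ _ := by
              rw [hc]
              gcongr
              linarith
      have h6 : R * (normA s (toL2 x) / η) ^ (1 / s)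
        ≤ R * (c ^ (1 / s₀) * (normA s (toL2 v) / eb) ^ (1 / s)) := by gcongr
      generalize (normA s (toL2 v) / eb) ^ (1 / s) = T at *
      have h7 : 0 ≤ 2 * (2 * 3 ^ P.sbar * (K + R * K)) * (nnz v + T) := by positivity
      have h8 : 0 ≤ R * c ^ (1 / s₀) * (nnz v : ℝ) := by positivity
      rw [add_mul, add_mul]
      linarith

/-- Size of the output and cost of one cycle, in terms of its input. -/
lemma exists_cycle_le {P : Params} (hP : P.Valid) {s₀ : ℝ} (hs₀ : 0 < s₀) :
    ∃ K : ℝ, 1 ≤ K ∧ ∀ (I : Type w) [Nontrivial I] (D : Data I), D.Admissible P →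
      ∀ s ∈ Set.Icc s₀ P.sbar, ∀ (v : I →₀ ℝ) (eb : ℝ), 0 < eb → eb ≤ P.eps0 → ‖toL2 v‖ = 1 →
      ‖D.perp (toL2 v)‖ ≤ eb →
        normA s (toL2 (D.cycle P v eb)) ≤ K * normA s (toL2 v) ∧
        (nnz (D.cycle P v eb) : ℝ) ≤ K * (nnz v + (normA s (toL2 v) / eb) ^ (1 / s)) ∧
        (D.cycleOps P v eb : ℝ) ≤ K * (nnz v + (normA s (toL2 v) / eb) ^ (1 / s) + 1) := by
  choose F hF1 hF using fun j => exists_iter_le.{w} hP hs₀ j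
  obtain ⟨R, hR, hres⟩ := exists_res_le.{w} hP hs₀
  set m := P.maxSteps with hm
  set K : ℝ := ∑ j ∈ range (m + 1), F j with hK
  have hFK : ∀ j, j ≤ m → F j ≤ K := fun j hj =>
    Finset.single_le_sum (f := F) (fun i _ => by linarith [hF1 i])
      (Finset.mem_range.2 (Nat.lt_succ_iff.2 hj))
  have hK1 : 1 ≤ K := (hF1 0).trans (hFK 0 (Nat.zero_le _))
  have hξ : 0 < 1 - P.xi := by linarith [hP.xi_lt_one]
  have hξ1 : 1 ≤ 1 + 2 ^ m / (1 - P.xi) := by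
    have : 0 < 2 ^ m / (1 - P.xi) := by positivity
    linarith
  set c : ℝ := K * (1 + 2 ^ m / (1 - P.xi)) with hc
  have hc1 : 1 ≤ c := one_le_mul_of_one_le_of_one_le hK1 hξ1
  set b : ℝ := c ^ (1 / s₀) with hb
  have hb1 : 1 ≤ b := Real.one_le_rpow hc1 (by positivity)
  set Q : ℝ := R * (K + b + 1) + 6 * (K + R * b) with hQ
  have hQ0 : 0 ≤ Q := by positivity
  refine ⟨2 * K + m * Q + 4 * K, by nlinarith [mul_nonneg (Nat.cast_nonneg (α := ℝ) m) hQ0], ?_⟩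
  intro I _ D h s hs v eb heb heb1 hv he
  have hs' : 0 < s := hs₀.trans_le hs.1
  have hX := normA_nonneg (s := s) (toL2 v)
  have hT : 0 ≤ (normA s (toL2 v) / eb) ^ (1 / s) := by positivity
  have hn : (0 : ℝ) ≤ nnz v := by positivity
  have hit : ∀ j, j ≤ m → normA s (toL2 (D.iter P v eb j)) ≤ K * normA s (toL2 v) ∧
      (nnz (D.iter P v eb j) : ℝ) ≤ K * (nnz v + (normA s (toL2 v) / eb) ^ (1 / s)) := by
    intro j hj
    obtain ⟨h1, h2⟩ := hF j I D h s hs v eb heb heb1 hv he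
    have := hFK j hj
    exact ⟨h1.trans (by gcongr), h2.trans (by gcongr)⟩
  have hlen : D.blockLen P v eb ≤ m := (D.blockLen_mem v eb).2
  obtain ⟨l1, l2⟩ := hit _ hlen
  have htol0 : 0 < 3 * P.c1 * eb / √2 := by
    have := hP.c1_pos
    positivity
  have hmQ : 0 ≤ m * Q := by positivity
  have hcyc := (h.cycle_spec hP heb heb1 hv he).1
  refine ⟨?_, ?_, ?_⟩
  · unfold Data.cycle
    refine (normA_unitVec_le hs' hcyc).trans ?_
    have h1 := normA_le_of_restrict hs' (h.approx_spec.restrict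
      (D.iter P v eb (D.blockLen P v eb)) _ htol0)
    calc _ ≤ 2 * (K * normA s (toL2 v)) := by gcongr; exact h1.trans l1
      _ = 2 * K * normA s (toL2 v) := by ring
      _ ≤ _ := by gcongr; linarith
  · have h1 : (nnz (D.cycle P v eb) : ℝ) ≤ nnz (D.iter P v eb (D.blockLen P v eb)) := by
      exact_mod_cast (nnz_unitVec_le _).trans (h.approx_spec.nnz_le_self _ htol0)
    refine (h1.trans l2).trans ?_
    gcongr
    linarith
  · have hstep : ∀ j ∈ range (D.blockLen P v eb),
        ((D.resOps P (D.iter P v eb j) (stepTol P eb j)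
          + 6 * (nnz (D.iter P v eb j) + nnz (D.res P (D.iter P v eb j) (stepTol P eb j))) : ℕ) : ℝ)
        ≤ Q * (nnz v + (normA s (toL2 v) / eb) ^ (1 / s) + 1) := by
      intro j hj
      have hjm : j ≤ m := (Finset.mem_range.1 hj).le.trans hlen
      obtain ⟨i1, i2⟩ := hit j hjm
      obtain ⟨u1, u2, -⟩ := h.iter_spec hP heb heb1 hv he j
      have hη := stepTol_pos hP heb j
      have hη1 := h.stepTol_le_half hP heb heb1 j
      obtain ⟨-, r2, r3⟩ := hres I D h s hs _ u1 (u2.trans heb1) _ hη hη1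
      set x := D.iter P v eb j
      set η := stepTol P eb j with hη_def
      have hX' := normA_nonneg (s := s) (toL2 x)
      have h5 : (normA s (toL2 x) / η) ^ (1 / s)
          ≤ b * (normA s (toL2 v) / eb) ^ (1 / s) := by
        refine le_trans ?_ (mul_rpow_one_div_le hs₀ hs.1 (by positivity) hc1)
        refine Real.rpow_le_rpow (by positivity) ?_ (by positivity)
        calc normA s (toL2 x) / η ≤ K * normA s (toL2 v) / η := by gcongr
          _ = K * (2 ^ j / (1 - P.xi)) * (normA s (toL2 v) / eb) := by
              rw [hη_def, stepTol]
              field_simp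
          _ ≤ K * (1 + 2 ^ m / (1 - P.xi)) * (normA s (toL2 v) / eb) := by
              have h6 : (2 : ℝ) ^ j / (1 - P.xi) ≤ 2 ^ m / (1 - P.xi) := by
                gcongr
                norm_num
              gcongr
              linarith
      push_cast
      generalize (normA s (toL2 v) / eb) ^ (1 / s) = T at *
      generalize (normA s (toL2 x) / η) ^ (1 / s) = T' at *
      generalize (D.resOps P x η : ℝ) = o at *
      generalize (nnz (D.res P x η) : ℝ) = n₁ at *
      generalize (nnz x : ℝ) = n₂ at *
      generalize (nnz v : ℝ) = n at *
      calc o + 6 * (n₂ + n₁) ≤ R * (K * (n + T) + b * T + 1) + 6 * (K * (n + T) + R * (b * T)) := by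
            gcongr
            · refine r3.trans ?_
              gcongr
            · refine r2.trans ?_
              gcongr
        _ ≤ Q * (n + T + 1) := by
            have e1 : 0 ≤ R * (K + b * n + b + n + T) + 6 * (K + R * b * n + R * b) := by
              positivity
            have e2 : Q * (n + T + 1) = R * (K * (n + T) + b * T + 1)
              + 6 * (K * (n + T) + R * (b * T))
              + (R * (K + b * n + b + n + T) + 6 * (K + R * b * n + R * b)) := by
                rw [hQ]; ring
            linarith
    unfold Data.cycleOps
    rw [Nat.cast_add, Nat.cast_sum]
    have h1 := Finset.sum_le_sum hstep
    rw [Finset.sum_const, Finset.card_range, nsmul_eq_mul] at h1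
    have h2 : (D.blockLen P v eb : ℝ) * (Q * (nnz v + (normA s (toL2 v) / eb) ^ (1 / s) + 1))
        ≤ m * (Q * (nnz v + (normA s (toL2 v) / eb) ^ (1 / s) + 1)) := by
      gcongr
    push_cast at h1 ⊢
    generalize (normA s (toL2 v) / eb) ^ (1 / s) = T at *
    have h3 : 0 ≤ K * ((nnz v : ℝ) + T + 1) := by positivity
    have h4 : (2 * K + m * Q + 4 * K) * ((nnz v : ℝ) + T + 1)
      = 2 * (K * ((nnz v : ℝ) + T + 1)) + m * (Q * ((nnz v : ℝ) + T + 1))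
        + 4 * (K * ((nnz v : ℝ) + T)) + 4 * K := by ring
    rw [h4]
    linarith

lemma one_le_normA {I : Type w} {D : Data I} {P : Params} (h : D.Admissible P) (s : ℝ) :
    1 ≤ normA s D.u := by
  rw [← h.u_norm]; exact norm_le_normA _

/-- Coarsening makes the output of a cycle quasi-optimal with respect to the eigenvector,
irrespective of its input. -/
lemma exists_cycle_le_of_memA {P : Params} (hP : P.Valid) {s₀ : ℝ} (hs₀ : 0 < s₀) :
    ∃ K : ℝ, 1 ≤ K ∧ ∀ (I : Type w) [Nontrivial I] (D : Data I), D.Admissible P →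
      ∀ s ∈ Set.Icc s₀ P.sbar, MemA s D.u → ∀ (v : I →₀ ℝ) (eb : ℝ), 0 < eb → eb ≤ P.eps0 →
      ‖toL2 v‖ = 1 → ‖D.perp (toL2 v)‖ ≤ eb →
        normA s (toL2 (D.cycle P v eb)) ≤ K * normA s D.u ∧
        (nnz (D.cycle P v eb) : ℝ) ≤ K * (normA s D.u / eb) ^ (1 / s) := by
  have hc1 := hP.c1_pos
  set c : ℝ := 3 / P.c1 with hc
  have hc2 : 1 ≤ c := by
    rw [hc, one_le_div hc1]
    linarith [hP.c1_le_tenth]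
  set b : ℝ := c ^ (1 / s₀) with hb
  have hb1 : 1 ≤ b := Real.one_le_rpow hc2 (by positivity)
  set L : ℝ := (2 * b) ^ P.sbar with hL
  have hL1 : 1 ≤ L := Real.one_le_rpow (by linarith) hP.sbar_pos.le
  refine ⟨2 + L + 2 * b, by linarith, ?_⟩
  intro I _ D h s hs hu v eb heb heb1 hv he
  have hs' : 0 < s := hs₀.trans_le hs.1
  obtain ⟨-, k2, k3, σ, hσ, hnear⟩ := h.cycle_spec hP heb heb1 hv he
  have hU := h.one_le_normA s
  have heb2 : eb < 1 := heb1.trans_lt (hP.eps0_lt_one h.gam_le_Gam)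
  have hσu : MemA s (σ • D.u) := memA_smul σ hu
  have hσn : normA s (σ • D.u) ≤ normA s D.u := by
    simpa [hσ] using normA_smul_le σ hu
  have hT1 : 1 ≤ (normA s D.u / eb) ^ (1 / s) := by
    refine Real.one_le_rpow ?_ (by positivity)
    rw [one_le_div heb]
    linarith
  have hN : (nnz (D.cycle P v eb) : ℝ) ≤ 2 * b * (normA s D.u / eb) ^ (1 / s) := by
    have h1 : (nnz (D.cycle P v eb) : ℝ)
        ≤ nnz (D.approx (D.iter P v eb (D.blockLen P v eb)) (3 * P.c1 * eb / √2)) := by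
      exact_mod_cast nnz_unitVec_le _
    have h2 := h.approx_spec.nnz_le_of_near hs' hσu _ (by positivity) hnear
    have h3 : (normA s (σ • D.u) / (P.c1 * eb / 3)) ^ (1 / s)
        ≤ b * (normA s D.u / eb) ^ (1 / s) := by
      refine le_trans ?_ (mul_rpow_one_div_le hs₀ hs.1 (by positivity) hc2)
      have h0 := normA_nonneg (s := s) (σ • D.u)
      refine Real.rpow_le_rpow (by positivity) ?_ (by positivity)
      calc normA s (σ • D.u) / (P.c1 * eb / 3) ≤ normA s D.u / (P.c1 * eb / 3) := by gcongr
        _ = c * (normA s D.u / eb) := by rw [hc]; field_simp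
    have h4 : 1 ≤ b * (normA s D.u / eb) ^ (1 / s) := one_le_mul_of_one_le_of_one_le hb1 hT1
    linarith
  constructor
  · obtain ⟨σ', hσ', hd⟩ := h.exists_sign k2
    have hσu' : MemA s (σ' • D.u) := memA_smul σ' hu
    have hσn' : normA s (σ' • D.u) ≤ normA s D.u := by
      simpa [hσ'] using normA_smul_le σ' hu
    have h1 := normA_toL2_le_of_near hs' (D.cycle P v eb) hσu'
    have h2 : (nnz (D.cycle P v eb) : ℝ) ^ s ≤ L * (normA s D.u / eb) := by
      calc (nnz (D.cycle P v eb) : ℝ) ^ s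
          ≤ (2 * b * (normA s D.u / eb) ^ (1 / s)) ^ s :=
            Real.rpow_le_rpow (by positivity) hN hs'.le
        _ = (2 * b) ^ s * (normA s D.u / eb) := by
            rw [Real.mul_rpow (by positivity) (by positivity), ← Real.rpow_mul (by positivity),
              one_div_mul_cancel hs'.ne', Real.rpow_one]
        _ ≤ _ := by
            gcongr
            exact Real.rpow_le_rpow_of_exponent_le (by linarith) hs.2
    have hs2 : √2 ≤ 2 := Real.sqrt_le_iff.2 ⟨by norm_num, by norm_num⟩
    have h3 : ‖toL2 (D.cycle P v eb) - σ' • D.u‖ ≤ eb := by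
      calc _ ≤ √2 * ‖D.perp (toL2 (D.cycle P v eb))‖ := hd
        _ ≤ 2 * (eb / 2) := by gcongr
        _ = eb := by ring
    have h4 : (nnz (D.cycle P v eb) : ℝ) ^ s * ‖toL2 (D.cycle P v eb) - σ' • D.u‖
        ≤ L * normA s D.u := by
      calc _ ≤ L * (normA s D.u / eb) * eb := by gcongr
        _ = L * normA s D.u := by field_simp
    have h5 := semiA_le_normA (s := s) (σ' • D.u)
    have h6 : 0 ≤ 2 * b * normA s D.u := by positivity
    rw [k2] at h1
    rw [add_mul, add_mul]
    linarith
  · refine hN.trans ?_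
    gcongr
    linarith

/-- Size of the iterates of the eigensolver. -/
lemma exists_ubar_le {P : Params} (hP : P.Valid) {s₀ : ℝ} (hs₀ : 0 < s₀) :
    ∃ K : ℝ, 1 ≤ K ∧ ∀ (I : Type w) [Nontrivial I] (D : Data I), D.Admissible P →
      ∀ s ∈ Set.Icc s₀ P.sbar, MemA s D.u → ∀ k : ℕ,
        normA s (toL2 (D.ubar P k)) ≤ K * normA s D.u ∧
        (nnz (D.ubar P k) : ℝ) ≤ K * (normA s D.u / cycleTol P k) ^ (1 / s) := by
  obtain ⟨K, hK, hcyc⟩ := exists_cycle_le_of_memA.{w} hP hs₀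
  have h0 : (1 : ℝ) ≤ ((P.n0 : ℝ) + 1) ^ P.sbar := by
    refine Real.one_le_rpow ?_ hP.sbar_pos.le
    linarith [Nat.cast_nonneg (α := ℝ) P.n0]
  have hn0 := Nat.cast_nonneg (α := ℝ) P.n0
  refine ⟨K + (1 + ((P.n0 : ℝ) + 1) ^ P.sbar) + P.n0, by linarith, ?_⟩
  intro I _ D h s hs hu k
  have hs' : 0 < s := hs₀.trans_le hs.1
  have hU := h.one_le_normA s
  have hU0 : 0 ≤ normA s D.u := by linarith
  rcases k with _ | k
  · have hnn : (nnz D.x0 : ℝ) ≤ P.n0 := by exact_mod_cast h.x0_nnz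
    constructor
    · have h1 := normA_toL2_le hs' D.x0
      rw [h.x0_norm, mul_one] at h1
      have h2 : (nnz D.x0 : ℝ) ^ s ≤ ((P.n0 : ℝ) + 1) ^ P.sbar := by
        calc (nnz D.x0 : ℝ) ^ s ≤ ((P.n0 : ℝ) + 1) ^ s :=
              Real.rpow_le_rpow (by positivity) (by linarith) hs'.le
          _ ≤ _ := Real.rpow_le_rpow_of_exponent_le (by linarith) hs.2
      calc normA s (toL2 (D.ubar P 0)) ≤ (1 + ((P.n0 : ℝ) + 1) ^ P.sbar) * 1 := by
            rw [mul_one]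
            exact h1.trans (by linarith)
        _ ≤ _ := mul_le_mul (by linarith) hU zero_le_one (by linarith)
    · have h1 : 1 ≤ (normA s D.u / cycleTol P 0) ^ (1 / s) := by
        have h2 := cycleTol_pos hP 0
        refine Real.one_le_rpow ?_ (by positivity)
        rw [one_le_div h2]
        have := cycleTol_le hP 0
        have := hP.eps0_lt_one h.gam_le_Gam
        linarith
      calc (nnz (D.ubar P 0) : ℝ) ≤ P.n0 * 1 := by rw [mul_one]; exact hnn
        _ ≤ _ := by gcongr; linarith
  · obtain ⟨b1, b2⟩ := h.ubar_spec hP k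
    obtain ⟨c1, c2⟩ := hcyc I D h s hs hu (D.ubar P k) (cycleTol P k) (cycleTol_pos hP k)
      (cycleTol_le hP k) b1 b2
    have ht := cycleTol_pos hP k
    refine ⟨c1.trans (by gcongr; linarith), c2.trans ?_⟩
    rw [cycleTol_succ]
    gcongr
    · linarith
    · linarith

end Data.Admissible

/-! ### Regularity of the eigenvector -/

namespace Data.Admissible

lemma exists_nnz_ubar_le_pow {P : Params} (hP : P.Valid) :
    ∃ G : ℝ, 2 ≤ G ∧ ∀ (I : Type w) [Nontrivial I] (D : Data I), D.Admissible P → ∀ k : ℕ,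
      (nnz (D.ubar P k) : ℝ) ≤ G ^ (k + 1) := by
  obtain ⟨K, hK, hcyc⟩ := exists_cycle_le.{w} hP hP.sbar_pos
  have hs := hP.sbar_pos
  have he := hP.eps0_pos
  set X₀ : ℝ := 1 + (P.n0 : ℝ) ^ P.sbar with hX₀
  have hX0 : 0 < X₀ := by positivity
  set B : ℝ := (X₀ / P.eps0) ^ (1 / P.sbar) with hB
  have hB0 : 0 ≤ B := by positivity
  set H : ℝ := (K * 2) ^ (1 / P.sbar) with hH
  have hH0 : 0 ≤ H := by positivity
  have hn0 := Nat.cast_nonneg (α := ℝ) P.n0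
  set G : ℝ := 2 + P.n0 + K * (1 + B) + H with hG
  have hKB : 0 ≤ K * (1 + B) := by positivity
  refine ⟨G, by linarith, ?_⟩
  intro I _ D h
  have hX : ∀ k, normA P.sbar (toL2 (D.ubar P k)) ≤ K ^ k * X₀ := by
    intro k
    induction k with
    | zero =>
      have h1 := normA_toL2_le hs D.x0
      rw [h.x0_norm, mul_one] at h1
      have h2 : (nnz D.x0 : ℝ) ^ P.sbar ≤ (P.n0 : ℝ) ^ P.sbar :=
        Real.rpow_le_rpow (by positivity) (by exact_mod_cast h.x0_nnz) hs.le
      rw [pow_zero, one_mul]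
      exact h1.trans (by linarith)
    | succ k ih =>
      obtain ⟨b1, b2⟩ := h.ubar_spec hP k
      have h1 := (hcyc I D h P.sbar ⟨le_rfl, le_rfl⟩ (D.ubar P k) (cycleTol P k)
        (cycleTol_pos hP k) (cycleTol_le hP k) b1 b2).1
      calc normA P.sbar (toL2 (D.ubar P (k + 1))) ≤ K * (K ^ k * X₀) := h1.trans (by gcongr)
        _ = K ^ (k + 1) * X₀ := by ring
  intro k
  induction k with
  | zero =>
    have h1 : (nnz D.x0 : ℝ) ≤ P.n0 := by exact_mod_cast h.x0_nnz
    simp only [zero_add, pow_one, Data.ubar]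
    linarith
  | succ k ih =>
    obtain ⟨b1, b2⟩ := h.ubar_spec hP k
    have h1 := (hcyc I D h P.sbar ⟨le_rfl, le_rfl⟩ (D.ubar P k) (cycleTol P k)
      (cycleTol_pos hP k) (cycleTol_le hP k) b1 b2).2.1
    have hN := normA_nonneg (s := P.sbar) (toL2 (D.ubar P k))
    have h2 : (normA P.sbar (toL2 (D.ubar P k)) / cycleTol P k) ^ (1 / P.sbar)
        ≤ H ^ k * B := by
      have h3 : normA P.sbar (toL2 (D.ubar P k)) / cycleTol P k
          ≤ (K * 2) ^ k * (X₀ / P.eps0) := by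
        calc _ ≤ K ^ k * X₀ / cycleTol P k := by
              have := cycleTol_pos hP k
              gcongr
              exact hX k
          _ = _ := by
              unfold cycleTol
              rw [mul_pow]
              field_simp
      have ht := cycleTol_pos hP k
      refine (Real.rpow_le_rpow (by positivity) h3 (by positivity)).trans (le_of_eq ?_)
      rw [Real.mul_rpow (by positivity) (by positivity), ← Real.rpow_natCast,
        ← Real.rpow_mul (by positivity), mul_comm (k : ℝ), Real.rpow_mul (by positivity),
        Real.rpow_natCast]
    have hG1 : 1 ≤ G := by linarith
    have h4 : H ^ k ≤ G ^ (k + 1) := by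
      calc H ^ k ≤ G ^ k := by gcongr; linarith
        _ ≤ G ^ (k + 1) := pow_le_pow_right₀ hG1 (Nat.le_succ k)
    calc (nnz (D.ubar P (k + 1)) : ℝ) ≤ K * (G ^ (k + 1) + G ^ (k + 1) * B) := by
          refine h1.trans ?_
          gcongr
          exact h2.trans (by gcongr)
      _ = (K * (1 + B)) * G ^ (k + 1) := by ring
      _ ≤ G * G ^ (k + 1) := by gcongr; linarith
      _ = G ^ (k + 1 + 1) := by ring

/-- The eigenvector has some regularity, which depends only on the parameters: the error of the
eigensolver is halved in each cycle, while the support of the iterates grows at most by a constant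
factor. -/
lemma exists_memA {P : Params} (hP : P.Valid) :
    ∃ s₀ : ℝ, 0 < s₀ ∧ s₀ ≤ P.sbar ∧ ∃ U : ℝ, 1 ≤ U ∧ ∀ (I : Type w) [Nontrivial I] (D : Data I),
      D.Admissible P → MemA s₀ D.u ∧ normA s₀ D.u ≤ U := by
  obtain ⟨G, hG, hnnz⟩ := exists_nnz_ubar_le_pow.{w} hP
  have hG0 : 0 < G := by linarith
  have hlG : 0 < Real.log G := Real.log_pos (by linarith)
  have hl2 : 0 < Real.log 2 := Real.log_pos one_lt_two
  set s₀ : ℝ := min P.sbar (Real.log 2 / Real.log G) with hs₀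
  have hs : 0 < s₀ := lt_min hP.sbar_pos (by positivity)
  have hGs : G ^ s₀ ≤ 2 := by
    calc G ^ s₀ ≤ G ^ (Real.log 2 / Real.log G) :=
          Real.rpow_le_rpow_of_exponent_le (by linarith) (min_le_right _ _)
      _ = 2 := by
          rw [Real.rpow_def_of_pos hG0, mul_div_cancel₀ _ hlG.ne', Real.exp_log two_pos]
  refine ⟨s₀, hs, min_le_left _ _, 9, by norm_num, ?_⟩
  intro I _ D h
  have key : ∀ N : ℕ, (N : ℝ) ^ s₀ * bestErr N D.u ≤ 8 := by
    intro N
    have hu1 : bestErr N D.u ≤ 1 := by rw [← h.u_norm]; exact bestErr_le_norm _ _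
    rcases lt_or_ge (N : ℝ) G with hN | hN
    · calc (N : ℝ) ^ s₀ * bestErr N D.u ≤ 2 * 1 := by
            refine mul_le_mul ?_ hu1 (bestErr_nonneg _ _) two_pos.le
            exact (Real.rpow_le_rpow (by positivity) hN.le hs.le).trans hGs
        _ ≤ 8 := by norm_num
    · -- `k` is the last index for which `ū_k` is known to have at most `N` nonzero entries
      obtain ⟨n, hn1, hn2⟩ := exists_nat_pow_near (show (1 : ℝ) ≤ N by linarith)
        (show (1 : ℝ) < G by linarith)
      obtain ⟨k, rfl⟩ : ∃ k, n = k + 1 := by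
        refine Nat.exists_eq_succ_of_ne_zero ?_
        rintro rfl
        simp at hn2
        linarith
      obtain ⟨b1, b2⟩ := h.ubar_spec hP k
      obtain ⟨σ, hσ, hd⟩ := h.exists_sign b1
      have hσ2 : σ * σ = 1 := by rw [← abs_mul_abs_self, hσ, one_mul]
      have hle : nnz (σ • D.ubar P k) ≤ N := by
        have h1 := (hnnz I D h k).trans hn1
        exact (nnz_smul_le _ _).trans (by exact_mod_cast h1)
      have h1 := bestErr_le D.u _ hle
      have h2 : ‖D.u - toL2 (σ • D.ubar P k)‖ = ‖toL2 (D.ubar P k) - σ • D.u‖ := by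
        have h3 : toL2 (D.ubar P k) - σ • D.u = (-σ) • (D.u - toL2 (σ • D.ubar P k)) := by
          rw [toL2_smul, smul_sub, smul_smul, neg_mul, hσ2]
          simp only [neg_smul, one_smul]
          abel
        rw [h3, norm_smul, Real.norm_eq_abs, abs_neg, hσ, one_mul]
      have hs2 : √2 ≤ 2 := Real.sqrt_le_iff.2 ⟨by norm_num, by norm_num⟩
      have h4 : bestErr N D.u ≤ 2 * (1 / 2 ^ k) := by
        rw [h2] at h1
        refine (h1.trans hd).trans ?_
        have h5 : cycleTol P k ≤ 1 / 2 ^ k := by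
          unfold cycleTol
          gcongr
          exact (hP.eps0_lt_one h.gam_le_Gam).le
        have := b2.trans h5
        gcongr
      have h5 : (N : ℝ) ^ s₀ ≤ 2 ^ (k + 2) := by
        calc (N : ℝ) ^ s₀ ≤ (G ^ (k + 2)) ^ s₀ :=
              Real.rpow_le_rpow (by positivity) hn2.le hs.le
          _ = (G ^ s₀) ^ (k + 2) := by
              rw [← Real.rpow_natCast, ← Real.rpow_natCast, ← Real.rpow_mul hG0.le,
                ← Real.rpow_mul hG0.le, mul_comm]
          _ ≤ 2 ^ (k + 2) := by gcongr
      calc (N : ℝ) ^ s₀ * bestErr N D.u ≤ 2 ^ (k + 2) * (2 * (1 / 2 ^ k)) :=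
            mul_le_mul h5 h4 (bestErr_nonneg _ _) (by positivity)
        _ = 8 := by rw [pow_add]; field_simp; norm_num
  refine ⟨memA_of_le key, ?_⟩
  have h1 : semiA s₀ D.u ≤ 8 := ciSup_le key
  unfold normA
  rw [h.u_norm]
  linarith

/-! ### Total cost of the eigensolver -/

/-- A logarithm is dominated by the small power that separates the two exponents of the cost. -/
lemma _root_.log_le_mul_rpow {s sb t : ℝ} (hs : 0 < s) (hsb : s ≤ sb) (ht : 0 ≤ t) :
    Real.log t ≤ 2 * sb * t ^ (1 / (s + sb)) := by
  have h1 := Real.log_le_rpow_div ht (show 0 < 1 / (s + sb) by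
    have := hs.trans_le hsb
    positivity)
  refine h1.trans ?_
  rw [div_div_eq_mul_div, div_one, mul_comm]
  gcongr
  linarith

/-- Cost of the eigensolver, and the size of its output. -/
lemma exists_eigOps_le {P : Params} (hP : P.Valid) {s₀ : ℝ} (hs₀ : 0 < s₀) :
    ∃ K : ℝ, 1 ≤ K ∧ ∀ (I : Type w) [Nontrivial I] (D : Data I), D.Admissible P →
      ∀ s ∈ Set.Icc s₀ P.sbar, MemA s D.u → ∀ ε : ℝ, 0 < ε → ε ≤ 1 →
        normA s (toL2 (D.uEps P ε)) ≤ K * normA s D.u ∧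
        (nnz (D.uEps P ε) : ℝ) ≤ K * (normA s D.u / ε) ^ (1 / s) ∧
        (D.eigOps P ε : ℝ) ≤ K * (normA s D.u / ε) ^ (1 / s + 1 / (s + P.sbar)) := by
  obtain ⟨K₁, hK₁, hub⟩ := exists_ubar_le.{w} hP hs₀
  obtain ⟨K₂, hK₂, hcyc⟩ := exists_cycle_le.{w} hP hs₀
  obtain ⟨K₃, hK₃, hray⟩ := exists_raylSimpleOps_le.{w} hP hs₀ one_pos
  have he := hP.eps0_pos
  have hsb := hP.sbar_pos
  set c : ℝ := 1 + 2 / P.eps0 with hc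
  have hc1 : 1 ≤ c := by
    have : 0 < 2 / P.eps0 := by positivity
    linarith
  set b : ℝ := c ^ (1 / s₀) with hb
  have hb1 : 1 ≤ b := Real.one_le_rpow hc1 (by positivity)
  set a : ℝ := K₁ ^ (1 / s₀) with ha
  have ha1 : 1 ≤ a := Real.one_le_rpow hK₁ (by positivity)
  have hl2 : 0 < Real.log 2 := Real.log_pos one_lt_two
  set Z : ℝ := K₂ * (K₁ * b + a * b + 1) with hZ
  have hZ0 : 0 ≤ Z := by positivity
  set W : ℝ := 2 * P.sbar / Real.log 2 + 1 with hW
  have hW0 : 0 ≤ W := by positivity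
  set Y : ℝ := K₃ * (K₁ * b + a + 1) with hY
  have hY0 : 0 ≤ Y := by positivity
  refine ⟨K₁ * b + W * Z + Y, ?_, ?_⟩
  · have h1 : 1 ≤ K₁ * b := one_le_mul_of_one_le_of_one_le hK₁ hb1
    have : 0 ≤ W * Z := by positivity
    linarith
  intro I _ D h s hs hu ε hε hε1
  have hs' : 0 < s := hs₀.trans_le hs.1
  have hU := h.one_le_normA s
  set U := normA s D.u with hU_def
  have hUε : 1 ≤ U / ε := by rw [one_le_div hε]; linarith
  have hT1 : 1 ≤ (U / ε) ^ (1 / s) := Real.one_le_rpow hUε (by positivity)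
  have hq1 : 1 ≤ (U / ε) ^ (1 / (s + P.sbar)) := Real.one_le_rpow hUε (by positivity)
  have hTq : (U / ε) ^ (1 / s + 1 / (s + P.sbar))
      = (U / ε) ^ (1 / s) * (U / ε) ^ (1 / (s + P.sbar)) := Real.rpow_add (by positivity) _ _
  have hWZ : 0 ≤ W * Z := by positivity
  have hKb : 0 ≤ K₁ * b := by positivity
  have hlast : ∀ k, k ≤ lastCycle P ε → P.eps0 * ε ≤ cycleTol P k := fun k hk =>
    le_cycleTol hP h.gam_le_Gam hε1 hk hε
  have hpow : ∀ k, k ≤ lastCycle P ε + 1 → (U / cycleTol P k) ^ (1 / s)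
      ≤ b * (U / ε) ^ (1 / s) := by
    intro k hk
    have h1 : P.eps0 * ε ≤ 2 * cycleTol P k := by
      rcases Nat.lt_or_ge (lastCycle P ε) k with h2 | h2
      · obtain rfl : k = lastCycle P ε + 1 := le_antisymm hk h2
        have h3 := hlast _ le_rfl
        rw [cycleTol_succ]
        linarith
      · have h3 := hlast k h2
        have h4 := cycleTol_pos hP k
        linarith
    refine div_rpow_one_div_le hs₀ hs.1 (by linarith) hε (cycleTol_pos hP k) hc1 ?_
    calc ε = 1 / P.eps0 * (P.eps0 * ε) := by field_simp
      _ ≤ 1 / P.eps0 * (2 * cycleTol P k) := by gcongr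
      _ = 2 / P.eps0 * cycleTol P k := by ring
      _ ≤ _ := by
          have := cycleTol_pos hP k
          gcongr
          linarith
  obtain ⟨e1, e2⟩ := hub I D h s hs hu (lastCycle P ε + 1)
  have e3 := hpow _ le_rfl
  have hN : (nnz (D.uEps P ε) : ℝ) ≤ K₁ * b * (U / ε) ^ (1 / s) := by
    refine e2.trans ?_
    rw [mul_assoc]
    gcongr
  refine ⟨?_, ?_, ?_⟩
  · refine e1.trans ?_
    have : K₁ ≤ K₁ * b := le_mul_of_one_le_right (by linarith) hb1
    gcongr
    linarith
  · refine hN.trans ?_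
    gcongr
    linarith
  · -- one cycle
    have hone : ∀ k ∈ range (lastCycle P ε + 1),
        (D.cycleOps P (D.ubar P k) (cycleTol P k) : ℝ) ≤ Z * (U / ε) ^ (1 / s) := by
      intro k hk
      have hk' : k ≤ lastCycle P ε := Nat.lt_succ_iff.1 (Finset.mem_range.1 hk)
      obtain ⟨b1, b2⟩ := h.ubar_spec hP k
      obtain ⟨x1, x2⟩ := hub I D h s hs hu k
      have x3 := (hcyc I D h s hs (D.ubar P k) (cycleTol P k) (cycleTol_pos hP k)
        (cycleTol_le hP k) b1 b2).2.2
      have x4 := hpow k (by omega)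
      have ht := cycleTol_pos hP k
      have x5 : (normA s (toL2 (D.ubar P k)) / cycleTol P k) ^ (1 / s)
          ≤ a * (b * (U / ε) ^ (1 / s)) := by
        have h0 := normA_nonneg (s := s) (toL2 (D.ubar P k))
        calc _ ≤ (K₁ * (U / cycleTol P k)) ^ (1 / s) := by
              refine Real.rpow_le_rpow (by positivity) ?_ (by positivity)
              rw [← mul_div_assoc]
              gcongr
          _ ≤ a * (U / cycleTol P k) ^ (1 / s) :=
              mul_rpow_one_div_le hs₀ hs.1 (by positivity) hK₁
          _ ≤ _ := by gcongr
      calc _ ≤ K₂ * (K₁ * (b * (U / ε) ^ (1 / s)) + a * (b * (U / ε) ^ (1 / s))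
            + (U / ε) ^ (1 / s)) := by
            refine x3.trans ?_
            gcongr
            exact x2.trans (by gcongr)
        _ = Z * (U / ε) ^ (1 / s) := by rw [hZ]; ring
    -- the number of cycles is logarithmic
    have hnum : ((lastCycle P ε + 1 : ℕ) : ℝ) ≤ W * (U / ε) ^ (1 / (s + P.sbar)) := by
      have h1 := hlast _ le_rfl
      have h2 : (2 : ℝ) ^ lastCycle P ε ≤ U / ε := by
        rw [cycleTol, le_div_iff₀ (by positivity)] at h1
        have h3 : ε * 2 ^ lastCycle P ε ≤ 1 := by
          refine le_of_mul_le_mul_left ?_ he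
          linarith
        rw [le_div_iff₀ hε]
        linarith
      have h3 := Real.log_le_log (by positivity) h2
      rw [Real.log_pow] at h3
      have h4 := h3.trans (log_le_mul_rpow hs' hs.2 (by positivity : 0 ≤ U / ε))
      rw [← le_div_iff₀ hl2] at h4
      have h5 : 2 * P.sbar * (U / ε) ^ (1 / (s + P.sbar)) / Real.log 2
        = 2 * P.sbar / Real.log 2 * (U / ε) ^ (1 / (s + P.sbar)) := by ring
      rw [h5] at h4
      push_cast
      rw [hW, add_mul]
      linarith
    have hsum := Finset.sum_le_sum hone
    rw [Finset.sum_const, Finset.card_range, nsmul_eq_mul] at hsum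
    have hfin : (D.raylSimpleOps P (D.uEps P ε) ε : ℝ) ≤ Y * (U / ε) ^ (1 / s) := by
      have x3 := hray I D h s hs (D.uEps P ε) ε hε hε1
      have x5 : (normA s (toL2 (D.uEps P ε)) / ε) ^ (1 / s) ≤ a * (U / ε) ^ (1 / s) := by
        have h0 := normA_nonneg (s := s) (toL2 (D.uEps P ε))
        refine le_trans ?_ (mul_rpow_one_div_le hs₀ hs.1 (by positivity) hK₁)
        refine Real.rpow_le_rpow (by positivity) ?_ (by positivity)
        rw [← mul_div_assoc]
        gcongr
        exact e1
      calc _ ≤ K₃ * (K₁ * b * (U / ε) ^ (1 / s) + a * (U / ε) ^ (1 / s) + (U / ε) ^ (1 / s)) := by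
            refine x3.trans ?_
            gcongr
        _ = Y * (U / ε) ^ (1 / s) := by rw [hY]; ring
    unfold Data.eigOps
    push_cast at hsum hnum ⊢
    rw [hTq]
    generalize (U / ε) ^ (1 / s) = T at *
    generalize (U / ε) ^ (1 / (s + P.sbar)) = q at *
    have hT0 : 0 ≤ T := by linarith
    have f1 : ((lastCycle P ε : ℝ) + 1) * (Z * T) ≤ W * q * (Z * T) := by gcongr
    have f2 : Y * T ≤ Y * (T * q) := by
      gcongr
      exact le_mul_of_one_le_right hT0 hq1
    have f3 : 0 ≤ K₁ * b * (T * q) := by positivity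
    have f4 : (K₁ * b + W * Z + Y) * (T * q)
        = K₁ * b * (T * q) + W * q * (Z * T) + Y * (T * q) := by ring
    rw [f4]
    linarith

end Data.Admissible

/-! ### Cost of the improved scalar product -/

/-- The increasing terms `2^j` and the decreasing terms `Q² / 2^j` meet at `2^j ≈ Q`. -/
lemma sum_min_two_pow_le {Q : ℝ} (hQ : 0 ≤ Q) (n : ℕ) :
    ∑ j ∈ range n, min ((2 : ℝ) ^ j) (Q ^ 2 / 2 ^ j) ≤ 4 * Q := by
  have h1 : ∀ n : ℕ, ∑ j ∈ range n, min ((2 : ℝ) ^ j) (Q ^ 2 / 2 ^ j) ≤ 2 ^ n := by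
    intro n
    induction n with
    | zero => simp
    | succ n ih =>
      rw [Finset.sum_range_succ, pow_succ (2 : ℝ) n]
      have := min_le_left ((2 : ℝ) ^ n) (Q ^ 2 / 2 ^ n)
      linarith
  have h2 : ∀ n : ℕ, Q ≤ 2 ^ n →
      ∑ j ∈ range n, min ((2 : ℝ) ^ j) (Q ^ 2 / 2 ^ j) ≤ 4 * Q - 2 * (Q ^ 2 / 2 ^ n) := by
    intro n
    induction n with
    | zero =>
      intro h
      simp only [range_zero, sum_empty, pow_zero, div_one] at h ⊢
      nlinarith
    | succ n ih =>
      intro h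
      have hp : (0 : ℝ) < 2 ^ n := by positivity
      have e : 2 * (Q ^ 2 / 2 ^ (n + 1)) = Q ^ 2 / 2 ^ n := by
        rw [pow_succ (2 : ℝ) n]; field_simp
      rcases le_or_gt Q (2 ^ n) with h3 | h3
      · rw [Finset.sum_range_succ, e]
        have := min_le_right ((2 : ℝ) ^ n) (Q ^ 2 / 2 ^ n)
        linarith [ih h3]
      · have h4 := h1 (n + 1)
        have h5 : Q ^ 2 / 2 ^ n ≤ 2 * Q := by
          rw [div_le_iff₀ hp]
          rw [pow_succ (2 : ℝ) n] at h
          nlinarith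
        rw [e]
        rw [pow_succ (2 : ℝ) n] at h4
        linarith
  rcases le_or_gt Q (2 ^ n) with h3 | h3
  · have h4 : 0 ≤ Q ^ 2 / 2 ^ n := by positivity
    linarith [h2 n h3]
  · linarith [h1 n]

section ImprovedScalCost

variable {I : Type w} {approx : (I →₀ ℝ) → ℝ → (I →₀ ℝ)} {s sb : ℝ}

lemma levels_le {v : I →₀ ℝ} {ζ y : ℝ} (hy : 0 ≤ y) (h : Real.logb 2 (‖toL2 v‖ / ζ) / sb ≤ y) :
    (levels sb v ζ : ℝ) ≤ y + 1 := by
  have h1 : (levels sb v ζ : ℝ) ≤ (⌈y⌉₊ : ℝ) := by exact_mod_cast Nat.ceil_le_ceil h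
  exact h1.trans (Nat.ceil_lt_add_one hy).le

lemma half_le_log_two : 1 / 2 ≤ Real.log 2 := by linarith [Real.log_two_gt_d9]

lemma logb_two_le {x z : ℝ} (hz : 0 ≤ z) (h : Real.log x ≤ z) : Real.logb 2 x ≤ 2 * z := by
  have h2 := half_le_log_two
  rw [Real.logb, div_le_iff₀ (by linarith)]
  nlinarith

/-- The number of levels is logarithmic. -/
lemma levels_le_rpow (hs : 0 < s) (hsb : s ≤ sb) {v : I →₀ ℝ} (hv : ‖toL2 v‖ = 1) {ζ : ℝ}
    (hζ : 0 < ζ) :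
    (levels sb v ζ : ℝ) ≤ 4 * (normA s (toL2 v) / ζ) ^ (1 / (s + sb)) + 1 := by
  have hsb0 : 0 < sb := hs.trans_le hsb
  have hV : 1 ≤ normA s (toL2 v) := by rw [← hv]; exact norm_le_normA _
  set V := normA s (toL2 v)
  refine levels_le (by positivity) ?_
  rw [div_le_iff₀ hsb0, hv]
  have h1 : Real.log (1 / ζ) ≤ 2 * sb * (V / ζ) ^ (1 / (s + sb)) := by
    refine (Real.log_le_log (by positivity) (by gcongr)).trans
      (log_le_mul_rpow hs hsb (by positivity))
  have h2 := logb_two_le (by positivity) h1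
  linarith

/-- The square of the number of levels is dominated by a small power, too. -/
lemma levels_add_two_sq_le (hs : 0 < s) (hsb : s ≤ sb) {v : I →₀ ℝ} (hv : ‖toL2 v‖ = 1) {ζ : ℝ}
    (hζ : 0 < ζ) :
    ((levels sb v ζ : ℝ) + 2) ^ 2 ≤ 128 * (1 + (normA s (toL2 v) / ζ) ^ (1 / (s + sb))) := by
  have hsb0 : 0 < sb := hs.trans_le hsb
  have hV : 1 ≤ normA s (toL2 v) := by rw [← hv]; exact norm_le_normA _
  set V := normA s (toL2 v)
  set R : ℝ := (V / ζ) ^ (1 / (s + sb) / 2) with hR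
  have hR0 : 0 ≤ R := by positivity
  have hR2 : (V / ζ) ^ (1 / (s + sb)) = R ^ 2 := by
    rw [hR, ← Real.rpow_natCast, ← Real.rpow_mul (by positivity)]
    norm_num
  have h0 : (levels sb v ζ : ℝ) ≤ 8 * R + 1 := by
    refine levels_le (by positivity) ?_
    rw [div_le_iff₀ hsb0, hv]
    have h1 : Real.log (1 / ζ) ≤ 4 * sb * R := by
      refine (Real.log_le_log (by positivity) (show 1 / ζ ≤ V / ζ by gcongr)).trans ?_
      refine (Real.log_le_rpow_div (by positivity)
        (show 0 < 1 / (s + sb) / 2 by positivity)).trans ?_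
      have e : R / (1 / (s + sb) / 2) = 2 * (s + sb) * R := by field_simp
      rw [← hR, e]
      have := mul_le_mul_of_nonneg_right hsb hR0
      linarith
    have h2 := logb_two_le (by positivity) h1
    linarith
  rw [hR2]
  have h3 : ((levels sb v ζ : ℝ) + 2) ^ 2 ≤ (8 * R + 3) ^ 2 :=
    pow_le_pow_left₀ (by positivity) (by linarith) 2
  nlinarith [sq_nonneg (R - 1)]

lemma nnz_piece_zero_le (ha : IsApprox approx) (v : I →₀ ℝ) {ζ : ℝ} (hζ : 0 < ζ) :
    nnz (piece approx sb v ζ 0) ≤ nnz v := by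
  rw [piece]
  refine nnz_le_of_restrict fun i => ?_
  rw [Finsupp.sub_apply]
  rcases ha.restrict v ζ hζ i with h | h
  · exact Or.inr (by rw [h, sub_self])
  · exact Or.inl (by rw [h, sub_zero])

lemma nnz_piece_succ_le (ha : IsApprox approx) (hs : 0 < s) (hsb : 0 < sb) (v : I →₀ ℝ) {ζ : ℝ}
    (hζ : 0 < ζ) (j : ℕ) :
    (nnz (piece approx sb v ζ (j + 1)) : ℝ)
      ≤ 4 * ((normA s (toL2 v) / ζ) ^ (1 / s) * (2 : ℝ) ^ (-((j : ℝ) * sb / s))) := by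
  have hV := normA_nonneg (s := s) (toL2 v)
  have h0 : 0 < (2 : ℝ) ^ ((j : ℝ) * sb) * ζ := by positivity
  have h1 : nnz (approx v ((2 : ℝ) ^ (((j : ℝ) + 1) * sb) * ζ))
      ≤ nnz (approx v ((2 : ℝ) ^ ((j : ℝ) * sb) * ζ)) := by
    refine ha.nnz_anti v h0 ?_
    gcongr
    · norm_num
    · linarith
  have h2 : (nnz (piece approx sb v ζ (j + 1)) : ℝ)
      ≤ 2 * nnz (approx v ((2 : ℝ) ^ ((j : ℝ) * sb) * ζ)) := by
    rw [piece]
    have := (nnz_sub_le (approx v ((2 : ℝ) ^ ((j : ℝ) * sb) * ζ))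
      (approx v ((2 : ℝ) ^ (((j : ℝ) + 1) * sb) * ζ))).trans (add_le_add le_rfl h1)
    rw [← two_mul] at this
    exact_mod_cast this
  have h3 := ha.nnz_le hs v h0
  have h4 : (normA s (toL2 v) / ((2 : ℝ) ^ ((j : ℝ) * sb) * ζ)) ^ (1 / s)
      = (normA s (toL2 v) / ζ) ^ (1 / s) * (2 : ℝ) ^ (-((j : ℝ) * sb / s)) := by
    have h5 : normA s (toL2 v) / ((2 : ℝ) ^ ((j : ℝ) * sb) * ζ)
        = normA s (toL2 v) / ζ * (2 : ℝ) ^ (-((j : ℝ) * sb)) := by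
      rw [Real.rpow_neg two_pos.le]
      field_simp
    rw [h5, Real.mul_rpow (by positivity) (by positivity), ← Real.rpow_mul two_pos.le]
    congr 2
    ring
  rw [h4] at h3
  linarith

/-- The cost of one entry of the approximation to `B v`. -/
lemma applyEntryOps_le (ha : IsApprox approx) (hs : 0 < s) (hsb : s ≤ sb) {v : I →₀ ℝ}
    (hv : ‖toL2 v‖ = 1) {ζ : ℝ} (hζ : 0 < ζ) :
    (applyEntryOps approx sb v ζ : ℝ)
      ≤ 36 * (1 + (normA s (toL2 v) / ζ) ^ (1 / (s + sb))) := by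
  have hsb0 : 0 < sb := hs.trans_le hsb
  have hV : 1 ≤ normA s (toL2 v) := by rw [← hv]; exact norm_le_normA _
  have hJ := levels_le_rpow hs hsb hv hζ
  have hpiece := fun j => nnz_piece_succ_le ha hs hsb0 v hζ j
  set V := normA s (toL2 v)
  have ht : 0 < V / ζ := by positivity
  set Q : ℝ := (V / ζ) ^ (1 / (s + sb)) with hQ
  have hQ0 : 0 < Q := by positivity
  have hQs : (V / ζ) ^ (1 / s) = Q * Q ^ (sb / s) := by
    have e : Q * Q ^ (sb / s) = Q ^ (1 + sb / s) := by rw [Real.rpow_add hQ0, Real.rpow_one]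
    rw [e, hQ, ← Real.rpow_mul ht.le]
    congr 1
    field_simp
  have hterm : ∀ j : ℕ, min ((2 : ℝ) ^ j) (nnz (piece approx sb v ζ (j + 1)))
      ≤ 4 * min ((2 : ℝ) ^ j) (Q ^ 2 / 2 ^ j) := by
    intro j
    have hp : (0 : ℝ) < 2 ^ j := by positivity
    rcases le_or_gt ((2 : ℝ) ^ j) Q with h1 | h1
    · have h2 : (2 : ℝ) ^ j ≤ Q ^ 2 / 2 ^ j := by
        rw [le_div_iff₀ hp]; nlinarith
      rw [min_eq_left h2]
      exact (min_le_left _ _).trans (by linarith)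
    · have h2 : Q ^ 2 / 2 ^ j ≤ 2 ^ j := by
        rw [div_le_iff₀ hp]; nlinarith
      rw [min_eq_right h2]
      refine (min_le_right _ _).trans ((hpiece j).trans ?_)
      have h3 : (2 : ℝ) ^ (-((j : ℝ) * sb / s)) = (((2 : ℝ) ^ j)⁻¹) ^ (sb / s) := by
        rw [← Real.rpow_natCast, ← Real.rpow_neg two_pos.le, ← Real.rpow_mul two_pos.le]
        congr 1
        ring
      have h4 : (Q * ((2 : ℝ) ^ j)⁻¹) ^ (sb / s) ≤ Q * ((2 : ℝ) ^ j)⁻¹ := by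
        refine Real.rpow_le_self_of_le_one (by positivity) ?_ ?_
        · rw [mul_inv_le_iff₀ hp, one_mul]; exact h1.le
        · rwa [one_le_div hs]
      rw [hQs, h3, mul_assoc Q, ← Real.mul_rpow hQ0.le (by positivity)]
      calc 4 * (Q * (Q * ((2 : ℝ) ^ j)⁻¹) ^ (sb / s)) ≤ 4 * (Q * (Q * ((2 : ℝ) ^ j)⁻¹)) := by
            gcongr
        _ = 4 * (Q ^ 2 / 2 ^ j) := by rw [div_eq_mul_inv]; ring
  unfold applyEntryOps
  push_cast
  rw [Finset.sum_add_distrib, Finset.sum_const, Finset.card_range, ← Finset.mul_sum]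
  have h5 : ∑ j ∈ range (levels sb v ζ + 1),
      min ((2 : ℝ) ^ j) (nnz (piece approx sb v ζ (j + 1))) ≤ 4 * (4 * Q) := by
    refine (Finset.sum_le_sum fun j _ => hterm j).trans ?_
    rw [← Finset.mul_sum]
    gcongr
    exact sum_min_two_pow_le hQ0.le _
  simp only [nsmul_eq_mul, mul_one]
  push_cast
  linarith

/-- A lower bound for the tolerances of the improved scalar product. The algebraic decay of the
weights costs only a polynomial factor. -/
lemma exists_inv_scalTol_le (Q : CompressConst) (hsb : 0 < sb) (b₀ : ℝ) :
    ∃ E : ℝ, 1 ≤ E ∧ ∃ m : ℕ, ∀ (I : Type w) (B : L2 I →L[ℝ] L2 I), 0 < ‖B‖ → ‖B‖ ≤ b₀ →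
      0 ≤ Q.cst → ∀ (δ : ℝ), 0 < δ → ∀ l : ℕ,
        (scalTol sb Q δ l / applyConst sb B Q)⁻¹
          ≤ E * ((l : ℝ) + 1) ^ m * (2 : ℝ) ^ ((l : ℝ) * sb) * (√δ)⁻¹ := by
  obtain ⟨c, hc, q, hq⟩ := Q.wt_algebraic
  set A : ℝ := |b₀| + (1 + (2 : ℝ) ^ sb) * |Q.cst| with hA
  have hA0 : 0 ≤ A := by positivity
  refine ⟨1 + A * (1 + (2 : ℝ) ^ sb) / c, ?_, ⌈q⌉₊, ?_⟩
  · have : 0 ≤ A * (1 + (2 : ℝ) ^ sb) / c := by positivity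
    linarith
  intro I B hB hB0 hcst δ hδ l
  have hd : 0 < √δ := Real.sqrt_pos.2 hδ
  have hAC : applyConst sb B Q ≤ A := by
    rw [applyConst, hA, abs_of_nonneg hcst, abs_of_nonneg (hB.le.trans hB0)]
    gcongr
  have hw := Q.wt_pos l
  have hwl : (Q.wt l)⁻¹ ≤ c⁻¹ * ((l : ℝ) + 1) ^ ⌈q⌉₊ := by
    have h1 := hq l
    have h2 : 0 < c * ((l : ℝ) + 1) ^ (-q) := by positivity
    calc (Q.wt l)⁻¹ ≤ (c * ((l : ℝ) + 1) ^ (-q))⁻¹ := inv_anti₀ h2 h1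
      _ = c⁻¹ * ((l : ℝ) + 1) ^ q := by
          rw [mul_inv, Real.rpow_neg (by positivity), inv_inv]
      _ ≤ _ := by
          gcongr
          rw [← Real.rpow_natCast]
          exact Real.rpow_le_rpow_of_exponent_le (by linarith [Nat.cast_nonneg (α := ℝ) l])
            (Nat.le_ceil q)
  have hS : (0 : ℝ) < 1 + 2 ^ sb := by positivity
  have htol : (scalTol sb Q δ l)⁻¹
      ≤ (1 + (2 : ℝ) ^ sb) * (Q.wt l)⁻¹ * (2 : ℝ) ^ ((l : ℝ) * sb) * (√δ)⁻¹ := by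
    cases l with
    | zero =>
      rw [scalTol, mul_inv]
      simp only [Nat.cast_zero, zero_mul, Real.rpow_zero, mul_one]
      gcongr
      refine le_mul_of_one_le_left (by positivity) ?_
      have : (0 : ℝ) ≤ 2 ^ sb := by positivity
      linarith
    | succ j =>
      have h1 : sb * (j : ℝ) ≤ ((j + 1 : ℕ) : ℝ) * sb := by push_cast; nlinarith
      have h2 : (2 : ℝ) ^ (sb * (j : ℝ)) ≤ 2 ^ (((j + 1 : ℕ) : ℝ) * sb) :=
        Real.rpow_le_rpow_of_exponent_le one_le_two h1
      rw [scalTol, mul_inv, mul_inv, mul_inv, inv_inv, Real.rpow_neg two_pos.le, inv_inv,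
        mul_comm (Q.wt (j + 1))⁻¹]
      gcongr
  rw [inv_div, div_eq_mul_inv]
  have hi : 0 < scalTol sb Q δ l := scalTol_pos Q hδ l
  calc applyConst sb B Q * (scalTol sb Q δ l)⁻¹
      ≤ A * ((1 + (2 : ℝ) ^ sb) * (c⁻¹ * ((l : ℝ) + 1) ^ ⌈q⌉₊) * (2 : ℝ) ^ ((l : ℝ) * sb)
          * (√δ)⁻¹) := by
        refine mul_le_mul hAC (htol.trans ?_) (by positivity) hA0
        gcongr
    _ = A * (1 + (2 : ℝ) ^ sb) / c * ((l : ℝ) + 1) ^ ⌈q⌉₊ * (2 : ℝ) ^ ((l : ℝ) * sb)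
          * (√δ)⁻¹ := by ring
    _ ≤ _ := by gcongr; linarith

end ImprovedScalCost

lemma summable_add_one_pow_mul_geometric (m : ℕ) {r : ℝ} (hr0 : 0 < r) (hr1 : r < 1) :
    Summable fun l : ℕ => ((l : ℝ) + 1) ^ m * r ^ l := by
  have h1 := summable_pow_mul_geometric_of_norm_lt_one m
    (r := r) (by rwa [Real.norm_eq_abs, abs_of_pos hr0])
  have h2 := ((summable_nat_add_iff 1).2 h1).mul_left r⁻¹
  refine h2.congr fun l => ?_
  push_cast
  rw [pow_succ r l]
  field_simp

/-- The balance of the two factors in the cost of the improved scalar product: the decay of the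
support sizes of the pieces, `2^{-l s̄/s}`, outweighs the growth of the cost per entry,
`2^{l s̄/(s+s̄)}`. -/
lemma two_rpow_mul_two_rpow_le {s sb : ℝ} (hs : 0 < s) (hsb : s ≤ sb) (l : ℕ) :
    (2 : ℝ) ^ (-((l : ℝ) * sb / s)) * (2 : ℝ) ^ ((l : ℝ) * sb * (1 / (s + sb)))
      ≤ ((2 : ℝ) ^ (-(1 / 2) : ℝ)) ^ l := by
  have hsb0 : 0 < sb := hs.trans_le hsb
  rw [← Real.rpow_add two_pos, ← Real.rpow_natCast, ← Real.rpow_mul two_pos.le]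
  refine Real.rpow_le_rpow_of_exponent_le one_le_two ?_
  have h1 : sb * (1 / (s + sb)) - sb / s ≤ -(1 / 2) := by
    rw [mul_one_div, div_sub_div _ _ (by positivity) hs.ne', div_le_iff₀ (by positivity)]
    nlinarith
  calc -((l : ℝ) * sb / s) + (l : ℝ) * sb * (1 / (s + sb))
      = l * (sb * (1 / (s + sb)) - sb / s) := by ring
    _ ≤ l * -(1 / 2) := by gcongr
    _ = _ := by ring

/-- The number of levels for the tolerances of the improved scalar product. -/
lemma levels_scalTol_le {I : Type w} {sb E ζ h : ℝ} {m l : ℕ} (hsb : 0 < sb) (hE : 1 ≤ E)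
    (hζ : 0 < ζ) (hh : 0 < h) {v : I →₀ ℝ} (hv : ‖toL2 v‖ = 1) (hl : l ≤ levels sb v h + 1)
    (hle : ζ⁻¹ ≤ E * ((l : ℝ) + 1) ^ m * (2 : ℝ) ^ ((l : ℝ) * sb) * h⁻¹) :
    (levels sb v ζ : ℝ) + 2
      ≤ (Real.logb 2 E / sb + m / sb + 3) * ((levels sb v h : ℝ) + 2) := by
  set J := levels sb v h with hJ
  have hJ1 : Real.logb 2 h⁻¹ ≤ J * sb := by
    rw [← div_le_iff₀ hsb]
    have : Real.logb 2 (‖toL2 v‖ / h) / sb ≤ J := Nat.le_ceil _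
    rwa [hv, one_div] at this
  have he : 0 ≤ Real.logb 2 E := Real.logb_nonneg one_lt_two hE
  have hl1 : Real.logb 2 ((l : ℝ) + 1) ≤ l := by
    rw [Real.logb_le_iff_le_rpow one_lt_two (by positivity), Real.rpow_natCast]
    exact_mod_cast Nat.lt_two_pow_self (n := l)
  have h1 : Real.logb 2 ζ⁻¹ ≤ Real.logb 2 E + m * l + l * sb + J * sb := by
    refine (Real.logb_le_logb_of_le one_lt_two (by positivity) hle).trans ?_
    rw [Real.logb_mul (by positivity) (by positivity), Real.logb_mul (by positivity)
      (by positivity), Real.logb_mul (by positivity) (by positivity), Real.logb_pow,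
      Real.logb_rpow two_pos (by norm_num)]
    gcongr
  have h2 : (levels sb v ζ : ℝ) ≤ (Real.logb 2 E / sb + m / sb * l + l + J) + 1 := by
    refine levels_le (by positivity) ?_
    rw [hv, one_div, div_le_iff₀ hsb]
    refine h1.trans (le_of_eq ?_)
    field_simp
  have hl' : (l : ℝ) ≤ J + 1 := by exact_mod_cast hl
  have hJ0 : (0 : ℝ) ≤ J := by positivity
  have h3 : (m : ℝ) / sb * l ≤ m / sb * (J + 2) := by gcongr; linarith
  have h4 : 0 ≤ Real.logb 2 E / sb * (J + 1) := by positivity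
  rw [add_mul, add_mul]
  linarith

/-- Cost of the improved scalar product. -/
lemma exists_scalImpOps_le (Q : CompressConst) {s₀ sb : ℝ} (hs₀ : 0 < s₀) (hsb : 0 < sb)
    (b₀ : ℝ) :
    ∃ K : ℝ, 1 ≤ K ∧ ∀ (I : Type w) (approx : (I →₀ ℝ) → ℝ → (I →₀ ℝ)), IsApprox approx →
      ∀ B : L2 I →L[ℝ] L2 I, 0 < ‖B‖ → ‖B‖ ≤ b₀ → 0 ≤ Q.cst → ∀ s ∈ Set.Icc s₀ sb,
      ∀ v : I →₀ ℝ, ‖toL2 v‖ = 1 → ∀ δ : ℝ, 0 < δ →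
        (scalImpOps approx sb B Q v δ : ℝ)
          ≤ K * ((nnz v + (normA s (toL2 v) / √δ) ^ (1 / s))
            * (1 + (normA s (toL2 v) / √δ) ^ (1 / (s + sb)))) := by
  obtain ⟨E, hE, m, htol⟩ := exists_inv_scalTol_le.{w} Q hsb b₀
  set r : ℝ := (2 : ℝ) ^ (-(1 / 2) : ℝ) with hr
  have hr0 : 0 < r := by positivity
  have hr1 : r < 1 := Real.rpow_lt_one_of_one_lt_of_neg one_lt_two (by norm_num)
  set m' : ℕ := ⌈(m : ℝ) / sb⌉₊ with hm'
  have hsum := summable_add_one_pow_mul_geometric m' hr0 hr1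
  set S : ℝ := ∑' l : ℕ, ((l : ℝ) + 1) ^ m' * r ^ l with hS
  have hS0 : 0 ≤ S := tsum_nonneg fun l => by positivity
  set F : ℝ := Real.logb 2 E / sb + m / sb + 3 with hF
  have he : 0 ≤ Real.logb 2 E := Real.logb_nonneg one_lt_two hE
  have hF0 : 0 ≤ F := by positivity
  set G : ℝ := (2 : ℝ) ^ (sb / s₀) with hG
  have hG1 : 1 ≤ G := Real.one_le_rpow one_le_two (by positivity)
  set E' : ℝ := E ^ (1 / sb) with hE'
  have hE1 : 1 ≤ E' := Real.one_le_rpow hE (by positivity)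
  have hC0 : 0 ≤ 4 * G * 38 * E' * S := by positivity
  refine ⟨256 + 256 * F + 4 * G * 38 * E' * S, by linarith, ?_⟩
  intro I approx ha B hB hB0 hcst s hs v hv δ hδ
  have hs' : 0 < s := hs₀.trans_le hs.1
  have hd : 0 < √δ := Real.sqrt_pos.2 hδ
  have hV : 1 ≤ normA s (toL2 v) := by rw [← hv]; exact norm_le_normA _
  have htol' := htol I B hB hB0 hcst δ hδ
  have hζ : ∀ l, 0 < scalTol sb Q δ l / applyConst sb B Q := fun l =>
    div_pos (scalTol_pos Q hδ l) (applyConst_pos hB hcst)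
  have hsq := levels_add_two_sq_le hs' hs.2 hv hd
  have hentry := fun l => applyEntryOps_le ha hs' hs.2 hv (hζ l)
  have hp0 := nnz_piece_zero_le (sb := sb) ha v hd
  have hp1 := fun j => nnz_piece_succ_le ha hs' hsb v hd j
  have hlev := fun (l : ℕ) (hl : l ≤ levels sb v (√δ) + 1) =>
    levels_scalTol_le hsb hE (hζ l) hd hv hl (htol' l)
  set V := normA s (toL2 v) with hV_def
  set q : ℝ := 1 / (s + sb) with hq
  have hq0 : 0 < q := by positivity
  have hqsb : q ≤ 1 / sb := by
    rw [hq]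
    exact one_div_le_one_div_of_le hsb (by linarith)
  set t : ℝ := V / √δ with ht
  have ht0 : 0 < t := by positivity
  set J := levels sb v (√δ) with hJ
  set n : ℝ := (nnz v : ℝ) with hn
  have hn0 : 0 ≤ n := by positivity
  have hT0 : 0 ≤ t ^ (1 / s) := by positivity
  have hQ0 : 0 ≤ t ^ q := by positivity
  -- the thresholded versions of `v` for `√δ` and for the tolerances of all pieces
  have hJ2 : (J : ℝ) + 2 ≤ ((J : ℝ) + 2) ^ 2 := by
    have : (0 : ℝ) ≤ J := by positivity
    nlinarith
  have part1 : (pieceOps sb v (√δ) : ℝ) ≤ 256 * (n * (1 + t ^ q)) := by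
    unfold pieceOps
    push_cast
    calc ((J : ℝ) + 2) * (2 * n) ≤ (128 * (1 + t ^ q)) * (2 * n) := by
          gcongr
          exact hJ2.trans hsq
      _ = _ := by ring
  have part2 : ∑ l ∈ range (J + 2), (pieceOps sb v (scalTol sb Q δ l / applyConst sb B Q) : ℝ)
      ≤ 256 * F * (n * (1 + t ^ q)) := by
    have h1 : ∀ l ∈ range (J + 2),
        (pieceOps sb v (scalTol sb Q δ l / applyConst sb B Q) : ℝ)
          ≤ F * ((J : ℝ) + 2) * (2 * n) := by
      intro l hl
      unfold pieceOps
      push_cast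
      gcongr
      exact hlev l (by have := Finset.mem_range.1 hl; omega)
    refine (Finset.sum_le_sum h1).trans ?_
    rw [Finset.sum_const, Finset.card_range, nsmul_eq_mul]
    push_cast
    calc ((J : ℝ) + 2) * (F * ((J : ℝ) + 2) * (2 * n)) = F * (2 * n) * ((J : ℝ) + 2) ^ 2 := by
          ring
      _ ≤ F * (2 * n) * (128 * (1 + t ^ q)) := by gcongr
      _ = _ := by ring
  -- the entries of the approximations to `B v` on the supports of the pieces
  have hpiece : ∀ l, (nnz (piece approx sb v (√δ) l) : ℝ)
      ≤ 4 * (n + t ^ (1 / s)) * G * (2 : ℝ) ^ (-((l : ℝ) * sb / s)) := by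
    intro l
    cases l with
    | zero =>
      have h1 : (nnz (piece approx sb v (√δ) 0) : ℝ) ≤ n := by rw [hn]; exact_mod_cast hp0
      simp only [Nat.cast_zero, zero_mul, zero_div, neg_zero, Real.rpow_zero, mul_one]
      have h2 : 4 * (n + t ^ (1 / s)) ≤ 4 * (n + t ^ (1 / s)) * G :=
        le_mul_of_one_le_right (by positivity) hG1
      linarith
    | succ j =>
      have h2 : (2 : ℝ) ^ (-((j : ℝ) * sb / s))
          ≤ G * (2 : ℝ) ^ (-(((j + 1 : ℕ) : ℝ) * sb / s)) := by
        rw [hG, ← Real.rpow_add two_pos]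
        refine Real.rpow_le_rpow_of_exponent_le one_le_two ?_
        have h3 : sb / s ≤ sb / s₀ := by
          have := hs.1
          gcongr
        push_cast
        rw [add_mul, one_mul, add_div]
        linarith
      calc _ ≤ 4 * (t ^ (1 / s) * (2 : ℝ) ^ (-((j : ℝ) * sb / s))) := hp1 j
        _ ≤ 4 * ((n + t ^ (1 / s)) * (G * (2 : ℝ) ^ (-(((j + 1 : ℕ) : ℝ) * sb / s)))) := by
            gcongr
            linarith
        _ = _ := by ring
  have hops : ∀ l : ℕ,
      (applyEntryOps approx sb v (scalTol sb Q δ l / applyConst sb B Q) : ℝ) + 2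
        ≤ 38 * (E' * ((l : ℝ) + 1) ^ m' * (2 : ℝ) ^ ((l : ℝ) * sb * q) * (1 + t ^ q)) := by
    intro l
    have hl1 : (1 : ℝ) ≤ (l : ℝ) + 1 := by linarith [Nat.cast_nonneg (α := ℝ) l]
    have h1 : V / (scalTol sb Q δ l / applyConst sb B Q)
        ≤ E * ((l : ℝ) + 1) ^ m * (2 : ℝ) ^ ((l : ℝ) * sb) * t := by
      calc V / (scalTol sb Q δ l / applyConst sb B Q)
          = V * (scalTol sb Q δ l / applyConst sb B Q)⁻¹ := by rw [div_eq_mul_inv]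
        _ ≤ V * (E * ((l : ℝ) + 1) ^ m * (2 : ℝ) ^ ((l : ℝ) * sb) * (√δ)⁻¹) := by
            gcongr
            exact htol' l
        _ = _ := by rw [ht, div_eq_mul_inv]; ring
    have h2 : (V / (scalTol sb Q δ l / applyConst sb B Q)) ^ q
        ≤ E' * ((l : ℝ) + 1) ^ m' * (2 : ℝ) ^ ((l : ℝ) * sb * q) * t ^ q := by
      have hζl := hζ l
      refine (Real.rpow_le_rpow (by positivity) h1 hq0.le).trans ?_
      rw [Real.mul_rpow (by positivity) ht0.le, Real.mul_rpow (by positivity) (by positivity),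
        Real.mul_rpow (by positivity) (by positivity), ← Real.rpow_mul two_pos.le]
      gcongr
      · exact Real.rpow_le_rpow_of_exponent_le hE hqsb
      · rw [← Real.rpow_natCast, ← Real.rpow_mul (by positivity), ← Real.rpow_natCast]
        refine Real.rpow_le_rpow_of_exponent_le hl1 ?_
        calc (m : ℝ) * q ≤ m * (1 / sb) := by gcongr
          _ = m / sb := by ring
          _ ≤ m' := Nat.le_ceil _
    have h3 : 1 ≤ E' * ((l : ℝ) + 1) ^ m' * (2 : ℝ) ^ ((l : ℝ) * sb * q) :=
      one_le_mul_of_one_le_of_one_le (one_le_mul_of_one_le_of_one_le hE1 (one_le_pow₀ hl1))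
        (Real.one_le_rpow one_le_two (by positivity))
    have h4 := hentry l
    rw [mul_add (E' * ((l : ℝ) + 1) ^ m' * (2 : ℝ) ^ ((l : ℝ) * sb * q)), mul_one]
    have h5 : 0 ≤ (V / (scalTol sb Q δ l / applyConst sb B Q)) ^ q := by
      have hζl := hζ l
      positivity
    linarith
  have part3 : ∑ l ∈ range (J + 2), (nnz (piece approx sb v (√δ) l) : ℝ)
      * ((applyEntryOps approx sb v (scalTol sb Q δ l / applyConst sb B Q) : ℝ) + 2)
      ≤ 4 * G * 38 * E' * S * ((n + t ^ (1 / s)) * (1 + t ^ q)) := by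
    have h1 : ∀ l ∈ range (J + 2), (nnz (piece approx sb v (√δ) l) : ℝ)
        * ((applyEntryOps approx sb v (scalTol sb Q δ l / applyConst sb B Q) : ℝ) + 2)
        ≤ 4 * G * 38 * E' * ((n + t ^ (1 / s)) * (1 + t ^ q))
          * (((l : ℝ) + 1) ^ m' * r ^ l) := by
      intro l _
      have h2 := two_rpow_mul_two_rpow_le hs' hs.2 l
      calc _ ≤ (4 * (n + t ^ (1 / s)) * G * (2 : ℝ) ^ (-((l : ℝ) * sb / s)))
            * (38 * (E' * ((l : ℝ) + 1) ^ m' * (2 : ℝ) ^ ((l : ℝ) * sb * q) * (1 + t ^ q))) := by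
            refine mul_le_mul (hpiece l) (hops l) (by positivity) (by positivity)
        _ = 4 * G * 38 * E' * ((n + t ^ (1 / s)) * (1 + t ^ q)) * (((l : ℝ) + 1) ^ m'
            * ((2 : ℝ) ^ (-((l : ℝ) * sb / s)) * (2 : ℝ) ^ ((l : ℝ) * sb * q))) := by ring
        _ ≤ _ := by gcongr
    refine (Finset.sum_le_sum h1).trans ?_
    rw [← Finset.mul_sum]
    have h3 : ∑ l ∈ range (J + 2), ((l : ℝ) + 1) ^ m' * r ^ l ≤ S :=
      hsum.sum_le_tsum _ fun l _ => by positivity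
    calc _ ≤ 4 * G * 38 * E' * ((n + t ^ (1 / s)) * (1 + t ^ q)) * S := by gcongr
      _ = _ := by ring
  unfold scalImpOps
  push_cast
  rw [Finset.sum_add_distrib]
  have h6 : n * (1 + t ^ q) ≤ (n + t ^ (1 / s)) * (1 + t ^ q) := by
    gcongr
    linarith
  have h7 : 256 * F * (n * (1 + t ^ q)) ≤ 256 * F * ((n + t ^ (1 / s)) * (1 + t ^ q)) := by
    gcongr
  rw [add_mul, add_mul]
  linarith

/-! ### Total cost -/

/-- Cost of the improved scalar product for a vector whose size is quasi-optimal. -/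
lemma scalImpOps_le_of_le {o n V K K₁ c s₀ s sb U ε h : ℝ} (hs₀ : 0 < s₀) (hs : s₀ ≤ s)
    (hsb : 0 < sb) (hK : 1 ≤ K) (hK₁ : 1 ≤ K₁) (hc : 1 ≤ c) (hU : 1 ≤ U) (hε : 0 < ε)
    (hε1 : ε ≤ 1) (hh : 0 < h) (hV0 : 0 ≤ V)
    (ho : o ≤ K * ((n + (V / h) ^ (1 / s)) * (1 + (V / h) ^ (1 / (s + sb)))))
    (hV : V ≤ K₁ * U) (hn : n ≤ K₁ * (U / ε) ^ (1 / s)) (hεh : ε ≤ c * h) :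
    o ≤ K * (K₁ + (K₁ * c) ^ (1 / s₀)) * (1 + (K₁ * c) ^ (1 / s₀))
      * (U / ε) ^ (1 / s + 1 / (s + sb)) := by
  have hs' : 0 < s := hs₀.trans_le hs
  have hUε : 1 ≤ U / ε := by rw [one_le_div hε]; linarith
  have hK1c : 1 ≤ K₁ * c := one_le_mul_of_one_le_of_one_le hK₁ hc
  have hle : V / h ≤ K₁ * c * (U / ε) := by
    rw [div_le_iff₀ hh]
    calc V ≤ K₁ * U := hV
      _ = K₁ * (U / ε) * ε := by field_simp
      _ ≤ K₁ * (U / ε) * (c * h) := by gcongr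
      _ = _ := by ring
  have h1 : (V / h) ^ (1 / s) ≤ (K₁ * c) ^ (1 / s₀) * (U / ε) ^ (1 / s) :=
    (Real.rpow_le_rpow (by positivity) hle (by positivity)).trans
      (mul_rpow_one_div_le hs₀ hs (by positivity) hK1c)
  have h2 : (V / h) ^ (1 / (s + sb)) ≤ (K₁ * c) ^ (1 / s₀) * (U / ε) ^ (1 / (s + sb)) :=
    (Real.rpow_le_rpow (by positivity) hle (by positivity)).trans
      (mul_rpow_one_div_le hs₀ (by linarith) (by positivity) hK1c)
  have hq1 : 1 ≤ (U / ε) ^ (1 / (s + sb)) := Real.one_le_rpow hUε (by positivity)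
  rw [Real.rpow_add (by positivity)]
  refine ho.trans ?_
  have hq'0 : 0 ≤ (V / h) ^ (1 / (s + sb)) := by positivity
  generalize (V / h) ^ (1 / s) = T' at *
  generalize (V / h) ^ (1 / (s + sb)) = q' at *
  have hT0 : 0 ≤ (U / ε) ^ (1 / s) := by positivity
  generalize (U / ε) ^ (1 / s) = T at *
  generalize (U / ε) ^ (1 / (s + sb)) = q at *
  have hb0 : 0 ≤ (K₁ * c) ^ (1 / s₀) := by positivity
  generalize (K₁ * c) ^ (1 / s₀) = b at *
  have hq0 : 0 ≤ q := by linarith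
  calc K * ((n + T') * (1 + q')) ≤ K * ((K₁ * T + b * T) * (1 * q + b * q)) := by
        gcongr
        linarith
    _ = _ := by ring

namespace Data.Admissible

/-- The cost estimate for exponents in a compact subinterval `[s₀, s̄]`. -/
lemma exists_lamStarOps_le {P : Params} (hP : P.Valid) {s₀ : ℝ} (hs₀ : 0 < s₀) :
    ∃ K : ℝ, 1 ≤ K ∧ ∀ (I : Type w) [Nontrivial I] (D : Data I), D.Admissible P →
      ∀ s ∈ Set.Icc s₀ P.sbar, MemA s D.u → ∀ ε : ℝ, 0 < ε → ε ≤ 1 →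
        (D.lamStarOps P ε : ℝ) ≤ K * (normA s D.u / ε) ^ (1 / s + 1 / (s + P.sbar)) := by
  obtain ⟨K₁, hK₁, heig⟩ := exists_eigOps_le.{w} hP hs₀
  obtain ⟨KA, hKA, hA⟩ := exists_scalImpOps_le.{w} P.compA hs₀ hP.sbar_pos P.Gam
  obtain ⟨KC, hKC, hC⟩ := exists_scalImpOps_le.{w} P.compC hs₀ hP.sbar_pos P.CC
  obtain ⟨c, hc, hcη⟩ := exists_raylTol_ge hP one_pos
  have hcC := hP.cC_pos
  have hG := hP.Gam_pos
  set cA : ℝ := max 1 (c * (2 / P.cC)) with hcA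
  set cB : ℝ := max 1 (c * (6 * P.Gam / P.cC ^ 2)) with hcB
  have hA1 : 1 ≤ cA := le_max_left _ _
  have hB1 : 1 ≤ cB := le_max_left _ _
  set ZA : ℝ := KA * (K₁ + (K₁ * cA) ^ (1 / s₀)) * (1 + (K₁ * cA) ^ (1 / s₀)) with hZA
  set ZB : ℝ := KC * (K₁ + (K₁ * cB) ^ (1 / s₀)) * (1 + (K₁ * cB) ^ (1 / s₀)) with hZB
  have hZA0 : 0 ≤ ZA := by positivity
  have hZB0 : 0 ≤ ZB := by positivity
  refine ⟨K₁ + ZA + ZB + 1, by linarith, ?_⟩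
  intro I _ D h s hs hu ε hε hε1
  have hs' : 0 < s := hs₀.trans_le hs.1
  have hU := h.one_le_normA s
  obtain ⟨e1, e2, e3⟩ := heig I D h s hs hu ε hε hε1
  obtain ⟨u1, -, -⟩ := h.uEps_spec hP hε
  have hε2 : 0 < ε ^ 2 := by positivity
  have ht := raylTol_pos hP hε2
  have hτ := hcη (ε ^ 2) hε2 (pow_le_one₀ hε.le hε1)
  have hV0 := normA_nonneg (s := s) (toL2 (D.uEps P ε))
  -- the accuracy `ε²` corresponds to the truncation threshold `√δ ≈ ε`
  have hsqrt : ∀ {e δ : ℝ}, 0 < δ → ε ^ 2 ≤ e * δ → ε ≤ max 1 e * √δ := by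
    intro e δ hδ hle
    refine le_of_sq_le_sq ?_ (by positivity)
    rw [mul_pow, Real.sq_sqrt hδ.le]
    refine hle.trans ?_
    gcongr
    calc e ≤ max 1 e := le_max_right _ _
      _ ≤ max 1 e ^ 2 := le_self_pow₀ (le_max_left _ _) two_ne_zero
  have hδA : 0 < raylTol P (ε ^ 2) * P.cC / 2 := by positivity
  have hδC : 0 < P.cC ^ 2 * raylTol P (ε ^ 2) / (6 * P.Gam) := by positivity
  have fA := scalImpOps_le_of_le hs₀ hs.1 hP.sbar_pos hKA hK₁ hA1 hU hε hε1
    (Real.sqrt_pos.2 hδA) hV0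
    (hA I D.approx h.approx_spec D.A (h.opNorm_A_pos hP) (h.opNorm_A_le hP) h.A_comp.cst_nonneg
      s hs _ u1 _ hδA) e1 e2 (hsqrt hδA (hτ.trans (le_of_eq (by field_simp))))
  have fC := scalImpOps_le_of_le hs₀ hs.1 hP.sbar_pos hKC hK₁ hB1 hU hε hε1
    (Real.sqrt_pos.2 hδC) hV0
    (hC I D.approx h.approx_spec D.C h.opNorm_C_pos (h.opNorm_C_le hP) h.C_comp.cst_nonneg
      s hs _ u1 _ hδC) e1 e2 (hsqrt hδC (hτ.trans (le_of_eq (by field_simp))))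
  have h1 : 1 ≤ (normA s D.u / ε) ^ (1 / s + 1 / (s + P.sbar)) := by
    have := hP.sbar_pos
    refine Real.one_le_rpow ?_ (by positivity)
    rw [one_le_div hε]
    linarith
  unfold Data.lamStarOps raylOps
  push_cast
  rw [add_mul, add_mul, add_mul]
  linarith

end Data.Admissible

theorem mainTheorem6 (P : Params) (hP : P.Valid) :
    ∃ Const : ℝ, ∀ (I : Type w) [Nontrivial I] (D : Data I), D.Admissible P →
      (∀ ε : ℝ, 0 < ε →
        |P.lam - D.lamStar P ε| ≤ (1 + 2 * P.Gam * P.K / P.gam) * ε ^ 2) ∧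
      ∀ s : ℝ, 0 < s → s ≤ P.sbar → MemA s D.u → ∀ ε : ℝ, 0 < ε → ε ≤ 1 →
        (D.lamStarOps P ε : ℝ) ≤
          Const * normA s D.u ^ ((2 * s + P.sbar) / (s * (s + P.sbar)))
            * ε ^ (-((P.sbar + 2 * s) / (s * (P.sbar + s)))) ∧
        (D.lamStarOps P ε : ℝ) ≤
          Const * normA s D.u ^ ((2 * s + P.sbar) / (s * (s + P.sbar)))
            * ε ^ (-(3 / (2 * s))) := by
  obtain ⟨s₀, hs₀, hs₀b, U₀, hU₀, hreg⟩ := Data.Admissible.exists_memA.{w} hP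
  obtain ⟨K, hK, hops⟩ := Data.Admissible.exists_lamStarOps_le.{w} hP hs₀
  have hsb := hP.sbar_pos
  set p₀ : ℝ := 1 / s₀ + 1 / (s₀ + P.sbar) with hp₀
  have hp₀0 : 0 ≤ p₀ := by positivity
  have hU₀p : 1 ≤ U₀ ^ p₀ := Real.one_le_rpow hU₀ hp₀0
  refine ⟨K * U₀ ^ p₀, fun I _ D h => ⟨fun ε hε => h.abs_lam_sub_lamStar_le hP hε, ?_⟩⟩
  intro s hs hsle hu ε hε hε1
  have hU := h.one_le_normA s
  have hp1 : (2 * s + P.sbar) / (s * (s + P.sbar)) = 1 / s + 1 / (s + P.sbar) := by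
    field_simp
    ring
  have hp2 : (P.sbar + 2 * s) / (s * (P.sbar + s)) = 1 / s + 1 / (s + P.sbar) := by
    field_simp
    ring
  rw [hp1, hp2]
  set p : ℝ := 1 / s + 1 / (s + P.sbar) with hp
  have hp0 : 0 ≤ p := by positivity
  have hUp : 1 ≤ normA s D.u ^ p := Real.one_le_rpow hU hp0
  have hmain : (D.lamStarOps P ε : ℝ) ≤ K * U₀ ^ p₀ * normA s D.u ^ p * ε ^ (-p) := by
    rcases le_or_gt s₀ s with h1 | h1
    · have h2 := hops I D h s ⟨h1, hsle⟩ hu ε hε hε1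
      rw [Real.div_rpow (by linarith) hε.le, div_eq_mul_inv, ← Real.rpow_neg hε.le] at h2
      calc _ ≤ K * 1 * normA s D.u ^ p * ε ^ (-p) := by
            rw [mul_one, mul_assoc]; exact h2
        _ ≤ _ := by gcongr
    · -- for small `s` the automatic regularity gives the stronger estimate
      obtain ⟨r1, r2⟩ := hreg I D h
      have h2 := hops I D h s₀ ⟨le_rfl, hs₀b⟩ r1 ε hε hε1
      have h3 := h.one_le_normA s₀
      rw [Real.div_rpow (by linarith) hε.le, div_eq_mul_inv, ← Real.rpow_neg hε.le] at h2
      have h4 : ε ^ (-p₀) ≤ ε ^ (-p) := by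
        refine Real.rpow_le_rpow_of_exponent_ge hε hε1 (neg_le_neg ?_)
        rw [hp₀, hp]
        gcongr
      calc _ ≤ K * (U₀ ^ p₀ * ε ^ (-p)) := by
            refine h2.trans ?_
            gcongr
        _ = K * U₀ ^ p₀ * 1 * ε ^ (-p) := by ring
        _ ≤ _ := by gcongr
  refine ⟨hmain, hmain.trans ?_⟩
  have hexp : p ≤ 3 / (2 * s) := by
    rw [hp, div_add_div _ _ hs.ne' (by positivity), div_le_div_iff₀ (by positivity) (by positivity)]
    nlinarith [mul_pos hs hs, mul_pos hs hsb]
  gcongr ?_ * ?_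
  exact Real.rpow_le_rpow_of_exponent_ge hε hε1 (neg_le_neg hexp)
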